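/- Setup. Let $k$ be a non-archimedean local field with residue field $\mathbb F_q$, $\breve k$ the completion of a maximal unramified extension of $k$, with residue field $\overline{\mathbb F}_q$, and let $F$ denote the action of the Frobenius of $\breve k/k$. Let $G$ be an unramified reductive group over $k$ (quasi-split over $k$, split over $\breve k$) such that the Dynkin diagram of $G_{\breve k}$ is non-empty and connected. Let $T\subseteq G$ be a $k$-rational, $\breve k$-split maximal torus and $B\supseteq T$ a Borel subgroup, with set of simple roots $\Delta_0\subset\Phi=\Phi(T,G)\subset X^*(T)$. Let $W=N_G(T)/T$. A choice of simple roots $\Delta\subset\Phi$ makes $W$ a Coxeter group with length function $\ell=\ell_\Delta$. For an automorphism $\sigma$ with $\sigma(\Delta)=\Delta$, put $\sigma(w)=\sigma w\sigma^{-1}$; one calls $c\sigma$, with $c\in W$, a twisted Coxeter element of $(W,\sigma)$ if a reduced expression of $c$ contains precisely one simple reflection from each $\sigma$-orbit of simple reflections. In that case the Coxeter number $h$ of $(W,\sigma)$ is the order of $c\sigma$ acting on $\Phi$. Assume that $(T,B)$ is a Coxeter pair: there are a $k$-rational Borel subgroup $B_0$ of $G$, a $k$-rational maximal torus $T_0\subseteq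 B_0$ and $g\in G(\breve k)$ with ${}^g(T_0,B_0)=(T,B)$ such that, with $w$ the image of $g^{-1}F(g)$ in $W_0=N_G(T_0)/T_0$ and $\sigma_0$ the automorphism of $W_0$ induced by $F$, the element $w\sigma_0$ is a twisted Coxeter element of $(W_0,\sigma_0)$ with respect to the simple reflections determined by $B_0$. Let $T_1$ be the torus over $\overline{\mathbb F}_q$ obtained by reduction from the standard integral model of $T$. Thus $X^*(T_1)=X^*(T)$, $X_*(T_1)=X_*(T)$, and $T_1$ has a geometric Frobenius $F\colon T_1\to T_1$. This acts on $X^*(T_1)=X^*(T)$ by $\chi\mapsto\chi\circ F$. For $\nu\in X_*(T_1)$ put $$H_\nu=\{t\in T_1 : t^{-1}F(t)\in \operatorname{im}(\nu\colon\mathbb G_m\to T_1)\},$$ and let $H_\nu^\circ$ be its identity component. For $\alpha$ in a set of simple roots $\Delta$, let $\alpha^*\in X_*(T^{\rm ad})_{\mathbb Q}$ be the corresponding fundamental coweight, i.e. $\langle\beta,\alpha^*\rangle=\delta_{\alpha\beta}$ for $\beta\in\Delta$, and let $H^\circ_{\alpha^*}$ denote $H_\nu^\circ$ for any $\nu\in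 X_*(T_1)$ that is a non-zero integral multiple of a lift of $\alpha^*$ to $X_*(T)_{\mathbb Q}$. Let $\alpha_0$ be the highest root with respect to $\Delta_0$, and $M=\max_{\alpha\in\Delta_0}\langle\alpha_0,\alpha^*\rangle$. Proposition 6.2. Assume $q>M$. Then there exists a set of simple roots $\Delta\subset\Phi(T,G)$ such that: (i) $F$ acts on $X^*(T)$ as $q\,c\sigma$, where $\sigma(\Delta)=\Delta$, $c\in W$, and $c\sigma$ is a twisted Coxeter element of $(W,\sigma)$ such that $$\ell\bigl(c\,\sigma(c)\cdots\sigma^{i-1}(c)\bigr)=i\,\ell(c)\qquad\text{for all integers } 0\le i\le h/2,$$ where $h$ is the Coxeter number of $(W,\sigma)$; (ii) for all $\alpha\in\Delta$ and all $\gamma\in\Phi(T,G)$ one has $H_{\alpha^*}^\circ\not\subseteq\ker(\gamma)$; this holds for every choice of $\nu$ as above. -/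

import Mathlib

noncomputable section

namespace CoxeterTorus

open scoped Matrix

/-! ## Linear algebraic groups over an algebraically closed field `Ω`

A linear algebraic group is a Zariski closed subgroup of some `GL_n(Ω)`; the ambient field `Ω`
is an algebraic closure of the complete field over which the groups split. -/

section AlgebraicGroups

variable {n : ℕ} {Ω : Type*} [Field Ω]

/-- The ideal of all polynomials in the matrix entries that vanish on `H`. -/
def vanishing (H : Subgroup (GL (Fin n) Ω)) : Ideal (MvPolynomial (Fin n × Fin n) Ω) where
  carrier := {f | ∀ g ∈ H, MvPolynomial.eval (fun p => (g : Matrix (Fin n) (Fin n) Ω) p.1 p.2) f = 0}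
  add_mem' := fun ha hb g hg => by rw [map_add, ha g hg, hb g hg, add_zero]
  zero_mem' := fun _ _ => map_zero _
  smul_mem' := fun c f hf g hg => by rw [smul_eq_mul, map_mul, hf g hg, mul_zero]

/-- `H` is the zero set in `GL_n(Ω)` of the polynomials vanishing on it. -/
def IsClosedSubgroup (H : Subgroup (GL (Fin n) Ω)) : Prop :=
  ∀ g : GL (Fin n) Ω,
    (∀ f ∈ vanishing H,
      MvPolynomial.eval (fun p => (g : Matrix (Fin n) (Fin n) Ω) p.1 p.2) f = 0) → g ∈ H

/-- A closed subgroup is connected if it has no proper closed subgroup of finite index. -/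
def IsConnectedSubgroup (H : Subgroup (GL (Fin n) Ω)) : Prop :=
  ∀ H' : Subgroup (GL (Fin n) Ω), IsClosedSubgroup H' → H' ≤ H → H'.relIndex H ≠ 0 → H' = H

/-- The algebraic group `H` is defined over the subfield `k`: it is closed and its vanishing ideal
is generated by polynomials with coefficients in `k`. -/
def IsDefinedOver (k : Type*) [Field k] [Algebra k Ω] (H : Subgroup (GL (Fin n) Ω)) : Prop :=
  IsClosedSubgroup H ∧
    Ideal.map (MvPolynomial.map (σ := Fin n × Fin n) (algebraMap k Ω))
      (Ideal.comap (MvPolynomial.map (algebraMap k Ω)) (vanishing H)) = vanishing H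

/-- Every element of `U` is a unipotent matrix. -/
def IsUnipotentSubgroup (U : Subgroup (GL (Fin n) Ω)) : Prop :=
  ∀ u ∈ U, IsNilpotent ((u : Matrix (Fin n) (Fin n) Ω) - 1)

/-- Connected reductive groups: connected, with trivial unipotent radical. -/
structure IsReductive (G : Subgroup (GL (Fin n) Ω)) : Prop where
  closed : IsClosedSubgroup G
  connected : IsConnectedSubgroup G
  unipotentRadical : ∀ U : Subgroup (GL (Fin n) Ω), U ≤ G → (∀ g ∈ G, ∀ u ∈ U, g * u * g⁻¹ ∈ U) →
    IsClosedSubgroup U → IsConnectedSubgroup U → IsUnipotentSubgroup U → U = ⊥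

/-- A torus: a closed connected group that can be conjugated into the diagonal matrices. -/
structure IsTorus (T : Subgroup (GL (Fin n) Ω)) : Prop where
  closed : IsClosedSubgroup T
  connected : IsConnectedSubgroup T
  diagonalizable : ∃ g : GL (Fin n) Ω, ∀ t ∈ T,
    ((g * t * g⁻¹ : GL (Fin n) Ω) : Matrix (Fin n) (Fin n) Ω).IsDiag

/-- A torus is split over a subfield `K` if it can be diagonalized by a matrix over `K`. -/
def IsSplitOver (K : Type*) [Field K] [Algebra K Ω] (T : Subgroup (GL (Fin n) Ω)) : Prop :=
  ∃ g : GL (Fin n) K, ∀ t ∈ T,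
    ((Matrix.GeneralLinearGroup.map (algebraMap K Ω) g * t *
      (Matrix.GeneralLinearGroup.map (algebraMap K Ω) g)⁻¹ : GL (Fin n) Ω) :
        Matrix (Fin n) (Fin n) Ω).IsDiag

/-- `T` is a maximal torus of `G`. -/
structure IsMaximalTorus (T G : Subgroup (GL (Fin n) Ω)) : Prop where
  torus : IsTorus T
  le : T ≤ G
  maximal : ∀ T' : Subgroup (GL (Fin n) Ω), IsTorus T' → T ≤ T' → T' ≤ G → T' = T

/-- `B` is a Borel subgroup of `G`: maximal among the closed connected solvable subgroups. -/
structure IsBorel (B G : Subgroup (GL (Fin n) Ω)) : Prop where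
  closed : IsClosedSubgroup B
  connected : IsConnectedSubgroup B
  solvable : Group.IsSolvable B
  le : B ≤ G
  maximal : ∀ B' : Subgroup (GL (Fin n) Ω), IsClosedSubgroup B' → IsConnectedSubgroup B' →
    Group.IsSolvable B' → B ≤ B' → B' ≤ G → B' = B

/-- The Lie algebra of `H`: the matrices `N` such that `1 + εN` satisfies, in the dual numbers
`Ω[ε]`, all polynomial equations of `H`. -/
def lieAlg (H : Subgroup (GL (Fin n) Ω)) : Set (Matrix (Fin n) (Fin n) Ω) :=
  {N | ∀ f ∈ vanishing H,
    MvPolynomial.aeval (fun p : Fin n × Fin n =>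
      (TrivSqZeroExt.inl ((1 : Matrix (Fin n) (Fin n) Ω) p.1 p.2) + TrivSqZeroExt.inr (N p.1 p.2) :
        DualNumber Ω)) f = 0}

/-- `χ : T → Ωˣ` is algebraic: it is given by a polynomial in the matrix entries divided by a power
of the determinant. -/
def IsAlgebraicCharacter {T : Subgroup (GL (Fin n) Ω)} (χ : T →* Ωˣ) : Prop :=
  ∃ (f : MvPolynomial (Fin n × Fin n) Ω) (m : ℕ), ∀ t : T,
    (χ t : Ω) * ((t : GL (Fin n) Ω) : Matrix (Fin n) (Fin n) Ω).det ^ m =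
      MvPolynomial.eval (fun p => ((t : GL (Fin n) Ω) : Matrix (Fin n) (Fin n) Ω) p.1 p.2) f

/-- `χ` belongs to `Φ(T, H)`: it is a non-trivial weight of `T` on the Lie algebra of `H`. -/
def IsWeight (H : Subgroup (GL (Fin n) Ω)) {T : Subgroup (GL (Fin n) Ω)} (χ : T →* Ωˣ) : Prop :=
  χ ≠ 1 ∧ ∃ N ∈ lieAlg H, N ≠ 0 ∧ ∀ t : T,
    ((t : GL (Fin n) Ω) : Matrix (Fin n) (Fin n) Ω) * N *
      (((t : GL (Fin n) Ω)⁻¹ : GL (Fin n) Ω) : Matrix (Fin n) (Fin n) Ω) = (χ t : Ω) • N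

end AlgebraicGroups

/-! ## Weyl groups, length and twisted Coxeter elements of a root datum -/

section RootData

variable {ι X Y : Type*} [AddCommGroup X] [AddCommGroup Y] {P : RootPairing ι ℤ X Y}

/-- The Weyl group, as a group of automorphisms of `X`. -/
def weyl (P : RootPairing ι ℤ X Y) : Subgroup (X ≃ₗ[ℤ] X) :=
  Subgroup.closure (Set.range P.reflection)

/-- `l` is a word in the simple reflections of `Δ`, with product `w`. -/
def IsWord (Δ : P.Base) (l : List ι) (w : X ≃ₗ[ℤ] X) : Prop :=
  (∀ i ∈ l, i ∈ Δ.support) ∧ (l.map P.reflection).prod = w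

/-- The length of `w ∈ W` with respect to the simple reflections of `Δ`. -/
def len (Δ : P.Base) (w : X ≃ₗ[ℤ] X) : ℕ :=
  sInf {m | ∃ l : List ι, IsWord Δ l w ∧ l.length = m}

/-- `c ∈ W` is a twisted Coxeter element for the permutation `σ` of `Δ`: it has a reduced expression
that contains, counted with multiplicity, precisely one simple reflection from each `σ`-orbit. -/
def IsTwistedCoxeter (Δ : P.Base) (σ c : X ≃ₗ[ℤ] X) : Prop :=
  ∃ l : List ι, IsWord Δ l c ∧ l.length = len Δ c ∧ l.Nodup ∧
    ∀ j ∈ Δ.support, ∃! i, i ∈ l ∧ ∃ m : ℤ, (σ ^ m) (P.root j) = P.root i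

/-- The partial product `c σ(c) ⋯ σ^{i-1}(c)`, where `σ` acts on the Weyl group by conjugation. -/
def partialProd (σ c : X ≃ₗ[ℤ] X) (i : ℕ) : X ≃ₗ[ℤ] X :=
  ((List.range i).map fun j => σ ^ j * c * (σ ^ j)⁻¹).prod

/-- The order of an automorphism of the root datum, acting on the roots. For `τ = wσ` with `W`
irreducible and `w` twisted Coxeter, this is the Coxeter number of `(W, σ)`. -/
def orderOnRoots (P : RootPairing ι ℤ X Y) (τ : X ≃ₗ[ℤ] X) : ℕ :=
  sInf {m | 0 < m ∧ ∀ i, (τ ^ m) (P.root i) = P.root i}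

/-- The Dynkin diagram of `Δ` is non-empty and connected. -/
def IsConnectedDynkin (Δ : P.Base) : Prop :=
  Δ.support.Nonempty ∧ ∀ S ⊆ Δ.support, S.Nonempty → S ≠ Δ.support →
    ∃ i ∈ S, ∃ j ∈ Δ.support, j ∉ S ∧ P.pairing i j ≠ 0

/-- The fundamental coweight `α*`, for `α ∈ Δ`. It is an element of the cocharacter group
`Hom(ℤΦ, ℤ)` of the adjoint torus; these elements form the basis dual to `Δ`. -/
def fundCoweight (Δ : P.Base) (α : Δ.support) : P.rootSpan ℤ →ₗ[ℤ] ℤ :=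
  Δ.toWeightBasisInt.coord α

/-- `i₀` is the highest root: its difference with any root is a sum of simple roots. -/
def IsHighestRoot (Δ : P.Base) (i₀ : ι) : Prop :=
  ∀ j, P.root i₀ - P.root j ∈ AddSubmonoid.closure (P.root '' Δ.support)

/-- `M = max_{α ∈ Δ} ⟨α₀, α*⟩`, where `α₀` is the root with index `i₀`. -/
def maxMark (Δ : P.Base) (i₀ : ι) : ℤ :=
  ⨆ α : Δ.support, fundCoweight Δ α (P.rootSpanMem ℤ i₀)

/-- `ν ∈ Y = X_*(T)` is a non-zero integral multiple `m` of a lift to `X_*(T)_ℚ` of the fundamental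
coweight `α*`. -/
def IsCoweightLift (Δ : P.Base) (α : Δ.support) (ν : Y) : Prop :=
  ∃ m : ℤ, m ≠ 0 ∧ ∀ x : P.rootSpan ℤ, P.toLinearMap (x : X) ν = m * fundCoweight Δ α x

end RootData

/-! ## The torus `T₁` over the residue field -/

section SpecialFibre

variable (X : Type*) [AddCommGroup X] (κ : Type*) [Field κ]

/-- The (points of the) torus over the algebraically closed field `κ` with character group `X`. -/
abbrev TorusPts : Type _ := Multiplicative X →* κˣ

variable {X κ}

/-- The Zariski topology: the basic open sets are the non-vanishing loci of the regular functions
`∑ₓ fₓ·x`, the linear combinations of characters `x ∈ X`. -/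
abbrev zariski (X : Type*) [AddCommGroup X] (κ : Type*) [Field κ] : TopologicalSpace (TorusPts X κ) :=
  TopologicalSpace.generateFrom
    {U | ∃ f : X →₀ κ,
      U = {t | (f.sum fun x a => a * (t (Multiplicative.ofAdd x) : κ)) ≠ 0}}

/-- The identity component, for the Zariski topology, of a subset `H` that contains `1`. -/
def idComponent (H : Set (TorusPts X κ)) : Set (TorusPts X κ) :=
  @connectedComponentIn _ (zariski X κ) H 1

/-- The kernel of the character `x`. -/
def kerChar (x : X) : Set (TorusPts X κ) := {t | t (Multiplicative.ofAdd x) = 1}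

/-- The geometric Frobenius of the torus, for the `𝔽_q`-structure on which the Frobenius acts on
characters through `τ`: the character `x` takes at `frob q τ t` the value `((τ x)(t))^q`. -/
def frob (q : ℕ) (τ : X ≃ₗ[ℤ] X) (t : TorusPts X κ) : TorusPts X κ :=
  (t ^ q).comp (AddMonoidHom.toMultiplicative (τ : X →ₗ[ℤ] X).toAddMonoidHom)

variable {ι Y : Type*} [AddCommGroup Y]

/-- The image of the cocharacter `ν ∈ Y`: the points `x ↦ z^⟨x,ν⟩` with `z ∈ κˣ`. -/
def cocharImage (P : RootPairing ι ℤ X Y) (ν : Y) : Set (TorusPts X κ) :=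
  {t | ∃ z : κˣ, ∀ x : X, t (Multiplicative.ofAdd x) = z ^ (P.toLinearMap x ν)}

/-- `H_ν`, the preimage of the image of the cocharacter `ν` under the Lang map `t ↦ t⁻¹F(t)`. -/
def langPreimage (P : RootPairing ι ℤ X Y) (q : ℕ) (τ : X ≃ₗ[ℤ] X) (ν : Y) : Set (TorusPts X κ) :=
  {t | t⁻¹ * frob q τ t ∈ cocharImage P ν}

end SpecialFibre

/-! ## The root datum of a group with a torus, Frobenius, Coxeter pairs -/

section CoxeterPairs

variable {n : ℕ} {Ω : Type*} [Field Ω] {ι X Y : Type*} [AddCommGroup X] [AddCommGroup Y]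

/-- The element `g`, assumed to normalize `T`, acts on `X = X^*(T)` as `w`:
`(w x)(t) = x(g⁻¹ t g)`. -/
def ActsAs {T : Subgroup (GL (Fin n) Ω)} (ch : Multiplicative X →* (T →* Ωˣ)) (g : GL (Fin n) Ω)
    (w : X ≃ₗ[ℤ] X) : Prop :=
  ∀ (x : X) (t t' : T), (t' : GL (Fin n) Ω) = g⁻¹ * t * g →
    ch (Multiplicative.ofAdd (w x)) t = ch (Multiplicative.ofAdd x) t'

/-- `P` is the root datum of `(G, T)`. The map `ch` identifies `X` with the character group `X^*(T)`
(so that `Y`, being in perfect duality with `X`, is `X_*(T)`), the roots are the non-trivial weights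
of `T` on the Lie algebra of `G`, and the Weyl group is `N_G(T)/T` acting on `X^*(T)`; the last
condition determines the coroots. -/
structure IsRootDatumOf (G T : Subgroup (GL (Fin n) Ω)) (P : RootPairing ι ℤ X Y)
    (ch : Multiplicative X →* (T →* Ωˣ)) : Prop where
  reduced : P.IsReduced
  injective : Function.Injective ch
  range : ∀ χ : T →* Ωˣ, IsAlgebraicCharacter χ ↔ ∃ x, ch x = χ
  roots : ∀ x : X, x ∈ Set.range P.root ↔ IsWeight G (ch (Multiplicative.ofAdd x))
  weyl_of_normalizer : ∀ g ∈ G, T.map (MulAut.conj g).toMonoidHom = T →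
    ∃ w ∈ weyl P, ActsAs ch g w
  normalizer_of_weyl : ∀ w ∈ weyl P, ∃ g ∈ G, T.map (MulAut.conj g).toMonoidHom = T ∧ ActsAs ch g w

/-- The base `Δ` is the set of simple roots determined by the Borel subgroup `B ⊇ T`: the
`Δ`-positive roots are the roots of `T` in `B`. -/
def IsBaseOf (B : Subgroup (GL (Fin n) Ω)) {T : Subgroup (GL (Fin n) Ω)} {P : RootPairing ι ℤ X Y}
    (ch : Multiplicative X →* (T →* Ωˣ)) (Δ : P.Base) : Prop :=
  ∀ i, Δ.IsPos i ↔ IsWeight B (ch (Multiplicative.ofAdd (P.root i)))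

/-- The Frobenius `F` on `GL_n`, applying the field automorphism `Fr` to the matrix entries. -/
def frobGL {k : Type*} [Field k] [Algebra k Ω] (Fr : Ω ≃ₐ[k] Ω) : GL (Fin n) Ω →* GL (Fin n) Ω :=
  Matrix.GeneralLinearGroup.map (Fr : Ω →+* Ω)

/-- `τ` is the automorphism of `X = X^*(T)` induced by the Frobenius `F` on the torus `T`:
`x(F(t)) = Fr((τ x)(t))`. -/
def IsFrobAction {k : Type*} [Field k] [Algebra k Ω] (Fr : Ω ≃ₐ[k] Ω)
    {T : Subgroup (GL (Fin n) Ω)} (ch : Multiplicative X →* (T →* Ωˣ)) (τ : X ≃ₗ[ℤ] X) : Prop :=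
  ∀ (x : X) (t t' : T), (t' : GL (Fin n) Ω) = frobGL Fr t →
    (ch (Multiplicative.ofAdd x) t' : Ω) = Fr (ch (Multiplicative.ofAdd (τ x)) t : Ω)

/-- `(T, B)` is a Coxeter pair in `G`. There are a `k`-rational maximal torus `T₀` and a `k`-rational
Borel subgroup `B₀ ⊇ T₀` of `G`, and a `K`-rational `g ∈ G` with `ᵍ(T₀, B₀) = (T, B)`, such that the
image of `g⁻¹F(g)` in the Weyl group of `T₀` is a twisted Coxeter element. Everything is transported
from `T₀` to `T` by `g`: the element `g⁻¹F(g)` becomes `F(g)g⁻¹`, which acts on `X^*(T)` as some `w`,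
and the action of `F` on `X^*(T₀)` becomes `τw`, where `τ` is the action of `F` on `X^*(T)`. -/
def IsCoxeterPair (k K : Type*) [Field k] [Field K] [Algebra k Ω] [Algebra K Ω] (Fr : Ω ≃ₐ[k] Ω)
    (G T B : Subgroup (GL (Fin n) Ω)) {P : RootPairing ι ℤ X Y}
    (ch : Multiplicative X →* (T →* Ωˣ)) (τ : X ≃ₗ[ℤ] X) (Δ : P.Base) : Prop :=
  ∃ (T₀ B₀ : Subgroup (GL (Fin n) Ω)) (gK : GL (Fin n) K) (g : GL (Fin n) Ω) (w : X ≃ₗ[ℤ] X),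
    IsMaximalTorus T₀ G ∧ IsDefinedOver k T₀ ∧
    IsBorel B₀ G ∧ IsDefinedOver k B₀ ∧ T₀ ≤ B₀ ∧
    g = Matrix.GeneralLinearGroup.map (algebraMap K Ω) gK ∧ g ∈ G ∧
    T₀.map (MulAut.conj g).toMonoidHom = T ∧ B₀.map (MulAut.conj g).toMonoidHom = B ∧
    ActsAs ch (frobGL Fr g * g⁻¹) w ∧ IsTwistedCoxeter Δ (τ * w) w

end CoxeterPairs

end CoxeterTorus

end

set_option linter.unusedSectionVars false

noncomputable section

namespace CoxeterTorus
open RootPairing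

/-! ### Automorphisms of a root datum and their action on the root lattice. -/

section Aut

variable {ι X Y : Type*} [AddCommGroup X] [AddCommGroup Y] {P : RootPairing ι ℤ X Y}

/-! Let τ be the action of Frobenius on characters with the factor q removed. Rationality of G, T
and of the pair (T₀, B₀) shows that τ is an automorphism of the root datum of the form cσ, where σ
permutes the simple roots and c is a product of simple reflections, one from each σ-orbit
(`exists_aut_of_frob`, `exists_isCoxWord_of_isCoxeterPair`). The rest concerns such a τ.

Part (i). τ fixes no non-zero vector of the root lattice (`eq_zero_of_fixed`), so orbit sums of
roots vanish and signs change in every orbit. The change from positive to negative happens once per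
turn (`eq_of_transition`): a change at the root i belongs to a letter j of c, and the orbit coweight
ω_j satisfies ω_j∘τ = ω_j − i^∨; two changes in one orbit would put two dominant coweights into one
Weyl orbit. A sequence with sum zero and one run of each sign has a non-zero first Fourier
coefficient (`fourier_ne_zero`). This makes suitable eigenforms of τ non-zero at roots, and it
follows that all orbits have the same size h (`period_eq`). The eigenform built from the height with
ζ = exp(2πi/h) then vanishes at no root. A generic real part of it defines a base in the Weyl orbit
of Δ₀. Along each orbit this form is a sampled sine wave of period h, so for i ≤ h/2 the power τ^i
makes i times as many positive roots negative as τ does (`ncard_pos_neg_pow`). Length counts such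
roots, and τ is still a twisted Coxeter element for the new base (`of_smulBase`).

Part (ii). Choose ψ such that ψ∘(qτ − 1) is a non-zero multiple of ν; the curve z ↦ z^ψ lies in the
identity component of H_ν. If a root γ were trivial on it, the periodic sequence b_k = ψ(τ^k γ)
would vanish at 0 and satisfy q b_{k+1} − b_k = E a_k, where a_k is the α-coefficient of τ^k γ.
Since |a_k| ≤ M < q, all a_k vanish (`eq_zero_of_periodic_recursion`). But in a connected Dynkin
diagram each simple root occurs in every τ-orbit (`IsCoxWord.exists_coef_ne_zero`). -/

lemma root_smul (g : P.Aut) (i : ι) : P.root (g • i) = g • P.root i :=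
  Equiv.root_indexEquiv_eq_smul P i g

lemma coroot'_smul (g : P.Aut) (i : ι) (x : X) : P.coroot' (g • i) (g • x) = P.coroot' i x := by
  have h1 := Hom.weight_coweight_transpose_apply P P (P.coroot (g • i)) g.toHom
  have h2 := Hom.coroot_coweightMap_apply P P (g • i) g.toHom
  have h3 : g.toHom.indexEquiv.symm (g • i) = i := g.toHom.indexEquiv.symm_apply_apply i
  rw [h3] at h2
  rw [h2] at h1
  exact LinearMap.congr_fun h1 x

lemma pairing_smul (g : P.Aut) (i j : ι) : P.pairing (g • i) (g • j) = P.pairing i j := by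
  rw [← root_coroot'_eq_pairing, ← root_coroot'_eq_pairing, root_smul, coroot'_smul]

/-- The reflection in the root `i`, as an automorphism of the root datum. -/
abbrev refl (P : RootPairing ι ℤ X Y) (i : ι) : P.Aut := Equiv.reflection P i

lemma refl_smul_index (i j : ι) : refl P i • j = P.reflectionPerm i j := rfl

lemma refl_smul (i : ι) (x : X) : refl P i • x = x - P.coroot' i x • P.root i := rfl

lemma refl_mul_self (i : ι) : refl P i * refl P i = 1 := by
  rw [mul_eq_one_iff_eq_inv, Equiv.reflection_inv]

lemma refl_smul_smul (i j : ι) : refl P i • refl P i • j = j := by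
  rw [smul_smul, refl_mul_self, one_smul]

lemma aut_ext {g h : P.Aut} (H : ∀ x : X, g • x = h • x) : g = h :=
  Equiv.weightHom_injective P (LinearEquiv.ext H)

lemma refl_conj (g : P.Aut) (i : ι) : refl P (g • i) = g * refl P i * g⁻¹ := by
  apply aut_ext
  intro x
  rw [mul_smul, mul_smul, refl_smul, refl_smul, smul_sub, smul_inv_smul, root_smul]
  congr 1
  have : P.coroot' (g • i) x = P.coroot' i (g⁻¹ • x) := by
    rw [← coroot'_smul g i, smul_inv_smul]
  rw [this, smul_comm]

lemma weightHom_refl (i : ι) : Equiv.weightHom P (refl P i) = P.reflection i :=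
  Equiv.reflection_weightEquiv P i

lemma smul_mem_rootSpan (g : P.Aut) {x : X} (hx : x ∈ P.rootSpan ℤ) : g • x ∈ P.rootSpan ℤ := by
  induction hx using Submodule.span_induction with
  | mem x hx => 
    obtain ⟨i, rfl⟩ := hx
    rw [← root_smul]; exact Submodule.subset_span ⟨_, rfl⟩
  | zero => rw [smul_zero]; exact zero_mem _
  | add x y _ _ hx hy => rw [smul_add]; exact add_mem hx hy
  | smul a x _ hx => rw [smul_comm]; exact Submodule.smul_mem _ _ hx

/-- The action of the automorphism group on the root lattice. -/
instance rootSpanAction : DistribMulAction P.Aut (P.rootSpan ℤ) where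
  smul g x := ⟨g • (x : X), smul_mem_rootSpan g x.2⟩
  one_smul _ := Subtype.ext (one_smul _ _)
  mul_smul _ _ _ := Subtype.ext (mul_smul _ _ _)
  smul_zero _ := Subtype.ext (smul_zero _)
  smul_add _ _ _ := Subtype.ext (smul_add _ _ _)

lemma coe_smul (g : P.Aut) (x : P.rootSpan ℤ) : ((g • x : P.rootSpan ℤ) : X) = g • (x : X) := rfl

/-- The roots, as elements of the root lattice. -/
abbrev rt (P : RootPairing ι ℤ X Y) (i : ι) : P.rootSpan ℤ := P.rootSpanMem ℤ i

lemma coe_rt (i : ι) : (rt P i : X) = P.root i := rfl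

lemma rt_smul (g : P.Aut) (i : ι) : rt P (g • i) = g • rt P i :=
  Subtype.ext (root_smul g i)

lemma refl_smul_span (i : ι) (x : P.rootSpan ℤ) :
    refl P i • x = x - P.coroot' i x • rt P i := Subtype.ext rfl

/-- The action of an automorphism on the root lattice, as a linear map. -/
def spanMap (g : P.Aut) : P.rootSpan ℤ →ₗ[ℤ] P.rootSpan ℤ :=
  (DistribSMul.toAddMonoidHom (P.rootSpan ℤ) g).toIntLinearMap

@[simp] lemma spanMap_apply (g : P.Aut) (x : P.rootSpan ℤ) : spanMap g x = g • x := rfl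

lemma rt_induction {p : P.rootSpan ℤ → Prop} (h : ∀ i, p (rt P i)) (h0 : p 0)
    (hadd : ∀ x y, p x → p y → p (x + y)) (hneg : ∀ x, p x → p (-x)) (x : P.rootSpan ℤ) : p x := by
  obtain ⟨x, hx⟩ := x
  induction hx using Submodule.span_induction with
  | mem x hx => obtain ⟨i, rfl⟩ := hx; exact h i
  | zero => exact h0
  | add x y hx hy h1 h2 => exact hadd _ _ h1 h2
  | smul a x hx h1 =>
    have h2 : ∀ n : ℕ, p ((n : ℤ) • ⟨x, hx⟩) := by
      intro n
      induction n with
      | zero => simpa using h0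
      | succ n ih => 
        rw [Nat.cast_succ, add_smul, one_smul]; exact hadd _ _ ih h1
    rcases Int.eq_nat_or_neg a with ⟨n, rfl | rfl⟩
    · exact h2 n
    · have := hneg _ (h2 n)
      rwa [← neg_smul] at this

lemma eq_of_rt {A : Type*} [AddCommGroup A] {φ ψ : P.rootSpan ℤ →ₗ[ℤ] A}
    (h : ∀ i, φ (rt P i) = ψ (rt P i)) : φ = ψ := by
  ext x
  induction x using rt_induction with
  | h i => exact h i
  | h0 => simp
  | hadd x y hx hy => rw [map_add, map_add, hx, hy]
  | hneg x hx => rw [map_neg, map_neg, hx]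

/-- The simple coroots span all coroots, and the root form, a sum of squares of coroots, is
anisotropic on the root lattice. -/
lemma eq_zero_of_coroot'_eq_zero [Finite ι] (Δ : P.Base) {x : P.rootSpan ℤ}
    (h : ∀ i ∈ Δ.support, P.coroot' i x = 0) : x = 0 := by
  cases nonempty_fintype ι
  have h' : ∀ i, P.coroot' i (x : X) = 0 := by
    intro i
    have := Δ.coroot_mem_span_int i
    have key : ∀ y ∈ Submodule.span ℤ (P.coroot '' Δ.support), P.toLinearMap.flip y (x : X) = 0 := by
      intro y hy
      induction hy using Submodule.span_induction with
      | mem y hy => obtain ⟨j, hj, rfl⟩ := hy; exact h j hj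
      | zero => simp
      | add y z _ _ h1 h2 => rw [map_add, LinearMap.add_apply, h1, h2, add_zero]
      | smul a y _ h1 => rw [map_smul, LinearMap.smul_apply, h1, smul_zero]
    exact key _ this
  apply Subtype.ext
  apply P.eq_zero_of_mem_rootSpan_of_rootForm_self_eq_zero x.2
  rw [rootForm_apply_apply]
  exact Finset.sum_eq_zero fun i _ ↦ by rw [h' i]; simp

end Aut

/-! ### Positive roots, inversions, and length in the Weyl group. -/

section Positivity

variable {ι X Y : Type*} [AddCommGroup X] [AddCommGroup Y] {P : RootPairing ι ℤ X Y} (Δ : P.Base)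

/-- The coefficient of the simple root `α`. -/
abbrev coef (α : Δ.support) : P.rootSpan ℤ →ₗ[ℤ] ℤ := fundCoweight Δ α

lemma basis_apply (α : Δ.support) : Δ.toWeightBasisInt α = rt P α :=
  Subtype.ext (Δ.coe_toWeightBasisInt_apply α)

open Classical in
lemma coef_simple (α β : Δ.support) : coef Δ α (rt P β) = if α = β then 1 else 0 := by
  rw [← basis_apply, coef, fundCoweight, Module.Basis.coord_apply, Module.Basis.repr_self,
    Finsupp.single_apply]
  simp [eq_comm]

lemma coef_self (α : Δ.support) : coef Δ α (rt P α) = 1 := by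
  simp [coef_simple]

lemma coef_ne {α β : Δ.support} (h : α ≠ β) : coef Δ α (rt P β) = 0 := by
  simp [coef_simple, h]

lemma sum_coef (x : P.rootSpan ℤ) : ∑ α : Δ.support, coef Δ α x • rt P α = x := by
  simp_rw [← basis_apply]
  exact Δ.toWeightBasisInt.sum_repr x

lemma eq_of_coef {x y : P.rootSpan ℤ} (h : ∀ α, coef Δ α x = coef Δ α y) : x = y := by
  rw [← sum_coef Δ x, ← sum_coef Δ y]
  simp_rw [h]

lemma eq_of_simple {A : Type*} [AddCommGroup A] {φ ψ : P.rootSpan ℤ →ₗ[ℤ] A}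
    (h : ∀ i ∈ Δ.support, φ (rt P i) = ψ (rt P i)) : φ = ψ :=
  Δ.toWeightBasisInt.ext fun α ↦ by rw [basis_apply]; exact h α α.2

lemma height_eq (i : ι) : Δ.height i = ∑ α : Δ.support, coef Δ α (rt P i) := by
  classical
  have h := congrArg Subtype.val (sum_coef Δ (rt P i))
  rw [Submodule.coe_sum] at h
  let f : ι → ℤ := fun j ↦ if hj : j ∈ Δ.support then coef Δ ⟨j, hj⟩ (rt P i) else 0
  have hf : ∀ α : Δ.support, f α = coef Δ α (rt P i) := fun α ↦ by simp [f]
  rw [Base.height_eq_sum (f := f) (b := Δ) (i := i)]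
  · rw [← Finset.sum_coe_sort]
    exact Finset.sum_congr rfl fun α _ ↦ hf α
  · rw [← Finset.sum_coe_sort Δ.support (fun j ↦ f j • P.root j)]
    refine h.symm.trans (Finset.sum_congr rfl fun α _ ↦ ?_)
    rw [hf α]; rfl

lemma coef_nonneg_of_mem {x : P.rootSpan ℤ} (hx : (x : X) ∈ AddSubmonoid.closure (P.root '' Δ.support))
    (α : Δ.support) : 0 ≤ coef Δ α x := by
  have key : ∀ y ∈ AddSubmonoid.closure (P.root '' Δ.support), ∀ hy : y ∈ P.rootSpan ℤ,
      0 ≤ coef Δ α ⟨y, hy⟩ := by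
    intro y hy
    induction hy using AddSubmonoid.closure_induction with
    | mem y hy =>
      obtain ⟨j, hj, rfl⟩ := hy
      intro _
      have := coef_simple Δ α ⟨j, hj⟩
      change 0 ≤ coef Δ α (rt P j)
      rw [this]; split_ifs <;> simp
    | zero => intro h; exact (map_zero (coef Δ α)).ge
    | add y z hy hz h1 h2 =>
      intro h
      have hs : ∀ y ∈ AddSubmonoid.closure (P.root '' Δ.support), y ∈ P.rootSpan ℤ := by
        intro y hy
        refine (AddSubmonoid.closure_le (S := (P.rootSpan ℤ).toAddSubmonoid)).mpr ?_ hy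
        rintro _ ⟨j, _, rfl⟩
        exact Submodule.subset_span ⟨j, rfl⟩
      have := map_add (coef Δ α) ⟨y, hs y hy⟩ ⟨z, hs z hz⟩
      exact (add_nonneg (h1 (hs y hy)) (h2 (hs z hz))).trans this.symm.le
  exact key x hx x.2

lemma coef_sign (i : ι) : (∀ α, 0 ≤ coef Δ α (rt P i)) ∨ (∀ α, coef Δ α (rt P i) ≤ 0) := by
  rcases Δ.root_mem_or_neg_mem i with h | h
  · exact Or.inl fun α ↦ coef_nonneg_of_mem Δ h α
  · refine Or.inr fun α ↦ ?_
    have := coef_nonneg_of_mem Δ (x := -rt P i) h α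
    rw [map_neg] at this
    linarith

lemma rt_ne_zero (i : ι) : rt P i ≠ 0 := fun h ↦ P.ne_zero i (congrArg Subtype.val h)

lemma exists_coef_ne_zero (i : ι) : ∃ α, coef Δ α (rt P i) ≠ 0 := by
  by_contra! h
  exact rt_ne_zero i (eq_of_coef Δ fun α ↦ by rw [h α, map_zero])

lemma IsPos.coef_nonneg {i : ι} (h : Δ.IsPos i) (α) : 0 ≤ coef Δ α (rt P i) := by
  rcases coef_sign Δ i with h' | h'
  · exact h' α
  · have h2 := (Δ.isPos_iff).mp h
    rw [height_eq] at h2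
    exact absurd h2 (not_lt.mpr (Finset.sum_nonpos fun α _ ↦ h' α))

lemma isPos_of_coef_pos {i : ι} {α} (h : 0 < coef Δ α (rt P i)) : Δ.IsPos i := by
  rw [Base.isPos_iff', height_eq]
  rcases coef_sign Δ i with h' | h'
  · exact Finset.sum_nonneg fun α _ ↦ h' α
  · exact absurd h (not_lt.mpr (h' α))

lemma rt_refl_self (i : ι) : rt P (refl P i • i) = -rt P i :=
  Subtype.ext (by rw [coe_rt, root_smul]; exact P.reflection_apply_self i)

lemma isPos_refl_self (i : ι) : Δ.IsPos (refl P i • i) ↔ ¬ Δ.IsPos i := 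
  Base.IsPos.neg_iff_not Δ i

variable [Finite ι] [P.IsReduced]

lemma isPos_refl {i j : ι} (hj : j ∈ Δ.support) (hij : i ≠ j) (hi : Δ.IsPos i) :
    Δ.IsPos (refl P j • i) := Base.IsPos.reflectionPerm hi hj hij

/-- Reflecting in a simple root in `S` removes one positive root from `S`. -/
lemma ncard_pos_refl {j : ι} (hj : j ∈ Δ.support) (S : Set ι) (h1 : j ∈ S) (h2 : refl P j • j ∉ S) :
    {i | Δ.IsPos i ∧ refl P j • i ∈ S}.ncard + 1 = {i | Δ.IsPos i ∧ i ∈ S}.ncard := by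
  -- The reflection in j permutes the positive roots other than j.
  have : {i | Δ.IsPos i ∧ i ∈ S} = insert j ((refl P j • ·) '' {i | Δ.IsPos i ∧ refl P j • i ∈ S}) := by
    ext i
    simp only [Set.mem_ofPred_eq, Set.mem_insert_iff, Set.mem_image]
    constructor
    · rintro ⟨hi, hS⟩
      by_cases hij : i = j
      · exact Or.inl hij
      · exact Or.inr ⟨refl P j • i, ⟨isPos_refl Δ hj hij hi, by rwa [refl_smul_smul]⟩,
          refl_smul_smul _ _⟩
    · rintro (rfl | ⟨k, ⟨hk, hS⟩, rfl⟩)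
      · exact ⟨Base.isPos_of_mem_support hj, h1⟩
      · refine ⟨isPos_refl Δ hj ?_ hk, hS⟩
        rintro rfl
        exact h2 hS
  rw [this, Set.ncard_insert_of_notMem, Set.ncard_image_of_injective _ (MulAction.injective _)]
  rintro ⟨k, ⟨hk, _⟩, hkj⟩
  have h3 : k = refl P j • j := by
    have := congrArg (refl P j • ·) hkj
    simpa only [refl_smul_smul] using this
  rw [h3, isPos_refl_self] at hk
  exact hk (Base.isPos_of_mem_support hj : Δ.IsPos j)

/-- The number of positive roots that `g` makes negative. -/
def inv (g : P.Aut) : ℕ := {i | Δ.IsPos i ∧ i ∈ {i | ¬ Δ.IsPos (g • i)}}.ncard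

lemma inv_mul_refl_of_neg {g : P.Aut} {j : ι} (hj : j ∈ Δ.support) (h : ¬ Δ.IsPos (g • j)) :
    inv Δ (g * refl P j) + 1 = inv Δ g := by
  have := ncard_pos_refl Δ hj {i | ¬ Δ.IsPos (g • i)} h (by
    rw [Set.mem_ofPred_eq, not_not, ← mul_smul]
    have h1 : g * refl P j = refl P (g • j) * g := by rw [refl_conj]; group
    rwa [h1, mul_smul, isPos_refl_self])
  rw [inv, inv, ← this]
  congr 3

lemma inv_mul_refl_of_pos {g : P.Aut} {j : ι} (hj : j ∈ Δ.support) (h : Δ.IsPos (g • j)) :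
    inv Δ (g * refl P j) = inv Δ g + 1 := by
  have := inv_mul_refl_of_neg Δ (g := g * refl P j) hj (by
    have h1 : g * refl P j = refl P (g • j) * g := by rw [refl_conj]; group
    rwa [h1, mul_smul, isPos_refl_self, not_not])
  rw [mul_assoc, refl_mul_self, mul_one] at this
  exact this.symm

lemma inv_one : inv Δ (1 : P.Aut) = 0 := by
  rw [inv, Set.ncard_eq_zero]
  ext i; simp

/-- An automorphism that keeps the simple roots positive also keeps their non-negative combinations
positive. -/
lemma exists_simple_neg {g : P.Aut} (h : inv Δ g ≠ 0) : ∃ j ∈ Δ.support, ¬ Δ.IsPos (g • j) := by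
  by_contra! h'
  apply h
  rw [inv, Set.ncard_eq_zero]
  ext i
  simp only [Set.mem_ofPred_eq, Set.mem_empty_iff_false, iff_false, not_and, not_not]
  intro hi
  rw [Base.isPos_iff', height_eq, rt_smul, ← sum_coef Δ (rt P i), Finset.smul_sum]
  refine Finset.sum_nonneg fun α _ ↦ ?_
  rw [map_sum]
  refine Finset.sum_nonneg fun β _ ↦ ?_
  have : g • (coef Δ β (rt P i) • rt P β) = coef Δ β (rt P i) • rt P (g • (β : ι)) := by
    rw [← spanMap_apply, map_smul, spanMap_apply, rt_smul]
  rw [this, map_smul]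
  exact smul_nonneg (IsPos.coef_nonneg Δ hi β) (IsPos.coef_nonneg Δ (h' β β.2) α)

/-- The product of the reflections of a word. -/
def wordProd (P : RootPairing ι ℤ X Y) (l : List ι) : P.Aut := (l.map (refl P)).prod

omit [Finite ι] [P.IsReduced] in
@[simp] lemma wordProd_nil : wordProd P [] = 1 := rfl
omit [Finite ι] [P.IsReduced] in
@[simp] lemma wordProd_cons (i : ι) (l : List ι) : wordProd P (i :: l) = refl P i * wordProd P l := by
  simp [wordProd]
omit [Finite ι] [P.IsReduced] in
@[simp] lemma wordProd_append (l m : List ι) : wordProd P (l ++ m) = wordProd P l * wordProd P m := by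
  simp [wordProd]

lemma inv_wordProd_le (l : List ι) (hl : ∀ i ∈ l, i ∈ Δ.support) : inv Δ (wordProd P l) ≤ l.length := by
  induction l using List.reverseRecOn with
  | nil => simp [inv_one]
  | append_singleton l j ih =>
    have hj : j ∈ Δ.support := hl j (by simp)
    have := ih fun i hi ↦ hl i (by simp [hi])
    simp only [wordProd_append, wordProd_cons, wordProd_nil, mul_one, List.length_append,
      List.length_singleton]
    by_cases h : Δ.IsPos (wordProd P l • j)
    · rw [inv_mul_refl_of_pos Δ hj h]; omega
    · have := inv_mul_refl_of_neg Δ hj h; omega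

/-- The exchange condition. -/
lemma exists_word_exchange (l : List ι) (hl : ∀ i ∈ l, i ∈ Δ.support) {j : ι} (hj : j ∈ Δ.support)
    (h : ¬ Δ.IsPos (wordProd P l • j)) :
    ∃ m : List ι, (∀ i ∈ m, i ∈ Δ.support) ∧ m.length + 1 = l.length ∧
      wordProd P m = wordProd P l * refl P j := by
  induction l with
  | nil => exact absurd (Base.isPos_of_mem_support hj) (by simpa using h)
  | cons i l ih =>
    have hi : i ∈ Δ.support := hl i (by simp)
    have hl' : ∀ i ∈ l, i ∈ Δ.support := fun k hk ↦ hl k (by simp [hk])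
    by_cases h' : Δ.IsPos (wordProd P l • j)
    · refine ⟨l, hl', by simp, ?_⟩
      -- The only positive root that the reflection in i makes negative is i itself; so deleting the
      -- letter i has the effect of multiplying by the reflection in j.
      have : wordProd P l • j = i := by
        by_contra hne
        rw [wordProd_cons, mul_smul] at h
        exact h (isPos_refl Δ hi hne h')
      rw [wordProd_cons, ← this, refl_conj]
      rw [mul_assoc, mul_assoc, mul_assoc, inv_mul_cancel_left, refl_mul_self, mul_one]
    · obtain ⟨m, hm, hlen, hprod⟩ := ih hl' h'
      refine ⟨i :: m, ?_, by simp [hlen], by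
        rw [wordProd_cons, wordProd_cons, hprod, mul_assoc]⟩
      intro k hk
      rcases List.mem_cons.mp hk with rfl | hk
      · exact hi
      · exact hm k hk

/-- A letter that adds an inversion is kept; one that removes an inversion is absorbed by the
exchange condition. Word length thus keeps pace with the number of inversions. -/
lemma exists_reduced_word (l : List ι) (hl : ∀ i ∈ l, i ∈ Δ.support) :
    ∃ m : List ι, (∀ i ∈ m, i ∈ Δ.support) ∧ m.length = inv Δ (wordProd P l) ∧
      wordProd P m = wordProd P l := by
  induction l using List.reverseRecOn with
  | nil => exact ⟨[], by simp, (inv_one Δ).symm, rfl⟩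
  | append_singleton l j ih =>
    have hj : j ∈ Δ.support := hl j (by simp)
    obtain ⟨m, hm, hlen, hprod⟩ := ih fun i hi ↦ hl i (by simp [hi])
    simp only [wordProd_append, wordProd_cons, wordProd_nil, mul_one]
    by_cases h : Δ.IsPos (wordProd P l • j)
    · refine ⟨m ++ [j], ?_, ?_, by
        rw [wordProd_append, hprod, wordProd_cons, wordProd_nil, mul_one]⟩
      swap
      · rw [inv_mul_refl_of_pos Δ hj h, List.length_append, hlen, List.length_singleton]
      intro k hk
      rcases List.mem_append.mp hk with hk | hk
      · exact hm k hk
      · rw [List.mem_singleton.mp hk]; exact hj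
    · rw [← hprod] at h
      obtain ⟨m', hm', hlen', hprod'⟩ := exists_word_exchange Δ m hm hj h
      have := inv_mul_refl_of_neg Δ hj h
      rw [hprod] at this hprod'
      exact ⟨m', hm', by omega, hprod'⟩

lemma exists_word {w : P.Aut} (hw : w ∈ P.weylGroup) :
    ∃ l : List ι, (∀ i ∈ l, i ∈ Δ.support) ∧ wordProd P l = w := by
  have key : ∀ i, ∃ l : List ι, (∀ i ∈ l, i ∈ Δ.support) ∧ wordProd P l = refl P i := by
    intro i
    refine Δ.induction_reflect i (p := fun i ↦ ∃ l : List ι, (∀ i ∈ l, i ∈ Δ.support) ∧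
      wordProd P l = refl P i) ?_ ?_ ?_
    · rintro i ⟨l, hl, h⟩
      refine ⟨l, hl, h.trans ?_⟩
      rw [← refl_smul_index, refl_conj, mul_assoc, mul_inv_cancel, mul_one]
    · intro i hi
      exact ⟨[i], by simpa using hi, by simp⟩
    · rintro i j ⟨l, hl, h⟩ hj
      refine ⟨j :: l ++ [j], ?_, ?_⟩
      · intro k hk
        simp only [List.cons_append, List.mem_cons, List.mem_append, List.not_mem_nil, or_false] at hk
        rcases hk with rfl | hk | rfl
        · exact hj
        · exact hl k hk
        · exact hj
      · rw [← refl_smul_index, refl_conj, List.cons_append, wordProd_cons, wordProd_append, h,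
          wordProd_cons, wordProd_nil, mul_one, Equiv.reflection_inv, mul_assoc]
  induction hw using weylGroup.induction with
  | mem i => exact key i
  | one => exact ⟨[], by simp, rfl⟩
  | mul x y _ _ hx hy =>
    obtain ⟨l, hl, rfl⟩ := hx
    obtain ⟨m, hm, rfl⟩ := hy
    refine ⟨l ++ m, ?_, by simp⟩
    intro k hk
    rcases List.mem_append.mp hk with hk | hk
    · exact hl k hk
    · exact hm k hk

omit [Finite ι] [P.IsReduced] in
lemma weightHom_wordProd (l : List ι) : Equiv.weightHom P (wordProd P l) = (l.map P.reflection).prod := by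
  rw [wordProd, map_list_prod, List.map_map]
  congr 2
  exact funext weightHom_refl

lemma len_weightHom {w : P.Aut} (hw : w ∈ P.weylGroup) : len Δ (Equiv.weightHom P w) = inv Δ w := by
  apply le_antisymm
  · obtain ⟨l, hl, rfl⟩ := exists_word Δ hw
    obtain ⟨m, hm, hlen, hprod⟩ := exists_reduced_word Δ l hl
    exact Nat.sInf_le ⟨m, ⟨hm, by rw [← hprod, weightHom_wordProd]⟩, hlen⟩
  · apply le_csInf
    · obtain ⟨l, hl, rfl⟩ := exists_word Δ hw
      exact ⟨_, l, ⟨hl, by rw [weightHom_wordProd]⟩, rfl⟩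
    · rintro _ ⟨l, ⟨hl, h⟩, rfl⟩
      rw [← weightHom_wordProd] at h
      rw [← Equiv.weightHom_injective P h]
      exact inv_wordProd_le Δ l hl

omit [Finite ι] [P.IsReduced] in
lemma weightHom_mem_weyl {w : P.Aut} (hw : w ∈ P.weylGroup) : Equiv.weightHom P w ∈ weyl P := by
  rw [weyl, ← range_weylGroup_weightHom]
  exact ⟨⟨w, hw⟩, rfl⟩

lemma wordProd_mem (l : List ι) : wordProd P l ∈ P.weylGroup :=
  Subgroup.list_prod_mem _ fun g hg ↦ by
    obtain ⟨i, _, rfl⟩ := List.mem_map.mp hg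
    exact P.reflection_mem_weylGroup i

omit [Finite ι] [P.IsReduced] in
lemma conj_mem_weylGroup (g : P.Aut) {w : P.Aut} (hw : w ∈ P.weylGroup) :
    g * w * g⁻¹ ∈ P.weylGroup := by
  induction hw using weylGroup.induction with
  | mem i =>
    have := P.reflection_mem_weylGroup (g • i)
    rwa [show Equiv.reflection P (g • i) = _ from refl_conj g i] at this
  | one => simp
  | mul x y _ _ hx hy =>
    have := mul_mem hx hy
    rwa [show g * x * g⁻¹ * (g * y * g⁻¹) = g * (x * y) * g⁻¹ by group] at this

end Positivity

end CoxeterTorus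

namespace CoxeterTorus
open RootPairing

/-! ### Transport of bases, and the base defined by a regular linear form. -/

section BaseAction

variable {ι X Y : Type*} [AddCommGroup X] [AddCommGroup Y] {P : RootPairing ι ℤ X Y}

/-- Automorphisms act contravariantly on coweights, hence the inverse. -/
lemma coroot_smul (g : P.Aut) (i : ι) : P.coroot (g • i) = Equiv.coweightEquiv P P g⁻¹ (P.coroot i) := by
  have := Hom.coroot_coweightMap_apply P P i (g⁻¹).toHom
  exact this.symm

lemma mem_closure_map {κ M : Type*} [AddCommGroup M] (f : M →+ M) (r : κ → M) (e : κ → κ)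
    (he : ∀ i, r (e i) = f (r i)) {s t : Set κ} (hst : ∀ i ∈ s, e i ∈ t) {x : M}
    (hx : x ∈ AddSubmonoid.closure (r '' s)) : f x ∈ AddSubmonoid.closure (r '' t) := by
  induction hx using AddSubmonoid.closure_induction with
  | mem y hy =>
    obtain ⟨j, hj, rfl⟩ := hy
    exact AddSubmonoid.subset_closure ⟨e j, hst j hj, he j⟩
  | zero => rw [map_zero]; exact zero_mem _
  | add y z _ _ h1 h2 => rw [map_add]; exact add_mem h1 h2

open Classical in
/-- The transport of a base along an automorphism of the root datum. -/
def smulBase (g : P.Aut) (Δ : P.Base) : P.Base where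
  support := Δ.support.image (g • ·)
  linearIndepOn_root := by
    rw [Finset.coe_image]
    refine (linearIndepOn_equiv (MulAction.toPerm g)).mp ?_
    have h : P.root ∘ (MulAction.toPerm g) = (Equiv.weightEquiv P P g).toLinearMap ∘ P.root :=
      funext fun i ↦ root_smul g i
    rw [h]
    exact Δ.linearIndepOn_root.map_injOn _ (LinearEquiv.injective _).injOn
  linearIndepOn_coroot := by
    rw [Finset.coe_image]
    refine (linearIndepOn_equiv (MulAction.toPerm g)).mp ?_
    have h : P.coroot ∘ (MulAction.toPerm g) = (Equiv.coweightEquiv P P g⁻¹).toLinearMap ∘ P.coroot :=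
      funext fun i ↦ coroot_smul g i
    rw [h]
    exact Δ.linearIndepOn_coroot.map_injOn _ (LinearEquiv.injective _).injOn
  root_mem_or_neg_mem i := by
    have key := fun x ↦ mem_closure_map (x := x) (DistribSMul.toAddMonoidHom X g) P.root (g • ·)
      (root_smul g) (s := Δ.support) (t := Δ.support.image (g • ·)) (by simp)
    have h : P.root i = g • P.root (g⁻¹ • i) := by rw [← root_smul, smul_inv_smul]
    rw [h, ← smul_neg]
    exact (Δ.root_mem_or_neg_mem (g⁻¹ • i)).imp (key _) (key _)
  coroot_mem_or_neg_mem i := by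
    have key := fun x ↦ mem_closure_map (x := x)
      (Equiv.coweightEquiv P P g⁻¹).toLinearMap.toAddMonoidHom P.coroot (g • ·)
      (coroot_smul g) (s := Δ.support) (t := Δ.support.image (g • ·)) (by simp)
    have h : P.coroot i = Equiv.coweightEquiv P P g⁻¹ (P.coroot (g⁻¹ • i)) := by
      rw [← coroot_smul, smul_inv_smul]
    rw [h, ← map_neg]
    exact (Δ.coroot_mem_or_neg_mem (g⁻¹ • i)).imp (key _) (key _)

variable (g : P.Aut) (Δ : P.Base)

lemma mem_smulBase {i : ι} : i ∈ (smulBase g Δ).support ↔ g⁻¹ • i ∈ Δ.support := by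
  simp only [smulBase, Finset.mem_image]
  exact ⟨fun ⟨a, ha, h⟩ ↦ by rwa [← h, inv_smul_smul], fun h ↦ ⟨_, h, smul_inv_smul _ _⟩⟩

lemma smul_mem_smulBase {i : ι} : g • i ∈ (smulBase g Δ).support ↔ i ∈ Δ.support := by
  rw [mem_smulBase, inv_smul_smul]

lemma coef_smulBase (α : (smulBase g Δ).support) (x : P.rootSpan ℤ) :
    coef (smulBase g Δ) α x = coef Δ ⟨g⁻¹ • (α : ι), (mem_smulBase g Δ).mp α.2⟩ (g⁻¹ • x) := by
  classical
  have : coef (smulBase g Δ) α = (coef Δ ⟨g⁻¹ • (α : ι), (mem_smulBase g Δ).mp α.2⟩).comp (spanMap g⁻¹) := by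
    apply eq_of_simple (smulBase g Δ)
    intro i hi
    have h1 := coef_simple (smulBase g Δ) α ⟨i, hi⟩
    have h2 := coef_simple Δ ⟨g⁻¹ • (α : ι), (mem_smulBase g Δ).mp α.2⟩ ⟨g⁻¹ • i, (mem_smulBase g Δ).mp hi⟩
    rw [LinearMap.comp_apply, spanMap_apply, ← rt_smul, h1, h2]
    congr 1
    simp [Subtype.ext_iff]
  rw [this]; rfl

lemma isPos_iff_exists_coef {i : ι} : Δ.IsPos i ↔ ∃ α, 0 < coef Δ α (rt P i) := by
  refine ⟨fun h ↦ ?_, fun ⟨α, h⟩ ↦ isPos_of_coef_pos Δ h⟩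
  obtain ⟨α, hα⟩ := exists_coef_ne_zero Δ i
  exact ⟨α, lt_of_le_of_ne (IsPos.coef_nonneg Δ h α) hα.symm⟩

lemma isPos_smulBase {i : ι} : (smulBase g Δ).IsPos i ↔ Δ.IsPos (g⁻¹ • i) := by
  rw [isPos_iff_exists_coef, isPos_iff_exists_coef]
  constructor
  · rintro ⟨α, h⟩
    rw [coef_smulBase, ← rt_smul] at h
    exact ⟨_, h⟩
  · rintro ⟨α, h⟩
    refine ⟨⟨g • (α : ι), (smul_mem_smulBase g Δ).mpr α.2⟩, ?_⟩
    rw [coef_smulBase, ← rt_smul]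
    simpa using h

lemma isConnectedDynkin_smulBase (h : IsConnectedDynkin Δ) : IsConnectedDynkin (smulBase g Δ) := by
  classical
  refine ⟨?_, ?_⟩
  · obtain ⟨i, hi⟩ := h.1
    exact ⟨g • i, (smul_mem_smulBase g Δ).mpr hi⟩
  · intro S hS hne hS'
    obtain ⟨i, hi, j, hj, hjS, hij⟩ := h.2 (S.image (g⁻¹ • ·)) (by
      intro i hi
      obtain ⟨k, hk, rfl⟩ := Finset.mem_image.mp hi
      exact (mem_smulBase g Δ).mp (hS hk)) (hne.image _) (by
      rintro heq
      apply hS'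
      refine Finset.Subset.antisymm hS fun k hk ↦ ?_
      have := (mem_smulBase g Δ).mp hk
      rw [← heq] at this
      obtain ⟨l, hl, hlk⟩ := Finset.mem_image.mp this
      rwa [← MulAction.injective g⁻¹ hlk])
    obtain ⟨k, hk, rfl⟩ := Finset.mem_image.mp hi
    refine ⟨k, hk, g • j, (smul_mem_smulBase g Δ).mpr hj, ?_, ?_⟩
    · intro h'
      exact hjS (Finset.mem_image.mpr ⟨_, h', inv_smul_smul _ _⟩)
    · rw [← pairing_smul g] at hij
      simpa using hij

variable [Finite ι] [P.IsReduced]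

/-- A linear form that vanishes at no root is positive on the positive roots of some base in the
Weyl orbit of `Δ`. -/
lemma exists_base_of_regular (φ : P.rootSpan ℤ →ₗ[ℤ] ℝ) (hφ : ∀ i, φ (rt P i) ≠ 0) :
    ∃ u ∈ P.weylGroup, ∀ i, (smulBase u Δ).IsPos i ↔ 0 < φ (rt P i) := by
  classical
  -- Minimise, over the Weyl group, the number of positive roots whose translate has a negative
  -- value.
  let N : P.weylGroup → ℕ := fun u ↦ {i | Δ.IsPos i ∧ i ∈ {i | φ (rt P (u.1 • i)) < 0}}.ncard
  obtain ⟨u, hu⟩ : ∃ u, ∀ v, N u ≤ N v :=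
    ⟨Function.argmin N, fun v ↦ Function.argmin_le N v⟩
  have hs : ∀ j ∈ Δ.support, 0 < φ (rt P (u.1 • j)) := by
    intro j hj
    by_contra h
    have h1 : φ (rt P (u.1 • j)) < 0 := lt_of_le_of_ne (not_lt.mp h) (hφ _)
    -- If a simple root had a negative value, composing with its reflection would lower the minimum
    -- by one.
    have := ncard_pos_refl Δ hj {i | φ (rt P (u.1 • i)) < 0} h1 (by
      rw [Set.mem_ofPred_eq, rt_smul, rt_refl_self, smul_neg, ← rt_smul, map_neg]
      linarith)
    have h2 := hu (u * ⟨refl P j, P.reflection_mem_weylGroup j⟩)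
    have h3 : N (u * ⟨refl P j, P.reflection_mem_weylGroup j⟩) + 1 = N u := by
      exact this
    omega
  have hp : ∀ i, Δ.IsPos i → 0 < φ (rt P (u.1 • i)) := by
    intro i hi
    refine lt_of_le_of_ne ?_ (hφ _).symm
    rw [rt_smul, ← sum_coef Δ (rt P i), Finset.smul_sum, map_sum]
    refine Finset.sum_nonneg fun β _ ↦ ?_
    have : u.1 • (coef Δ β (rt P i) • rt P β) = coef Δ β (rt P i) • rt P (u.1 • (β : ι)) := by
      rw [← spanMap_apply, map_smul, spanMap_apply, rt_smul]
    rw [this, map_smul, zsmul_eq_mul]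
    exact mul_nonneg (by exact_mod_cast IsPos.coef_nonneg Δ hi β) (hs β β.2).le
  refine ⟨u, u.2, fun i ↦ ?_⟩
  rw [isPos_smulBase]
  refine ⟨fun h ↦ by simpa using hp _ h, fun h ↦ ?_⟩
  by_contra h'
  rw [← isPos_refl_self] at h'
  have := hp _ h'
  rw [rt_smul, rt_refl_self, smul_neg, ← rt_smul, map_neg, smul_inv_smul] at this
  linarith

end BaseAction

end CoxeterTorus

namespace CoxeterTorus
open RootPairing

/-! ### Twisted Coxeter words and orbit coweights. -/

section CoxeterWords

variable {ι X Y : Type*} [AddCommGroup X] [AddCommGroup Y] {P : RootPairing ι ℤ X Y}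

/-- `l` is a word in the simple reflections that contains precisely one simple reflection from each
orbit of the diagram automorphism `σ`. -/
structure IsCoxWord (Δ : P.Base) (σ : P.Aut) (l : List ι) : Prop where
  stable : ∀ i, σ • i ∈ Δ.support ↔ i ∈ Δ.support
  mem : ∀ i ∈ l, i ∈ Δ.support
  nodup : l.Nodup
  transversal : ∀ j ∈ Δ.support, ∃! i, i ∈ l ∧ ∃ m : ℤ, σ ^ m • j = i

lemma zpow_smul_mem {Δ : P.Base} {σ : P.Aut} (h : ∀ i, σ • i ∈ Δ.support ↔ i ∈ Δ.support) (m : ℤ)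
    (i : ι) : σ ^ m • i ∈ Δ.support ↔ i ∈ Δ.support := by
  induction m with
  | zero => simp
  | succ m ih => rw [add_comm, zpow_add, zpow_one, mul_smul, h, ih]
  | pred m ih =>
    rw [← h, smul_smul, ← zpow_one_add, add_sub_cancel, ih]

open Classical in
/-- The sum of the fundamental coweights over the `σ`-orbit of the simple root `j`. -/
def orbF (Δ : P.Base) (σ : P.Aut) (j : ι) : P.rootSpan ℤ →ₗ[ℤ] ℤ :=
  Δ.toWeightBasisInt.constr ℤ fun α ↦ if ∃ m : ℤ, σ ^ m • j = α then 1 else 0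

variable {Δ : P.Base} {σ : P.Aut} {l : List ι}

open Classical in
lemma orbF_simple {i : ι} (hi : i ∈ Δ.support) (j : ι) :
    orbF Δ σ j (rt P i) = if ∃ m : ℤ, σ ^ m • j = i then 1 else 0 := by
  have := Δ.toWeightBasisInt.constr_basis ℤ (fun α : Δ.support ↦ if ∃ m : ℤ, σ ^ m • j = α then (1 : ℤ) else 0) ⟨i, hi⟩
  rw [basis_apply] at this
  exact this

lemma orbF_of_orbit {i j : ι} (hi : i ∈ Δ.support) (h : ∃ m : ℤ, σ ^ m • j = i) :
    orbF Δ σ j (rt P i) = 1 := by rw [orbF_simple hi, if_pos h]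

lemma orbF_of_not_orbit {i j : ι} (hi : i ∈ Δ.support) (h : ¬ ∃ m : ℤ, σ ^ m • j = i) :
    orbF Δ σ j (rt P i) = 0 := by rw [orbF_simple hi, if_neg h]

lemma exists_zpow_smul_iff {i j : ι} : (∃ m : ℤ, σ ^ m • j = σ • i) ↔ ∃ m : ℤ, σ ^ m • j = i := by
  constructor
  · rintro ⟨m, h⟩
    exact ⟨-1 + m, by rw [zpow_add, zpow_neg_one, mul_smul, h, inv_smul_smul]⟩
  · rintro ⟨m, h⟩
    exact ⟨1 + m, by rw [zpow_add, zpow_one, mul_smul, h]⟩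

lemma orbF_smul (hσ : ∀ i, σ • i ∈ Δ.support ↔ i ∈ Δ.support) (j : ι) (x : P.rootSpan ℤ) :
    orbF Δ σ j (σ • x) = orbF Δ σ j x := by
  classical
  have : (orbF Δ σ j).comp (spanMap σ) = orbF Δ σ j := by
    apply eq_of_simple Δ
    intro i hi
    rw [LinearMap.comp_apply, spanMap_apply, ← rt_smul, orbF_simple ((hσ i).mpr hi), orbF_simple hi]
    simp only [exists_zpow_smul_iff]
  exact LinearMap.congr_fun this x

lemma orbF_nonneg {i : ι} (h : Δ.IsPos i) (j : ι) : 0 ≤ orbF Δ σ j (rt P i) := by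
  classical
  rw [← sum_coef Δ (rt P i), map_sum]
  refine Finset.sum_nonneg fun α _ ↦ ?_
  rw [map_smul, orbF_simple α.2]
  refine smul_nonneg (IsPos.coef_nonneg Δ h α) ?_
  split_ifs <;> simp

lemma le_orbF {i : ι} (h : Δ.IsPos i) (α : Δ.support) : coef Δ α (rt P i) ≤ orbF Δ σ α (rt P i) := by
  classical
  conv_rhs => rw [← sum_coef Δ (rt P i), map_sum]
  have : coef Δ α (rt P i) = orbF Δ σ α (coef Δ α (rt P i) • rt P α) := by
    rw [map_smul, orbF_of_orbit α.2 ⟨0, by simp⟩, smul_eq_mul, mul_one]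
  rw [this]
  refine Finset.single_le_sum (f := fun β : Δ.support ↦ orbF Δ σ α (coef Δ β (rt P i) • rt P β))
    (fun β _ ↦ ?_) (Finset.mem_univ α)
  change 0 ≤ orbF Δ σ α (coef Δ β (rt P i) • rt P β)
  rw [map_smul, orbF_simple β.2]
  refine smul_nonneg (IsPos.coef_nonneg Δ h β) ?_
  split_ifs <;> simp

lemma wordProd_smul_eq_self {m : List ι} {x : P.rootSpan ℤ}
    (φ : P.rootSpan ℤ →ₗ[ℤ] ℤ) (hm : ∀ i ∈ m, φ (rt P i) = 0) : φ (wordProd P m • x) = φ x := by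
  induction m with
  | nil => simp
  | cons i m ih =>
    rw [wordProd_cons, mul_smul, refl_smul_span, map_sub, φ.map_smul, hm i (by simp), smul_zero,
      sub_zero]
    exact ih fun k hk ↦ hm k (by simp [hk])

lemma coef_wordProd {m : List ι} (hm : ∀ i ∈ m, i ∈ Δ.support) {α : Δ.support} (hα : (α : ι) ∉ m)
    (x : P.rootSpan ℤ) : coef Δ α (wordProd P m • x) = coef Δ α x := by
  refine wordProd_smul_eq_self _ fun i hi ↦ ?_
  exact coef_ne Δ (β := ⟨i, hm i hi⟩) fun h ↦ hα (by rw [h]; exact hi)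

lemma coef_stable (hσ : ∀ i, σ • i ∈ Δ.support ↔ i ∈ Δ.support) {j : ι} (hj : j ∈ Δ.support)
    (x : P.rootSpan ℤ) : coef Δ ⟨σ • j, (hσ j).mpr hj⟩ (σ • x) = coef Δ ⟨j, hj⟩ x := by
  classical
  have : (coef Δ ⟨σ • j, (hσ j).mpr hj⟩).comp (spanMap σ) = coef Δ ⟨j, hj⟩ := by
    apply eq_of_simple Δ
    intro m hm
    have h1 := coef_simple Δ ⟨σ • j, (hσ j).mpr hj⟩ ⟨σ • m, (hσ m).mpr hm⟩
    have h2 := coef_simple Δ ⟨j, hj⟩ ⟨m, hm⟩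
    rw [LinearMap.comp_apply, spanMap_apply, ← rt_smul, h1, h2]
    congr 1
    simp [Subtype.ext_iff]
  exact LinearMap.congr_fun this x

lemma isPos_stable (hσ : ∀ i, σ • i ∈ Δ.support ↔ i ∈ Δ.support) {i : ι} :
    Δ.IsPos (σ • i) ↔ Δ.IsPos i := by
  have key : ∀ i, Δ.IsPos i → Δ.IsPos (σ • i) := by
    intro i h
    obtain ⟨α, hα⟩ := (isPos_iff_exists_coef Δ).mp h
    refine isPos_of_coef_pos Δ (α := ⟨σ • (α : ι), (hσ α).mpr α.2⟩) ?_
    rw [rt_smul, coef_stable hσ α.2]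
    exact hα
  refine ⟨fun h ↦ ?_, key i⟩
  by_contra h'
  rw [← isPos_refl_self] at h'
  have h2 := key _ h'
  have h3 : σ • refl P i • i = refl P (σ • i) • σ • i := by
    rw [refl_conj, mul_smul, mul_smul, inv_smul_smul]
  rw [h3, isPos_refl_self] at h2
  exact h2 h

namespace IsCoxWord

variable (H : IsCoxWord Δ σ l)
include H

lemma eq_of_orbit {i j : ι} (hi : i ∈ l) (hj : j ∈ l) (h : ∃ m : ℤ, σ ^ m • j = i) : i = j :=
  (H.transversal j (H.mem j hj)).unique ⟨hi, h⟩ ⟨hj, 0, by simp⟩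

/-- The letter j occurs once and no other letter lies in its σ-orbit, so only this one reflection
affects the orbit coweight. -/
lemma orbF_wordProd {a b : List ι} {j : ι} (hl : l = a ++ j :: b) (x : P.rootSpan ℤ) :
    orbF Δ σ j (wordProd P l • x) = orbF Δ σ j x - P.coroot' j (wordProd P b • x : P.rootSpan ℤ) := by
  have hj : j ∈ l := by simp [hl]
  have hnd := H.nodup
  rw [hl, List.nodup_middle, List.nodup_cons] at hnd
  have key : ∀ i ∈ a ++ b, orbF Δ σ j (rt P i) = 0 := by
    intro i hi
    have hil : i ∈ l := by rw [hl]; simp at hi ⊢; tauto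
    refine orbF_of_not_orbit (H.mem i hil) fun h ↦ hnd.1 ?_
    rwa [← H.eq_of_orbit hil hj h]
  rw [hl, wordProd_append, wordProd_cons, mul_smul, mul_smul,
    wordProd_smul_eq_self _ (fun i hi ↦ key i (by simp [hi])), refl_smul_span, map_sub, (orbF Δ σ j).map_smul,
    orbF_of_orbit (H.mem j hj) ⟨0, by simp⟩, wordProd_smul_eq_self _ (fun i hi ↦ key i (by simp [hi]))]
  simp

lemma orbF_coxeter {a b : List ι} {j : ι} (hl : l = a ++ j :: b) (x : P.rootSpan ℤ) :
    orbF Δ σ j ((wordProd P l * σ) • x) =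
      orbF Δ σ j x - P.coroot' j (wordProd P b • σ • x : P.rootSpan ℤ) := by
  rw [mul_smul, H.orbF_wordProd hl, orbF_smul H.stable]

/-- A twisted Coxeter element has no non-zero fixed vector in the root lattice. -/
lemma eq_zero_of_fixed [Finite ι] {x : P.rootSpan ℤ} (hx : (wordProd P l * σ) • x = x) : x = 0 := by
  -- Comparing the orbit coweight of j on x and on its image isolates the contribution of one
  -- reflection.
  have h1 : ∀ a b : List ι, ∀ j, l = a ++ j :: b → P.coroot' j (wordProd P b • σ • x : P.rootSpan ℤ) = 0 := by
    intro a b j hl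
    have := H.orbF_coxeter hl x
    rw [hx] at this
    linarith
  -- Read from the right, each reflection of the word therefore fixes σx.
  have h2 : ∀ b a : List ι, l = a ++ b → wordProd P b • σ • x = σ • x := by
    intro b
    induction b with
    | nil => simp
    | cons j b ih =>
      intro a hl
      have h3 := ih (a ++ [j]) (by simp [hl])
      have h4 := h1 a b j hl
      rw [wordProd_cons, mul_smul, refl_smul_span, h4, zero_smul, sub_zero, h3]
  have h3 : σ • x = x := by
    have := h2 l [] (by simp)
    rw [mul_smul] at hx
    rw [← this, hx]
  have h3' : ∀ m : ℤ, σ ^ m • x = x := by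
    intro m
    induction m with
    | zero => simp
    | succ m ih => rw [zpow_add, zpow_one, mul_smul, h3, ih]
    | pred m ih =>
      rw [zpow_sub, zpow_one, mul_smul]
      have : σ⁻¹ • x = x := by rw [inv_smul_eq_iff, h3]
      rw [this, ih]
  refine eq_zero_of_coroot'_eq_zero Δ fun i hi ↦ ?_
  obtain ⟨j, ⟨hj, m, hm⟩, -⟩ := H.transversal i hi
  obtain ⟨a, b, hl⟩ := List.append_of_mem hj
  have h4 := h1 a b j hl
  rw [h2 b (a ++ [j]) (by simp [hl]), h3, ← hm] at h4
  rw [← coroot'_smul (σ ^ m) i, ← coe_smul, h3' m]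
  exact h4

/-- A prefix not containing j leaves the coefficient 1 at the simple root j unchanged, so it sends
this root to a positive one and every letter adds an inversion. -/
lemma inv_wordProd [Finite ι] [P.IsReduced] : inv Δ (wordProd P l) = l.length := by
  have : ∀ m n : List ι, l = m ++ n → inv Δ (wordProd P m) = m.length := by
    intro m
    induction m using List.reverseRecOn with
    | nil => intro n _; exact inv_one Δ
    | append_singleton m j ih =>
      intro n hl
      have hj : j ∈ Δ.support := H.mem j (by simp [hl])
      have hnd := H.nodup
      rw [hl, List.nodup_append, List.nodup_append] at hnd
      have hjm : j ∉ m := fun h ↦ hnd.1.2.2 j h j (by simp) rfl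
      rw [wordProd_append, wordProd_cons, wordProd_nil, mul_one, inv_mul_refl_of_pos Δ hj,
        ih ([j] ++ n) (by simp [hl])]
      · simp
      · apply isPos_of_coef_pos Δ (α := ⟨j, hj⟩)
        rw [rt_smul, coef_wordProd (fun i hi ↦ H.mem i (by simp [hl, hi])) hjm]
        exact (coef_self Δ ⟨j, hj⟩).symm ▸ one_pos
  exact this l [] (by simp)

end IsCoxWord

end CoxeterWords

end CoxeterTorus

namespace CoxeterTorus
open RootPairing

/-! ### Orbits of a twisted Coxeter element on the roots. -/

section Orbits

variable {ι X Y : Type*} [AddCommGroup X] [AddCommGroup Y] {P : RootPairing ι ℤ X Y} [Finite ι]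

/-- The order of the permutation of the roots induced by an automorphism. -/
def rootOrder (τ : P.Aut) : ℕ := orderOf (MulAction.toPermHom P.Aut ι τ)

lemma rootOrder_pos (τ : P.Aut) : 0 < rootOrder τ := orderOf_pos _

lemma pow_rootOrder_smul (τ : P.Aut) (i : ι) : τ ^ rootOrder τ • i = i := by
  have := pow_orderOf_eq_one (MulAction.toPermHom P.Aut ι τ)
  rw [← map_pow] at this
  exact Equiv.Perm.congr_fun this i

lemma pow_rootOrder_smul_span (τ : P.Aut) (x : P.rootSpan ℤ) : τ ^ rootOrder τ • x = x := by
  have : spanMap (τ ^ rootOrder τ) = LinearMap.id := by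
    apply eq_of_rt
    intro i
    rw [spanMap_apply, ← rt_smul, pow_rootOrder_smul]; rfl
  exact LinearMap.congr_fun this x

lemma rootOrder_dvd {τ : P.Aut} {m : ℕ} (h : ∀ i : ι, τ ^ m • i = i) : rootOrder τ ∣ m := by
  apply orderOf_dvd_of_pow_eq_one
  rw [← map_pow]
  exact Equiv.Perm.ext h

lemma pow_add_mul_smul (τ : P.Aut) (k n : ℕ) (i : ι) : τ ^ (k + n * rootOrder τ) • i = τ ^ k • i := by
  induction n with
  | zero => simp
  | succ n ih =>
    rw [show k + (n + 1) * rootOrder τ = (k + n * rootOrder τ) + rootOrder τ by ring, pow_add,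
      mul_smul, pow_rootOrder_smul, ih]

/-- Negative powers are positive powers on roots. -/
lemma exists_pow_eq_zpow (τ : P.Aut) (m : ℤ) : ∃ n : ℕ, ∀ i : ι, τ ^ m • i = τ ^ n • i := by
  obtain ⟨n, hn⟩ : ∃ n : ℕ, (n : ℤ) = m + |m| * rootOrder τ := by
    refine ⟨(m + |m| * rootOrder τ).toNat, Int.toNat_of_nonneg ?_⟩
    have : (1 : ℤ) ≤ rootOrder τ := by exact_mod_cast rootOrder_pos τ
    nlinarith [neg_abs_le m, abs_nonneg m]
  refine ⟨n, fun i ↦ ?_⟩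
  have := pow_add_mul_smul τ 0 m.natAbs i
  rw [zero_add, pow_zero, one_smul, ← zpow_natCast, Nat.cast_mul, Int.natCast_natAbs] at this
  rw [← zpow_natCast τ n, hn, zpow_add, mul_smul, this]

variable {Δ : P.Base} {σ : P.Aut} {l : List ι}

/-- The orbit sums of an automorphism without fixed vectors vanish. -/
lemma sum_pow_smul_eq_zero {τ : P.Aut} (hτ : ∀ x : P.rootSpan ℤ, τ • x = x → x = 0)
    {p : ℕ} {x : P.rootSpan ℤ} (hx : τ ^ p • x = x) :
    ∑ k ∈ Finset.range p, τ ^ k • x = 0 := by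
  apply hτ
  rw [Finset.smul_sum]
  have h1 := Finset.sum_range_succ (fun k ↦ τ ^ k • x) p
  have h2 := Finset.sum_range_succ' (fun k ↦ τ ^ k • x) p
  rw [h1] at h2
  simp only [pow_zero, one_smul, hx] at h2
  rw [add_right_cancel h2]
  simp_rw [pow_succ', mul_smul]

/-- On an orbit sum, which vanishes, an invariant form takes a positive multiple of its value at x.
-/
lemma eq_zero_of_comp_eq {A : Type*} [AddCommGroup A] [IsAddTorsionFree A] {τ : P.Aut}
    (hτ : ∀ x : P.rootSpan ℤ, τ • x = x → x = 0) {φ : P.rootSpan ℤ →ₗ[ℤ] A}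
    (hφ : ∀ x, φ (τ • x) = φ x) : φ = 0 := by
  ext x
  have h := congrArg φ (sum_pow_smul_eq_zero hτ (pow_rootOrder_smul_span τ x))
  have h' : ∀ k, φ (τ ^ k • x) = φ x := by
    intro k
    induction k with
    | zero => simp
    | succ k ih => rw [pow_succ', mul_smul, hφ, ih]
  simp only [map_sum, h', Finset.sum_const, Finset.card_range, map_zero] at h
  exact (nsmul_eq_zero_iff.mp h).resolve_right (rootOrder_pos τ).ne'

/-- The sign of the roots changes in each orbit of an automorphism without fixed vectors. -/
lemma exists_pos_neg {A : Type*} [AddCommGroup A] [LinearOrder A] [IsOrderedAddMonoid A]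
    {τ : P.Aut} (hτ : ∀ x : P.rootSpan ℤ, τ • x = x → x = 0)
    {φ : P.rootSpan ℤ →ₗ[ℤ] A} (hφ : ∀ i, φ (rt P i) ≠ 0) (i : ι) :
    ∃ k : ℕ, 0 < φ (rt P (τ ^ k • i)) ∧ φ (rt P (τ ^ (k + 1) • i)) < 0 := by
  have h := congrArg φ (sum_pow_smul_eq_zero hτ (pow_rootOrder_smul_span τ (rt P i)))
  simp only [map_sum, map_zero, ← rt_smul] at h
  have hpos := rootOrder_pos τ
  obtain ⟨a, ha⟩ : ∃ a : ℕ, 0 < φ (rt P (τ ^ a • i)) := by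
    by_contra! h'
    have := Finset.sum_eq_zero_iff_of_nonpos (s := Finset.range (rootOrder τ)) (fun k _ ↦ h' k)
    exact hφ _ (this.mp h 0 (Finset.mem_range.mpr hpos))
  obtain ⟨b, hb⟩ : ∃ b : ℕ, φ (rt P (τ ^ b • i)) < 0 := by
    by_contra! h'
    have := Finset.sum_eq_zero_iff_of_nonneg (s := Finset.range (rootOrder τ)) (fun k _ ↦ h' k)
    exact hφ _ (this.mp h 0 (Finset.mem_range.mpr hpos))
  -- By periodicity a negative value occurs after the positive one at a; the first such value
  -- directly follows a positive one.
  have hex : ∃ n : ℕ, φ (rt P (τ ^ (a + n) • i)) < 0 := by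
    refine ⟨b + a * rootOrder τ - a, ?_⟩
    have : a ≤ b + a * rootOrder τ := by nlinarith
    rw [Nat.add_sub_cancel' this, pow_add_mul_smul]
    exact hb
  classical
  have h1 := Nat.find_spec hex
  have h2 : Nat.find hex ≠ 0 := by
    intro h0
    rw [h0, add_zero] at h1
    exact absurd ha (not_lt.mpr h1.le)
  obtain ⟨n, hn⟩ := Nat.exists_eq_succ_of_ne_zero h2
  have h3 := Nat.find_min hex (m := n) (by omega)
  refine ⟨a + n, lt_of_le_of_ne (not_lt.mp h3) (hφ _).symm, ?_⟩
  rw [hn] at h1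
  exact h1

/-- In each orbit of a twisted Coxeter element on the roots of a root system with connected Dynkin
diagram, each simple root occurs in some root. -/
lemma IsCoxWord.exists_coef_ne_zero (H : IsCoxWord Δ σ l) (hconn : IsConnectedDynkin Δ) (i : ι)
    (α : Δ.support) : ∃ k : ℕ, coef Δ α (rt P ((wordProd P l * σ) ^ k • i)) ≠ 0 := by
  classical
  set τ := wordProd P l * σ with hτ
  -- J collects the simple roots occurring in the orbit of i. It is shown to be σ-stable and closed
  -- under adjacency, so connectedness makes it the whole base.
  let J : Finset ι := Δ.support.filter fun j ↦ ∃ hj : j ∈ Δ.support, ∃ k : ℕ,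
    coef Δ ⟨j, hj⟩ (rt P (τ ^ k • i)) ≠ 0
  have memJ : ∀ j (hj : j ∈ Δ.support), j ∈ J ↔ ∃ k : ℕ, coef Δ ⟨j, hj⟩ (rt P (τ ^ k • i)) ≠ 0 := by
    intro j hj
    simp only [J, Finset.mem_filter, hj, true_and, exists_true_left]
  -- Positive exponents suffice, since τ has finite order on the roots.
  have memJ' : ∀ j (hj : j ∈ Δ.support), j ∈ J ↔ ∃ k : ℕ, coef Δ ⟨j, hj⟩ (rt P (τ ^ (k + 1) • i)) ≠ 0 := by
    intro j hj
    rw [memJ j hj]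
    constructor
    · rintro ⟨k, hk⟩
      obtain ⟨n, hn⟩ := Nat.exists_eq_succ_of_ne_zero (rootOrder_pos τ).ne'
      refine ⟨k + n, ?_⟩
      rw [show k + n + 1 = k + 1 * rootOrder τ by rw [hn]; simp; ring, pow_add_mul_smul]
      exact hk
    · rintro ⟨k, hk⟩
      exact ⟨_, hk⟩
  have hstep : ∀ k : ℕ, rt P (τ ^ (k + 1) • i) = wordProd P l • σ • rt P (τ ^ k • i) := by
    intro k
    rw [pow_succ', mul_smul, rt_smul, hτ, mul_smul]
  have hcσ : ∀ j (hj : j ∈ Δ.support) (x : P.rootSpan ℤ),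
      coef Δ ⟨σ • j, (H.stable j).mpr hj⟩ (σ • x) = coef Δ ⟨j, hj⟩ x :=
    fun j hj x ↦ coef_stable H.stable hj x
  -- the set of letters that occur is stable under the diagram automorphism
  have hJσ : ∀ j ∈ Δ.support, σ • j ∉ l → (σ • j ∈ J ↔ j ∈ J) := by
    intro j hj hjl
    rw [memJ' _ ((H.stable j).mpr hj), memJ j hj]
    refine exists_congr fun k ↦ ?_
    rw [hstep, coef_wordProd H.mem hjl, hcσ]
  -- Going round a σ-orbit from a letter, no other letter is met before the return to the start.
  have hJl : ∀ j ∈ l, ∀ m : ℕ, (σ ^ m • j ∈ J ↔ j ∈ J) := by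
    intro j hj m
    induction m with
    | zero => simp
    | succ m ih =>
      by_cases h : σ ^ (m + 1) • j = j
      · rw [h]
      · have hm : σ ^ m • j ∈ Δ.support := by
          rw [← zpow_natCast, zpow_smul_mem H.stable]; exact H.mem j hj
        have hs : σ ^ (m + 1) • j = σ • σ ^ m • j := by rw [pow_succ', mul_smul]
        rw [← ih, hs]
        apply hJσ _ hm
        intro hl
        rw [← hs] at hl
        exact h (H.eq_of_orbit hl hj ⟨m + 1, by rw [← zpow_natCast]; push_cast; rfl⟩)
  have hJ : ∀ j ∈ l, ∀ m : ℤ, (σ ^ m • j ∈ J ↔ j ∈ J) := by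
    intro j hj m
    obtain ⟨n, hn⟩ := exists_pow_eq_zpow σ m
    rw [hn, hJl j hj]
  have hJs : ∀ j ∈ Δ.support, (σ • j ∈ J ↔ j ∈ J) := by
    intro j hj
    obtain ⟨r, ⟨hr, m, hm⟩, -⟩ := H.transversal j hj
    have : j = σ ^ (-m) • r := by rw [← hm, zpow_neg, inv_smul_smul]
    rw [this, smul_smul, ← zpow_one_add, hJ r hr, hJ r hr]
  have hJz : ∀ j ∈ Δ.support, ∀ m : ℤ, (σ ^ m • j ∈ J ↔ j ∈ J) := by
    intro j hj m
    obtain ⟨r, ⟨hr, n, hn⟩, -⟩ := H.transversal j hj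
    have : j = σ ^ (-n) • r := by rw [← hn, zpow_neg, inv_smul_smul]
    rw [this, smul_smul, ← zpow_add, hJ r hr, hJ r hr]
  -- Split the word as l = a r b. If r misses J, the root z = bστ^k i has r-coefficient zero before
  -- and after the reflection in r, so it pairs to zero with the coroot of r. Its coefficients share
  -- one sign and the other simple roots pair non-positively with this coroot; hence no simple root
  -- adjacent to r occurs in z.
  have hadj : ∀ r ∈ l, r ∉ J → ∀ j ∈ Δ.support, P.pairing j r ≠ 0 → j ∉ J := by
    intro r hr hrJ j hj hjr hjJ
    obtain ⟨a, b, hl⟩ := List.append_of_mem hr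
    have hrs := H.mem r hr
    have hnd := H.nodup
    rw [hl, List.nodup_middle, List.nodup_cons, List.mem_append, not_or] at hnd
    have hne : j ≠ r := by rintro rfl; exact hrJ hjJ
    have hbm : ∀ m ∈ b, m ∈ Δ.support := fun m hm ↦ H.mem m (by simp [hl, hm])
    have ham : ∀ m ∈ a, m ∈ Δ.support := fun m hm ↦ H.mem m (by simp [hl, hm])
    have hrσ : σ⁻¹ • r ∈ Δ.support := by rw [← H.stable, smul_inv_smul]; exact hrs
    have hjσ : σ⁻¹ • j ∈ Δ.support := by rw [← H.stable, smul_inv_smul]; exact hj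
    -- the intermediate root
    have hz : ∀ k : ℕ, wordProd P b • σ • rt P (τ ^ k • i) = rt P (wordProd P b • σ • τ ^ k • i) := by
      intro k; rw [rt_smul (wordProd P b), rt_smul σ]
    have hcr : ∀ k : ℕ, coef Δ ⟨r, hrs⟩ (rt P (wordProd P b • σ • τ ^ k • i)) = 0 := by
      intro k
      rw [← hz, coef_wordProd hbm hnd.1.2]
      have h1 := hcσ _ hrσ (rt P (τ ^ k • i))
      simp only [smul_inv_smul] at h1
      rw [h1]
      by_contra h2
      have h3 : σ⁻¹ • r ∈ J := (memJ _ hrσ).mpr ⟨k, h2⟩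
      rw [← hJs _ hrσ, smul_inv_smul] at h3
      exact hrJ h3
    have hco : ∀ k : ℕ, P.coroot' r (rt P (wordProd P b • σ • τ ^ k • i) : P.rootSpan ℤ) = 0 := by
      intro k
      have h1 : coef Δ ⟨r, hrs⟩ (rt P (τ ^ (k + 1) • i)) = 0 := by
        by_contra h2
        exact hrJ ((memJ' _ hrs).mpr ⟨k, h2⟩)
      rw [hstep, hl, wordProd_append, wordProd_cons, mul_smul, mul_smul, coef_wordProd ham hnd.1.1,
        hz, refl_smul_span, map_sub, hcr k, (coef Δ ⟨r, hrs⟩).map_smul, coef_self Δ ⟨r, hrs⟩] at h1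
      simpa using h1
    have hcj : ∀ k : ℕ, coef Δ ⟨j, hj⟩ (rt P (wordProd P b • σ • τ ^ k • i)) = 0 := by
      intro k
      set z := wordProd P b • σ • τ ^ k • i with hzdef
      have h1 : P.coroot' r (rt P z : P.rootSpan ℤ) =
          ∑ β : Δ.support, coef Δ β (rt P z) * P.pairing β r := by
        conv_lhs => rw [← sum_coef Δ (rt P z)]
        rw [Submodule.coe_sum, map_sum]
        refine Finset.sum_congr rfl fun β _ ↦ ?_
        rw [Submodule.coe_smul, map_smul, smul_eq_mul, coe_rt, root_coroot'_eq_pairing]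
      rw [hco k] at h1
      have hle : ∀ β : Δ.support, (β : ι) ≠ r → P.pairing β r ≤ 0 := by
        intro β hβ
        have := Δ.pairingIn_le_zero_of_ne hβ β.2 hrs
        rwa [← P.algebraMap_pairingIn ℤ]
      have h2 : ∀ β : Δ.support, coef Δ β (rt P z) * P.pairing β r = 0 := by
        rcases coef_sign Δ z with hs | hs
        · have := (Finset.sum_eq_zero_iff_of_nonpos (s := Finset.univ)
            (f := fun β : Δ.support ↦ coef Δ β (rt P z) * P.pairing β r) ?_).mp h1.symm
          · exact fun β ↦ this β (Finset.mem_univ _)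
          · intro β _
            by_cases hβ : β = ⟨r, hrs⟩
            · rw [hβ, hcr k, zero_mul]
            · exact mul_nonpos_of_nonneg_of_nonpos (hs β) (hle β fun h ↦ hβ (Subtype.ext h))
        · have := (Finset.sum_eq_zero_iff_of_nonneg (s := Finset.univ)
            (f := fun β : Δ.support ↦ coef Δ β (rt P z) * P.pairing β r) ?_).mp h1.symm
          · exact fun β ↦ this β (Finset.mem_univ _)
          · intro β _
            by_cases hβ : β = ⟨r, hrs⟩
            · rw [hβ, hcr k, zero_mul]
            · exact mul_nonneg_of_nonpos_of_nonpos (hs β) (hle β fun h ↦ hβ (Subtype.ext h))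
      exact (mul_eq_zero.mp (h2 ⟨j, hj⟩)).resolve_right hjr
    -- The j-coefficient of z is that of τ^(k+1) i if the letter j has already been applied, and
    -- that of στ^k i otherwise.
    by_cases hjb : j ∈ b
    · obtain ⟨k, hk⟩ := (memJ' j hj).mp hjJ
      apply hk
      have hja : j ∉ a := by
        intro hja
        have := (List.nodup_append.mp hnd.2).2.2 j hja j hjb
        exact this rfl
      rw [hstep, hl, wordProd_append, wordProd_cons, mul_smul, mul_smul, coef_wordProd ham hja,
        hz, refl_smul_span, map_sub, hcj k, (coef Δ ⟨j, hj⟩).map_smul,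
        coef_ne Δ (α := ⟨j, hj⟩) (β := ⟨r, hrs⟩) (fun h ↦ hne (congrArg Subtype.val h))]
      simp
    · have h3 : σ⁻¹ • j ∈ J := by rwa [← hJs _ hjσ, smul_inv_smul]
      obtain ⟨k, hk⟩ := (memJ _ hjσ).mp h3
      apply hk
      have h4 := hcj k
      rw [← hz, coef_wordProd hbm hjb] at h4
      have h1 := hcσ _ hjσ (rt P (τ ^ k • i))
      simp only [smul_inv_smul] at h1
      rw [← h1, h4]
  have hJtop : J = Δ.support := by
    by_contra hne
    have hJne : J.Nonempty := by
      obtain ⟨β, hβ⟩ := CoxeterTorus.exists_coef_ne_zero Δ i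
      exact ⟨β, (memJ β β.2).mpr ⟨0, by simpa using hβ⟩⟩
    obtain ⟨j, hj, r, hr, hrJ, hjr⟩ := hconn.2 J (Finset.filter_subset _ _) hJne hne
    obtain ⟨s, ⟨hs, m, hm⟩, -⟩ := H.transversal r hr
    have hjs : j ∈ Δ.support := (Finset.mem_filter.mp hj).1
    have h1 : s ∉ J := by rw [← hm, hJz r hr]; exact hrJ
    refine hadj s hs h1 (σ ^ m • j) ((zpow_smul_mem H.stable m j).mpr hjs) ?_ ((hJz j hjs m).mpr hj)
    rw [← hm, pairing_smul]
    exact hjr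
  exact (memJ α α.2).mp (by rw [hJtop]; exact α.2)

end Orbits

end CoxeterTorus

namespace CoxeterTorus
open RootPairing

/-! ### Fourier coefficients of sequences with a single sign change. -/

section Analysis

open Real in
/-- A real sequence with at most one sign change and vanishing sum has a non-zero first Fourier
coefficient. -/
lemma fourier_ne_zero {p a : ℕ} (ha : 0 < a) (hap : a < p) (g : ℕ → ℝ) (hpos : ∀ k < a, 0 ≤ g k)
    (hneg : ∀ k, a ≤ k → k < p → g k ≤ 0) (hne : ∃ k < p, g k ≠ 0)
    (hsum : ∑ k ∈ Finset.range p, g k = 0) :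
    ∑ k ∈ Finset.range p, Complex.exp (2 * π * Complex.I / p) ^ k * (g k : ℂ) ≠ 0 := by
  intro h0
  have hp : (0 : ℝ) < p := by exact_mod_cast (ha.trans hap)
  have hexp : ∀ k : ℕ, Complex.exp (2 * π * Complex.I / p) ^ k =
      (cos (2 * π * k / p) : ℝ) + (sin (2 * π * k / p) : ℝ) * Complex.I := by
    intro k
    rw [Complex.ofReal_cos, Complex.ofReal_sin, ← Complex.exp_nat_mul, ← Complex.exp_mul_I]
    congr 1
    push_cast
    ring
  have hre' : ∀ c s x : ℝ, (((c : ℂ) + s * Complex.I) * x).re = x * c := by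
    intro c s x; simp [mul_comm]
  have him' : ∀ c s x : ℝ, (((c : ℂ) + s * Complex.I) * x).im = x * s := by
    intro c s x; simp [mul_comm]
  have hre : ∑ k ∈ Finset.range p, g k * cos (2 * π * k / p) = 0 := by
    have := congrArg Complex.re h0
    simp only [Complex.re_sum, hexp, Complex.zero_re, hre'] at this
    exact this
  have him : ∑ k ∈ Finset.range p, g k * sin (2 * π * k / p) = 0 := by
    have := congrArg Complex.im h0
    simp only [Complex.im_sum, hexp, Complex.zero_im, him'] at this
    exact this
  -- A test sequence with sign changes at −1/2 and a − 1/2, matching those of g. Up to an additive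
  -- constant it is a phase-shifted cosine of period p, so a vanishing Fourier coefficient would
  -- make it orthogonal to g.
  let T : ℕ → ℝ := fun k ↦ sin (π * (2 * k + 1) / (2 * p)) * sin (π * (2 * a - 2 * k - 1) / (2 * p))
  have hT : ∀ k, 2 * T k = cos (2 * π * k / p) * cos (π * (1 - a) / p) -
      sin (2 * π * k / p) * sin (π * (1 - a) / p) - cos (π * a / p) := by
    intro k
    have h1 := cos_sub (π * (2 * k + 1) / (2 * p)) (π * (2 * a - 2 * k - 1) / (2 * p))
    have h2 := cos_add (π * (2 * k + 1) / (2 * p)) (π * (2 * a - 2 * k - 1) / (2 * p))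
    have e1 : π * (2 * k + 1) / (2 * p) - π * (2 * a - 2 * k - 1) / (2 * p) =
        2 * π * k / p + π * (1 - a) / p := by field_simp; ring
    have e2 : π * (2 * k + 1) / (2 * p) + π * (2 * a - 2 * k - 1) / (2 * p) = π * a / p := by
      field_simp; ring
    rw [e1] at h1
    rw [e2] at h2
    rw [cos_add] at h1
    simp only [T]
    linarith
  have hsT : ∑ k ∈ Finset.range p, g k * (2 * T k) = 0 := by
    have : ∀ k, g k * (2 * T k) = (g k * cos (2 * π * k / p)) * cos (π * (1 - a) / p) -
      (g k * sin (2 * π * k / p)) * sin (π * (1 - a) / p) - g k * cos (π * a / p) := by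
      intro k; rw [hT]; ring
    simp only [this, Finset.sum_sub_distrib, ← Finset.sum_mul, hre, him, hsum]
    ring
  have hs1 : ∀ k < p, 0 < sin (π * (2 * k + 1) / (2 * p)) := by
    intro k hk
    have hk' : (k : ℝ) + 1 ≤ p := by exact_mod_cast hk
    apply sin_pos_of_pos_of_lt_pi
    · positivity
    · rw [div_lt_iff₀ (by positivity)]
      nlinarith [pi_pos]
  have hs2 : ∀ k < a, 0 < T k := by
    intro k hk
    have hk' : (k : ℝ) + 1 ≤ a := by exact_mod_cast hk
    have ha' : (a : ℝ) ≤ p := by exact_mod_cast hap.le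
    refine mul_pos (hs1 k (hk.trans hap)) (sin_pos_of_pos_of_lt_pi ?_ ?_)
    · apply div_pos (mul_pos pi_pos (by linarith)) (by positivity)
    · rw [div_lt_iff₀ (by positivity)]
      have : (0 : ℝ) ≤ k := Nat.cast_nonneg k
      nlinarith [pi_pos]
  have hs3 : ∀ k, a ≤ k → k < p → T k < 0 := by
    intro k hk hkp
    have hk' : (a : ℝ) ≤ k := by exact_mod_cast hk
    have hkp' : (k : ℝ) + 1 ≤ p := by exact_mod_cast hkp
    refine mul_neg_of_pos_of_neg (hs1 k hkp) (sin_neg_of_neg_of_neg_pi_lt ?_ ?_)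
    · apply div_neg_of_neg_of_pos (mul_neg_of_pos_of_neg pi_pos (by linarith)) (by positivity)
    · rw [lt_div_iff₀ (by positivity)]
      have : (0 : ℝ) ≤ a := Nat.cast_nonneg a
      nlinarith [pi_pos]
  have hnn : ∀ k ∈ Finset.range p, 0 ≤ g k * (2 * T k) := by
    intro k hk
    have hkp := Finset.mem_range.mp hk
    rcases lt_or_ge k a with h | h
    · exact mul_nonneg (hpos k h) (by linarith [hs2 k h])
    · exact mul_nonneg_of_nonpos_of_nonpos (hneg k h hkp) (by linarith [hs3 k h hkp])
  obtain ⟨k, hk, hgk⟩ := hne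
  have h1 := (Finset.sum_eq_zero_iff_of_nonneg hnn).mp hsT k (Finset.mem_range.mpr hk)
  rcases mul_eq_zero.mp h1 with h | h
  · exact hgk h
  · rcases lt_or_ge k a with h' | h'
    · linarith [hs2 k h']
    · linarith [hs3 k h' hk]

lemma sum_range_mul_of_periodic {A : Type*} [AddCommMonoid A] {p : ℕ} (f : ℕ → A)
    (hf : ∀ k, f (k + p) = f k) (m : ℕ) :
    ∑ k ∈ Finset.range (p * m), f k = m • ∑ k ∈ Finset.range p, f k := by
  induction m with
  | zero => simp
  | succ m ih =>
    rw [Nat.mul_succ, Finset.sum_range_add, ih, succ_nsmul]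
    congr 1
    refine Finset.sum_congr rfl fun k _ ↦ ?_
    clear ih
    induction m with
    | zero => simp
    | succ m ih => rw [← ih, ← hf (p * m + k)]; congr 1; ring

lemma sum_range_shift {A : Type*} [AddCommGroup A] {N : ℕ} (f : ℕ → A) (hf : ∀ k, f (k + N) = f k)
    (d : ℕ) : ∑ k ∈ Finset.range N, f (k + d) = ∑ k ∈ Finset.range N, f k := by
  induction d with
  | zero => simp
  | succ d ih =>
    rw [← ih]
    have h1 := Finset.sum_range_succ (fun k ↦ f (k + d)) N
    have h2 := Finset.sum_range_succ' (fun k ↦ f (k + d)) N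
    rw [h1] at h2
    have h3 : f (N + d) = f (0 + d) := by rw [← hf (0 + d)]; congr 1; ring
    rw [h3] at h2
    rw [add_right_cancel h2]
    refine Finset.sum_congr rfl fun k _ ↦ ?_
    congr 1; ring

end Analysis

/-! ### Uniqueness of the sign change in an orbit. -/

section Transitions

variable {ι X Y : Type*} [AddCommGroup X] [AddCommGroup Y] {P : RootPairing ι ℤ X Y} [Finite ι]
  [P.IsReduced] {Δ : P.Base} {σ : P.Aut} {l : List ι}

lemma eq_one_of_inv_eq_zero {w : P.Aut} (hw : w ∈ P.weylGroup) (h : inv Δ w = 0) : w = 1 := by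
  obtain ⟨l, hl, rfl⟩ := exists_word Δ hw
  obtain ⟨m, hm, hlen, hprod⟩ := exists_reduced_word Δ l hl
  rw [h, List.length_eq_zero_iff] at hlen
  rw [← hprod, hlen, wordProd_nil]

/-- Two dominant linear forms in the same Weyl orbit are equal. -/
lemma dominant_unique {φ : P.rootSpan ℤ →ₗ[ℤ] ℤ} (hφ : ∀ i, Δ.IsPos i → 0 ≤ φ (rt P i)) {w : P.Aut}
    (hw : w ∈ P.weylGroup) (hφw : ∀ i, Δ.IsPos i → 0 ≤ φ (w • rt P i)) (x : P.rootSpan ℤ) :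
    φ (w • x) = φ x := by
  induction hn : inv Δ w generalizing w x with
  | zero => rw [eq_one_of_inv_eq_zero hw hn, one_smul]
  | succ n ih =>
    obtain ⟨j, hj, hneg⟩ := exists_simple_neg Δ (g := w) (by omega)
    -- The image of j is a negative root, so its value is non-positive by dominance of φ and
    -- non-negative by dominance of the translate. The last reflection can then be dropped from w.
    have h0 : φ (w • rt P j) = 0 := by
      apply le_antisymm _ (hφw j (Base.isPos_of_mem_support hj))
      rw [← isPos_refl_self] at hneg
      have := hφ _ hneg
      rw [rt_refl_self, map_neg, rt_smul] at this
      linarith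
    have h1 : ∀ x, φ ((w * refl P j) • x) = φ (w • x) := by
      intro x
      rw [mul_smul, refl_smul_span, smul_sub, map_sub, ← spanMap_apply w (_ • _), (spanMap w).map_smul,
        φ.map_smul, spanMap_apply, h0, smul_zero, sub_zero]
    rw [← h1]
    refine ih (mul_mem hw (P.reflection_mem_weylGroup j)) (fun i hi ↦ ?_) x ?_
    · rw [h1]; exact hφw i hi
    · exact Nat.succ_injective ((inv_mul_refl_of_neg Δ hj hneg).trans hn)

lemma orbF_pow_smul (hσ : ∀ i, σ • i ∈ Δ.support ↔ i ∈ Δ.support) (k : ℕ) (j : ι)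
    (x : P.rootSpan ℤ) : orbF Δ σ j (σ ^ k • x) = orbF Δ σ j x := by
  induction k with
  | zero => simp
  | succ k ih => rw [pow_succ', mul_smul, orbF_smul hσ, ih]

/-- The sign changes at some letter, and a simple reflection makes no positive root but its own
negative. -/
lemma exists_split_of_neg {l : List ι} (hl : ∀ i ∈ l, i ∈ Δ.support) {i : ι} (hi : Δ.IsPos i)
    (h : ¬ Δ.IsPos (wordProd P l • i)) :
    ∃ a j b, l = a ++ j :: b ∧ wordProd P b • i = j := by
  induction l with
  | nil => exact absurd hi (by simpa using h)
  | cons j t ih =>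
    by_cases h' : Δ.IsPos (wordProd P t • i)
    · refine ⟨[], j, t, rfl, ?_⟩
      by_contra hne
      rw [wordProd_cons, mul_smul] at h
      exact h (isPos_refl Δ (hl j (by simp)) hne h')
    · obtain ⟨a, k, b, hab, hk⟩ := ih (fun k hk ↦ hl k (by simp [hk])) h'
      exact ⟨j :: a, k, b, by simp [hab], hk⟩

namespace IsCoxWord

variable (H : IsCoxWord Δ σ l)
include H

lemma eq_zero_of_fixed' (x : P.rootSpan ℤ) (hx : (wordProd P l * σ) • x = x) : x = 0 :=
  H.eq_zero_of_fixed hx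

omit [Finite ι] [P.IsReduced] H in
lemma append_cons_unique {l a a' b b' : List ι} {j : ι} (hnd : l.Nodup) (h : l = a ++ j :: b)
    (h' : l = a' ++ j :: b') : b = b' := by
  rw [h, List.nodup_middle, List.nodup_cons, List.mem_append, not_or] at hnd
  rw [h] at h'
  rcases List.append_eq_append_iff.mp h' with ⟨c, h1, h2⟩ | ⟨c, h1, h2⟩
  · cases c with
    | nil => simpa using h2
    | cons x c =>
      simp only [List.cons_append, List.cons.injEq] at h2
      exact absurd (by rw [h2.2]; simp) hnd.1.2
  · cases c with
    | nil => simpa using h2.symm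
    | cons x c =>
      simp only [List.cons_append, List.cons.injEq] at h2
      refine absurd ?_ hnd.1.1
      rw [h1, h2.1]; simp

lemma exists_split {i : ι} (hi : Δ.IsPos i) (h : ¬ Δ.IsPos ((wordProd P l * σ) • i)) :
    ∃ a j b, l = a ++ j :: b ∧ wordProd P b • σ • i = j := by
  rw [mul_smul] at h
  exact exists_split_of_neg H.mem ((isPos_stable H.stable).mpr hi) h

/-- Since bσ carries i to j, it identifies their coroots. This is the relation ω_j∘τ = ω_j − i^∨
behind all later statements about sign changes. -/
lemma orbF_sub {a b : List ι} {i j : ι} (hl : l = a ++ j :: b) (hj : wordProd P b • σ • i = j)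
    (x : P.rootSpan ℤ) :
    orbF Δ σ j ((wordProd P l * σ) • x) = orbF Δ σ j x - P.coroot' i (x : X) := by
  rw [H.orbF_coxeter hl, coe_smul, coe_smul]
  congr 1
  conv_lhs => rw [← hj]
  rw [coroot'_smul, coroot'_smul]

lemma pow_mul_mem (k : ℕ) : (wordProd P l * σ) ^ k * (σ ^ k)⁻¹ ∈ P.weylGroup := by
  induction k with
  | zero => simp
  | succ k ih =>
    have := mul_mem (wordProd_mem (P := P) l) (conj_mem_weylGroup σ ih)
    convert this using 1
    rw [pow_succ', pow_succ']
    group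

/-- The positive roots that a twisted Coxeter element makes negative lie in different orbits. -/
lemma eq_of_transition {i i' : ι} (hi : Δ.IsPos i) (h : ¬ Δ.IsPos ((wordProd P l * σ) • i))
    (hi' : Δ.IsPos i') (h' : ¬ Δ.IsPos ((wordProd P l * σ) • i')) {k : ℕ}
    (hk : (wordProd P l * σ) ^ k • i = i') : i = i' := by
  obtain ⟨a, j, b, hl, hj⟩ := H.exists_split hi h
  obtain ⟨a', j', b', hl', hj'⟩ := H.exists_split hi' h'
  set τ := wordProd P l * σ with hτ
  -- Under τ both terms change by the same coroot, so their difference is invariant and vanishes.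
  have hψ : orbF Δ σ j' - (orbF Δ σ j).comp (spanMap (τ ^ k)⁻¹) = 0 := by
    refine eq_zero_of_comp_eq (τ := τ) H.eq_zero_of_fixed' fun x ↦ ?_
    have h1 : (τ ^ k)⁻¹ • τ • x = τ • (τ ^ k)⁻¹ • x := by
      rw [smul_smul, smul_smul]; congr 1; group
    simp only [LinearMap.sub_apply, LinearMap.comp_apply, spanMap_apply]
    rw [h1, H.orbF_sub hl hj, H.orbF_sub hl' hj', ← hk]
    have h2 := coroot'_smul (τ ^ k) i ((τ ^ k)⁻¹ • (x : X))
    rw [smul_inv_smul] at h2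
    rw [h2, coe_smul]
    ring
  -- Orbit coweights are σ-invariant, so τ^k may be replaced by τ^k σ^(−k), which lies in the Weyl
  -- group. Uniqueness of dominant forms then applies.
  have hw : ∀ x, orbF Δ σ j' x = orbF Δ σ j ((τ ^ k * (σ ^ k)⁻¹)⁻¹ • x) := by
    intro x
    have h1 := LinearMap.congr_fun hψ x
    simp only [LinearMap.sub_apply, LinearMap.comp_apply, spanMap_apply, LinearMap.zero_apply] at h1
    rw [sub_eq_zero.mp h1, mul_inv_rev, inv_inv, mul_smul]
    exact (orbF_pow_smul H.stable k j _).symm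
  have heq : orbF Δ σ j' = orbF Δ σ j := by
    ext x
    rw [hw]
    refine dominant_unique (Δ := Δ) (fun i hi ↦ orbF_nonneg hi j) (inv_mem (H.pow_mul_mem k))
      (fun i hi ↦ ?_) x
    rw [← hw]
    exact orbF_nonneg hi j'
  have hjl : j ∈ l := by simp [hl]
  have hjl' : j' ∈ l := by simp [hl']
  have hjj : j' = j := by
    refine H.eq_of_orbit hjl' hjl ?_
    by_contra hno
    have h1 := orbF_of_not_orbit (Δ := Δ) (H.mem j' hjl') hno
    rw [← heq, orbF_of_orbit (H.mem j' hjl') ⟨0, by simp⟩] at h1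
    exact one_ne_zero h1
  subst hjj
  have hb := append_cons_unique H.nodup hl hl'
  subst hb
  rw [← hj'] at hj
  exact MulAction.injective _ (MulAction.injective _ hj)

end IsCoxWord
end Transitions

end CoxeterTorus

namespace CoxeterTorus
open RootPairing MulAction

/-! ### Eigenforms, and equality of all orbit sizes. -/

section Periods

variable {ι X Y : Type*} [AddCommGroup X] [AddCommGroup Y] {P : RootPairing ι ℤ X Y} [Finite ι]

lemma period_dvd_rootOrder (τ : P.Aut) (i : ι) : period τ i ∣ rootOrder τ :=
  pow_smul_eq_iff_period_dvd.mp (pow_rootOrder_smul τ i)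

lemma period_pos (τ : P.Aut) (i : ι) : 0 < period τ i :=
  Nat.pos_of_dvd_of_pos (period_dvd_rootOrder τ i) (rootOrder_pos τ)

lemma period_pow_smul (τ : P.Aut) (k : ℕ) (i : ι) : period τ (τ ^ k • i) = period τ i := by
  have : ∀ n, τ ^ n • τ ^ k • i = τ ^ k • i ↔ τ ^ n • i = i := by
    intro n
    rw [smul_smul, ← pow_add, add_comm, pow_add, mul_smul, smul_left_cancel_iff]
  apply Nat.dvd_antisymm
  · rw [← pow_smul_eq_iff_period_dvd, this, pow_smul_eq_iff_period_dvd]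
  · rw [← pow_smul_eq_iff_period_dvd, ← this, pow_smul_eq_iff_period_dvd]

/-- The `ζ`-component of a linear form with respect to an automorphism. -/
def eigenForm (τ : P.Aut) (ζ : ℂ) (φ : P.rootSpan ℤ →ₗ[ℤ] ℤ) : P.rootSpan ℤ →ₗ[ℤ] ℂ :=
  AddMonoidHom.toIntLinearMap
    { toFun := fun x ↦ ∑ k ∈ Finset.range (rootOrder τ), ζ ^ k * (φ (τ ^ k • x) : ℂ)
      map_zero' := by simp
      map_add' := fun x y ↦ by
        simp only [smul_add, map_add, Int.cast_add, mul_add, Finset.sum_add_distrib] }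

lemma eigenForm_apply (τ : P.Aut) (ζ : ℂ) (φ : P.rootSpan ℤ →ₗ[ℤ] ℤ) (x) :
    eigenForm τ ζ φ x = ∑ k ∈ Finset.range (rootOrder τ), ζ ^ k * (φ (τ ^ k • x) : ℂ) := rfl

variable {τ : P.Aut} {ζ : ℂ} (hζ : ζ ^ rootOrder τ = 1)
include hζ

lemma eigenForm_smul (φ : P.rootSpan ℤ →ₗ[ℤ] ℤ) (x) :
    ζ * eigenForm τ ζ φ (τ • x) = eigenForm τ ζ φ x := by
  rw [eigenForm_apply, eigenForm_apply, Finset.mul_sum]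
  rw [← sum_range_shift (fun k ↦ ζ ^ k * (φ (τ ^ k • x) : ℂ)) _ 1]
  · refine Finset.sum_congr rfl fun k _ ↦ ?_
    rw [pow_succ ζ, pow_succ τ, mul_smul]; ring
  · intro k
    simp only [pow_add, hζ, mul_one, mul_smul, pow_rootOrder_smul_span]

lemma eigenForm_pow_smul (φ : P.rootSpan ℤ →ₗ[ℤ] ℤ) (k : ℕ) (x) :
    ζ ^ k * eigenForm τ ζ φ (τ ^ k • x) = eigenForm τ ζ φ x := by
  induction k with
  | zero => simp
  | succ k ih => rw [← ih, pow_succ, pow_succ', mul_smul, mul_assoc, eigenForm_smul hζ]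

end Periods

section CoxeterNumber

variable {ι X Y : Type*} [AddCommGroup X] [AddCommGroup Y] {P : RootPairing ι ℤ X Y} [Finite ι]
  [P.IsReduced] {Δ : P.Base} {σ : P.Aut} {l : List ι}

/-- The sum of the coefficients. -/
def htForm (Δ : P.Base) : P.rootSpan ℤ →ₗ[ℤ] ℤ := ∑ α : Δ.support, coef Δ α

lemma htForm_apply (x : P.rootSpan ℤ) : htForm Δ x = ∑ α : Δ.support, coef Δ α x := by
  simp [htForm, LinearMap.sum_apply]

lemma isPos_iff_htForm {i : ι} : Δ.IsPos i ↔ 0 < htForm Δ (rt P i) := by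
  rw [htForm_apply, ← height_eq, Base.isPos_iff]

lemma htForm_ne_zero (i : ι) : htForm Δ (rt P i) ≠ 0 := by
  rw [htForm_apply, ← height_eq]; exact Δ.height_ne_zero i

lemma not_isPos_iff_htForm {i : ι} : ¬ Δ.IsPos i ↔ htForm Δ (rt P i) < 0 := by
  rw [isPos_iff_htForm, not_lt]
  exact ⟨fun h ↦ lt_of_le_of_ne h (htForm_ne_zero i), le_of_lt⟩

/-- A predicate on `ℕ` that holds at `m` and fails at a later point switches in between. -/
lemma exists_switch {p : ℕ → Prop} {m n : ℕ} (hmn : m ≤ n) (hm : p m) (hn : ¬ p n) :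
    ∃ k, m ≤ k ∧ k < n ∧ p k ∧ ¬ p (k + 1) := by
  by_contra! h
  have : ∀ k, m ≤ k → k ≤ n → p k := by
    intro k hk
    induction k, hk using Nat.le_induction with
    | base => exact fun _ ↦ hm
    | succ k hk ih => exact fun hk' ↦ h k hk (by omega) (ih (by omega))
  exact hn (this n hmn le_rfl)

namespace IsCoxWord

variable (H : IsCoxWord Δ σ l)
include H

/-- Each orbit of a twisted Coxeter element consists of a run of positive roots followed by a run of
negative roots. -/
lemma exists_run (i : ι) : ∃ s a : ℕ, 0 < a ∧ a < period (wordProd P l * σ) i ∧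
    (∀ k < a, Δ.IsPos ((wordProd P l * σ) ^ k • (wordProd P l * σ) ^ s • i)) ∧
    ∀ k, a ≤ k → k < period (wordProd P l * σ) i →
      ¬ Δ.IsPos ((wordProd P l * σ) ^ k • (wordProd P l * σ) ^ s • i) := by
  classical
  set τ := wordProd P l * σ with hτ
  -- The negated height yields a negative root followed by a positive one: the start of the positive
  -- run.
  obtain ⟨k, hk1, hk2⟩ := exists_pos_neg (τ := τ) H.eq_zero_of_fixed' (φ := -htForm Δ)
    (fun i ↦ by simpa using htForm_ne_zero i) i
  rw [LinearMap.neg_apply, neg_pos, ← not_isPos_iff_htForm] at hk1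
  rw [LinearMap.neg_apply, neg_lt_zero, ← isPos_iff_htForm] at hk2
  set γ := τ ^ (k + 1) • i with hγ
  have hper : period τ γ = period τ i := period_pow_smul τ _ i
  rw [← hper]
  set p := period τ γ with hp
  have hp0 : 0 < p := period_pos τ γ
  have hlast : ¬ Δ.IsPos (τ ^ (p - 1) • γ) := by
    have : τ ^ (p - 1) • γ = τ ^ k • i := by
      apply MulAction.injective τ
      simp only [smul_smul, ← pow_succ']
      rw [Nat.sub_add_cancel hp0, hp, pow_period_smul]
    rwa [this]
  have hex : ∃ n, ¬ Δ.IsPos (τ ^ n • γ) := ⟨_, hlast⟩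
  refine ⟨k + 1, Nat.find hex, ?_, ?_, fun n hn ↦ not_not.mp (Nat.find_min hex hn), ?_⟩
  · rw [Nat.find_pos]
    simpa using hk2
  · have := Nat.find_min' hex hlast
    omega
  · intro n hn hnp hpos
    have ha : 0 < Nat.find hex := by rw [Nat.find_pos]; simpa using hk2
    obtain ⟨m, hm1, hm2, hm3, hm4⟩ := exists_switch (p := fun n ↦ Δ.IsPos (τ ^ n • γ)) (m := n)
      (n := p - 1) (by omega) hpos hlast
    have h1 : Δ.IsPos (τ ^ (Nat.find hex - 1) • γ) :=
      not_not.mp (Nat.find_min hex (m := Nat.find hex - 1) (by omega))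
    have h2 : ¬ Δ.IsPos (τ • τ ^ (Nat.find hex - 1) • γ) := by
      rw [smul_smul, ← pow_succ', Nat.sub_add_cancel ha]
      exact Nat.find_spec hex
    have h3 : ¬ Δ.IsPos (τ • τ ^ m • γ) := by
      rw [smul_smul, ← pow_succ']
      exact hm4
    -- A later positive root gives a second change of sign. It must happen at the same root, so the
    -- period would divide an exponent between 1 and the period minus 1.
    have h4 := H.eq_of_transition h1 h2 hm3 h3 (k := m - (Nat.find hex - 1)) (by
      rw [← hτ, smul_smul, ← pow_add]
      congr 2
      omega)
    have h5 : τ ^ (m - (Nat.find hex - 1)) • γ = γ := by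
      apply MulAction.injective (τ ^ (Nat.find hex - 1))
      simp only [smul_smul, ← pow_add]
      rw [Nat.add_sub_cancel' (by omega), ← h4]
    have h6 := Nat.le_of_dvd (by omega) (pow_smul_eq_iff_period_dvd.mp h5)
    omega

/-- Along the orbit φ has one non-negative and one non-positive run and sums to zero, so
`fourier_ne_zero` applies to one period. The sum over the full order of τ is a positive multiple of
that sum. -/
lemma eigenForm_ne_zero {φ : P.rootSpan ℤ →ₗ[ℤ] ℤ} (hφ : ∀ i, Δ.IsPos i → 0 ≤ φ (rt P i)) {i : ι}
    (hi : ∃ k : ℕ, φ (rt P ((wordProd P l * σ) ^ k • i)) ≠ 0) :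
    eigenForm (wordProd P l * σ)
      (Complex.exp (2 * Real.pi * Complex.I / (period (wordProd P l * σ) i : ℕ))) φ (rt P i) ≠ 0 := by
  obtain ⟨s, a, ha, hap, hpos, hneg⟩ := H.exists_run i
  set τ := wordProd P l * σ with hτ
  set p := period τ i with hp
  set γ := τ ^ s • i with hγ
  have hp0 : p ≠ 0 := (period_pos τ i).ne'
  have hper : ∀ k, τ ^ (k + p) • γ = τ ^ k • γ := by
    intro k
    have := pow_period_smul τ γ
    rw [hγ, period_pow_smul, ← hp, ← hγ] at this
    rw [pow_add, mul_smul, this]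
  have hprim := Complex.isPrimitiveRoot_exp p hp0
  set ζ := Complex.exp (2 * Real.pi * Complex.I / p) with hζ
  obtain ⟨m, hm⟩ := period_dvd_rootOrder τ i
  have hζN : ζ ^ rootOrder τ = 1 := by rw [hm, pow_mul, hprim.pow_eq_one, one_pow]
  have hneg' : ∀ i, ¬ Δ.IsPos i → φ (rt P i) ≤ 0 := by
    intro i h
    rw [← isPos_refl_self] at h
    have := hφ _ h
    rw [rt_refl_self, map_neg] at this
    linarith
  rw [← eigenForm_pow_smul hζN φ s (rt P i), ← rt_smul]
  refine mul_ne_zero (pow_ne_zero _ (Complex.exp_ne_zero _)) ?_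
  rw [← hγ, eigenForm_apply]
  simp_rw [← rt_smul]
  rw [hm, sum_range_mul_of_periodic (p := p) (fun k ↦ ζ ^ k * (φ (rt P (τ ^ k • γ)) : ℂ))]
  swap
  · intro k
    simp only [hper]
    rw [pow_add ζ, hprim.pow_eq_one, mul_one]
  have hm0 : m ≠ 0 := by rintro rfl; exact (rootOrder_pos τ).ne' (by rw [hm, mul_zero])
  refine smul_ne_zero hm0 ?_
  have := fourier_ne_zero ha hap (fun k ↦ (φ (rt P (τ ^ k • γ)) : ℝ))
    (fun k hk ↦ by exact_mod_cast hφ _ (hpos k hk))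
    (fun k hk hkp ↦ by exact_mod_cast hneg' _ (hneg k hk hkp)) ?_ ?_
  · simpa using this
  · by_contra! h
    obtain ⟨k, hk⟩ := hi
    apply hk
    -- write `k` relative to the start of the run
    have h1 : τ ^ k • i = τ ^ ((k + s * rootOrder τ - s) % p) • γ := by
      have h2 : s ≤ k + s * rootOrder τ := by
        have := rootOrder_pos τ
        nlinarith
      have h3 : ∀ n q, τ ^ (n + p * q) • γ = τ ^ n • γ := by
        intro n q
        induction q with
        | zero => simp
        | succ q ih => rw [Nat.mul_succ, ← add_assoc, hper, ih]
      rw [← h3 _ ((k + s * rootOrder τ - s) / p), Nat.mod_add_div, hγ, smul_smul, ← pow_add,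
        Nat.sub_add_cancel h2, pow_add_mul_smul]
    rw [h1]
    exact_mod_cast h _ (Nat.mod_lt _ (Nat.pos_of_ne_zero hp0))
  · have hfix : τ ^ p • rt P γ = rt P γ := by
      rw [← rt_smul]
      have := hper 0
      rw [zero_add, pow_zero, one_smul] at this
      rw [this]
    have := congrArg φ (sum_pow_smul_eq_zero (τ := τ) H.eq_zero_of_fixed' hfix)
    simp only [map_sum, map_zero, ← rt_smul] at this
    exact_mod_cast this

/-- By ω_j∘τ = ω_j − i^∨, the ζ-component of ω_j times 1 − ζ⁻¹ is the sum of ζ^k i^∨(τ^k x).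
Shifting k by the period d of i multiplies this sum by ζ^d. As it is non-zero for some x, ζ^d = 1.
-/
lemma period_dvd_of_transition {i : ι} (hi : Δ.IsPos i) (h : ¬ Δ.IsPos ((wordProd P l * σ) • i))
    {p : ℕ} (hp : p ≠ 0) (hp1 : p ≠ 1) (hpN : p ∣ rootOrder (wordProd P l * σ))
    (hne : ∀ j ∈ Δ.support, ∃ x, eigenForm (wordProd P l * σ)
      (Complex.exp (2 * Real.pi * Complex.I / p)) (orbF Δ σ j) x ≠ 0) :
    p ∣ period (wordProd P l * σ) i := by
  obtain ⟨a, j, b, hl, hj⟩ := H.exists_split hi h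
  obtain ⟨x, hx⟩ := hne j (H.mem j (by simp [hl]))
  have hsub := H.orbF_sub hl hj
  set τ := wordProd P l * σ with hτ
  have hprim := Complex.isPrimitiveRoot_exp p hp
  set ζ := Complex.exp (2 * Real.pi * Complex.I / p) with hζ
  obtain ⟨m, hm⟩ := hpN
  have hζN : ζ ^ rootOrder τ = 1 := by rw [hm, pow_mul, hprim.pow_eq_one, one_pow]
  set d := period τ i with hd
  set f : ℕ → ℂ := fun k ↦ ζ ^ k * (P.coroot' i ((τ ^ k • x : P.rootSpan ℤ) : X) : ℂ) with hf
  have hS : eigenForm τ ζ (orbF Δ σ j) x - eigenForm τ ζ (orbF Δ σ j) (τ • x) =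
      ∑ k ∈ Finset.range (rootOrder τ), f k := by
    rw [eigenForm_apply, eigenForm_apply, ← Finset.sum_sub_distrib]
    refine Finset.sum_congr rfl fun k _ ↦ ?_
    have : τ ^ k • τ • x = τ • τ ^ k • x := by rw [smul_smul, smul_smul, ← pow_succ, pow_succ']
    rw [this, hsub, hf]
    push_cast
    ring
  have hfd : ∀ k, f (k + d) = ζ ^ d * f k := by
    intro k
    have h1 : P.coroot' i ((τ ^ (k + d) • x : P.rootSpan ℤ) : X) =
        P.coroot' i ((τ ^ k • x : P.rootSpan ℤ) : X) := by
      rw [add_comm, pow_add, mul_smul, coe_smul (τ ^ d)]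
      conv_lhs => rw [← pow_period_smul τ i, ← hd]
      rw [coroot'_smul]
    simp only [hf, h1]
    rw [pow_add ζ]
    ring
  have hshift := sum_range_shift f (N := rootOrder τ) (fun k ↦ by
    simp only [hf, pow_add, hζN, mul_one, mul_smul, pow_rootOrder_smul_span]) d
  simp only [hfd, ← Finset.mul_sum, ← hS] at hshift
  have hne : eigenForm τ ζ (orbF Δ σ j) x - eigenForm τ ζ (orbF Δ σ j) (τ • x) ≠ 0 := by
    intro h0
    have h1 := eigenForm_smul hζN (orbF Δ σ j) x
    rw [← sub_eq_zero.mp h0] at h1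
    exact hprim.ne_one (by omega) (mul_right_cancel₀ hx (h1.trans (one_mul _).symm))
  have h1 : ζ ^ d = 1 := mul_right_cancel₀ hne (hshift.trans (one_mul _).symm)
  exact hprim.dvd_of_pow_eq_one d h1

lemma period_ne_one (i : ι) : period (wordProd P l * σ) i ≠ 1 := by
  intro h
  rw [period_eq_one_iff] at h
  refine rt_ne_zero i (H.eq_zero_of_fixed' _ ?_)
  rw [← rt_smul, h]

/-- All orbits of a twisted Coxeter element on the roots have the same size. -/
lemma period_eq (hconn : IsConnectedDynkin Δ) (i : ι) :
    period (wordProd P l * σ) i = rootOrder (wordProd P l * σ) := by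
  set τ := wordProd P l * σ with hτ
  have : Nonempty ι := ⟨i⟩
  -- A maximal period divides every other period, because each orbit contains a sign change.
  obtain ⟨i₀, h0⟩ := Finite.exists_max (fun i : ι ↦ period τ i)
  have hall : ∀ i : ι, period τ i = period τ i₀ := by
    intro i
    obtain ⟨k, hk1, hk2⟩ := exists_pos_neg (τ := τ) H.eq_zero_of_fixed' (φ := htForm Δ)
      htForm_ne_zero i
    rw [← isPos_iff_htForm] at hk1
    rw [← not_isPos_iff_htForm, pow_succ', mul_smul] at hk2
    apply le_antisymm (h0 i)
    rw [← period_pow_smul τ k i]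
    refine Nat.le_of_dvd (period_pos _ _) (H.period_dvd_of_transition hk1 hk2 (period_pos _ _).ne'
      (H.period_ne_one i₀) (period_dvd_rootOrder τ i₀) fun j hj ↦ ⟨rt P i₀, ?_⟩)
    refine H.eigenForm_ne_zero (fun i hi ↦ orbF_nonneg hi j) ?_
    obtain ⟨k, hk⟩ := H.exists_coef_ne_zero hconn i₀ ⟨j, hj⟩
    refine ⟨k, fun h ↦ hk ?_⟩
    set m := (wordProd P l * σ) ^ k • i₀
    by_cases hm : Δ.IsPos m
    · exact le_antisymm (h ▸ le_orbF hm ⟨j, hj⟩) (IsPos.coef_nonneg Δ hm _)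
    · rw [← isPos_refl_self] at hm
      have h1 := le_orbF (σ := σ) hm ⟨j, hj⟩
      have h2 := IsPos.coef_nonneg Δ hm ⟨j, hj⟩
      rw [rt_refl_self, map_neg] at h1 h2
      rw [map_neg, h] at h1
      linarith
  rw [hall i]
  apply Nat.dvd_antisymm (period_dvd_rootOrder τ i₀)
  apply rootOrder_dvd
  intro k
  rw [pow_smul_eq_iff_period_dvd, hall k]

end IsCoxWord
end CoxeterNumber

end CoxeterTorus

namespace CoxeterTorus
open RootPairing MulAction Real

/-! ### Sampled waves, and counting their sign changes. -/

section PlaneWaves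

variable {N : ℕ} {a b : ℝ}

/-- The value at the step `k` of a wave of period `N`. -/
def wave (N : ℕ) (a b : ℝ) (k : ℕ) : ℝ := a * cos (k * (2 * π / N)) + b * sin (k * (2 * π / N))

/-- Three samples of a wave satisfy a linear relation whose coefficients are sines of angles in [0,
π], because (m + 1)θ ≤ π. -/
lemma wave_pos {m : ℕ} (hm : 2 * (m + 1) ≤ N) (h0 : 0 < wave N a b m) (h1 : wave N a b (m + 1) < 0) :
    0 < wave N a b 0 := by
  rcases Nat.eq_zero_or_pos m with rfl | hm0
  · exact h0
  have hN : (0 : ℝ) < N := by exact_mod_cast (by omega : 0 < N)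
  set θ := 2 * π / N with hθ
  have hθ0 : 0 < θ := by positivity
  have hle : (m + 1) * θ ≤ π := by
    rw [hθ, mul_div_assoc', div_le_iff₀ hN]
    have : (2 * (m + 1) : ℝ) ≤ N := by exact_mod_cast hm
    nlinarith [pi_pos]
  have hm1 : (1 : ℝ) ≤ m := by exact_mod_cast hm0
  have e : sin θ * wave N a b 0 = sin ((m + 1) * θ) * wave N a b m - sin (m * θ) * wave N a b (m + 1) := by
    simp only [wave, ← hθ]
    push_cast
    rw [add_mul, one_mul, sin_add, cos_add, zero_mul, cos_zero, sin_zero]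
    linear_combination (-(sin θ * a)) * sin_sq_add_cos_sq (m * θ)
  have s1 : 0 < sin θ := sin_pos_of_pos_of_lt_pi hθ0 (by nlinarith)
  have s2 : 0 ≤ sin ((m + 1) * θ) := sin_nonneg_of_nonneg_of_le_pi (by positivity) hle
  have s3 : 0 < sin (m * θ) := sin_pos_of_pos_of_lt_pi (by positivity) (by nlinarith)
  have : 0 < sin θ * wave N a b 0 := by rw [e]; nlinarith
  exact (mul_pos_iff_of_pos_left s1).mp this

/-- The same three-term relation, extrapolating from the samples 0 and 1. -/
lemma wave_neg {m : ℕ} (hm0 : 1 ≤ m) (hm : 2 * m ≤ N) (h0 : 0 < wave N a b 0)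
    (h1 : wave N a b 1 < 0) : wave N a b m < 0 := by
  obtain ⟨m, rfl⟩ := Nat.exists_eq_add_of_le' hm0
  rcases Nat.eq_zero_or_pos m with rfl | hm0
  · exact h1
  have hN : (0 : ℝ) < N := by exact_mod_cast (by omega : 0 < N)
  set θ := 2 * π / N with hθ
  have hθ0 : 0 < θ := by positivity
  have hle : (m + 1) * θ ≤ π := by
    rw [hθ, mul_div_assoc', div_le_iff₀ hN]
    have : (2 * (m + 1) : ℝ) ≤ N := by exact_mod_cast hm
    nlinarith [pi_pos]
  have hm1 : (1 : ℝ) ≤ m := by exact_mod_cast hm0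
  have e : sin θ * wave N a b (m + 1) = sin ((m + 1) * θ) * wave N a b 1 - sin (m * θ) * wave N a b 0 := by
    simp only [wave, ← hθ]
    push_cast
    rw [add_mul, one_mul, sin_add, cos_add, zero_mul, cos_zero, sin_zero]
    linear_combination (-(sin (m * θ) * a)) * sin_sq_add_cos_sq θ
  have s1 : 0 < sin θ := sin_pos_of_pos_of_lt_pi hθ0 (by nlinarith)
  have s2 : 0 ≤ sin ((m + 1) * θ) := sin_nonneg_of_nonneg_of_le_pi (by positivity) hle
  have s3 : 0 < sin (m * θ) := sin_pos_of_pos_of_lt_pi (by positivity) (by nlinarith)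
  have : sin θ * wave N a b (m + 1) < 0 := by rw [e]; nlinarith
  exact neg_of_mul_neg_right this s1.le

end PlaneWaves

section Transversals

variable {ι X Y : Type*} [AddCommGroup X] [AddCommGroup Y] {P : RootPairing ι ℤ X Y} [Finite ι]

/-- Moving each point of E along its orbit into E' is injective, since E has at most one point per
orbit. -/
lemma ncard_le_of_orbits {τ : P.Aut} {E E' : Set ι}
    (hE : ∀ x ∈ E, ∀ y ∈ E, ∀ k : ℕ, τ ^ k • x = y → x = y)
    (hE' : ∀ x ∈ E, ∃ k : ℕ, τ ^ k • x ∈ E') : E.ncard ≤ E'.ncard := by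
  choose! f hf using hE'
  refine Set.ncard_le_ncard_of_injOn (fun x ↦ τ ^ f x • x) (fun x hx ↦ hf x hx) ?_ (Set.toFinite _)
  intro x hx y hy hxy
  obtain ⟨k, hk⟩ := exists_pow_eq_zpow τ (-(f y : ℤ) + f x)
  refine hE x hx y hy k ?_
  rw [← hk, zpow_add, mul_smul, zpow_natCast]
  change τ ^ f x • x = τ ^ f y • y at hxy
  rw [hxy, zpow_neg, zpow_natCast, inv_smul_smul]

variable {τ : P.Aut} {lam : P.rootSpan ℤ →ₗ[ℤ] ℝ} (hlam : ∀ i, lam (rt P i) ≠ 0)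
  (hw : ∀ i, ∃ a b, ∀ k : ℕ, lam (rt P (τ ^ k • i)) = wave (rootOrder τ) a b k)
include hlam hw

/-- One of the two arcs between x and y is at most half a turn, and for half a turn after a change
of sign the wave is negative. -/
lemma transition_unique {x y : ι} (hx : 0 < lam (rt P x)) (hx' : lam (rt P (τ • x)) < 0)
    (hy : 0 < lam (rt P y)) (hy' : lam (rt P (τ • y)) < 0) {k : ℕ} (hk : τ ^ k • x = y) : x = y := by
  have key : ∀ z, 0 < lam (rt P z) → lam (rt P (τ • z)) < 0 → ∀ m : ℕ, 1 ≤ m →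
      2 * m ≤ rootOrder τ → lam (rt P (τ ^ m • z)) < 0 := by
    intro z h0 h1 m hm hm'
    obtain ⟨a, b, hab⟩ := hw z
    rw [hab]
    refine wave_neg hm hm' ?_ ?_
    · rw [← hab]; simpa using h0
    · rw [← hab]; simpa using h1
  have hmod : τ ^ (k % rootOrder τ) • x = y := by
    rw [← pow_add_mul_smul τ _ (k / rootOrder τ), mul_comm, Nat.mod_add_div, hk]
  have hlt := Nat.mod_lt k (rootOrder_pos τ)
  set r := k % rootOrder τ with hr
  rcases Nat.eq_zero_or_pos r with h | h
  · rw [h, pow_zero, one_smul] at hmod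
    exact hmod
  rcases le_or_gt (2 * r) (rootOrder τ) with h2 | h2
  · have := key x hx hx' r h h2
    rw [hmod] at this
    exact absurd this hy.not_gt
  · have := key y hy hy' (rootOrder τ - r) (by omega) (by omega)
    rw [← hmod, smul_smul, ← pow_add, Nat.sub_add_cancel hlt.le, pow_rootOrder_smul] at this
    exact absurd this hx.not_gt

/-- Within half a turn a wave that has become negative stays negative. The roots counted for i + 1
are those counted for i together with those changing sign exactly at step i, and the latter are a
translate of the roots counted for 1. -/
lemma ncard_pos_neg_pow (i : ℕ) (hi : 2 * i ≤ rootOrder τ) :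
    {x | 0 < lam (rt P x) ∧ lam (rt P (τ ^ i • x)) < 0}.ncard =
      i * {x | 0 < lam (rt P x) ∧ lam (rt P (τ • x)) < 0}.ncard := by
  induction i with
  | zero =>
    rw [zero_mul, Set.ncard_eq_zero]
    ext x
    simp only [pow_zero, one_smul, Set.mem_ofPred_eq, Set.mem_empty_iff_false, iff_false]
    rintro ⟨h1, h2⟩
    linarith
  | succ i ih =>
    have hpow : ∀ x : ι, τ • τ ^ i • x = τ ^ (i + 1) • x := fun x ↦ by rw [smul_smul, pow_succ']
    have hU : {x | 0 < lam (rt P x) ∧ lam (rt P (τ ^ (i + 1) • x)) < 0} =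
        {x | 0 < lam (rt P x) ∧ lam (rt P (τ ^ i • x)) < 0} ∪
          (τ ^ i • ·) ⁻¹' {x | 0 < lam (rt P x) ∧ lam (rt P (τ • x)) < 0} := by
      ext x
      simp only [Set.mem_ofPred_eq, Set.mem_union, Set.mem_preimage, hpow]
      constructor
      · rintro ⟨h1, h2⟩
        rcases lt_or_gt_of_ne (hlam (τ ^ i • x)) with h | h
        · exact Or.inl ⟨h1, h⟩
        · exact Or.inr ⟨h, h2⟩
      · rintro (⟨h1, h2⟩ | ⟨h1, h2⟩)
        · refine ⟨h1, ?_⟩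
          obtain ⟨m, -, hm, hm1, hm2⟩ := exists_switch (p := fun k ↦ 0 < lam (rt P (τ ^ k • x)))
            (Nat.zero_le i) (by simpa using h1) h2.not_gt
          have hm3 : lam (rt P (τ ^ (m + 1) • x)) < 0 :=
            lt_of_le_of_ne (not_lt.mp hm2) (hlam _)
          obtain ⟨a, b, hab⟩ := hw (τ ^ m • x)
          have e : τ ^ (i + 1) • x = τ ^ (i + 1 - m) • τ ^ m • x := by
            rw [smul_smul, ← pow_add, Nat.sub_add_cancel (by omega)]
          rw [e, hab]
          refine wave_neg (by omega) (by omega) ?_ ?_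
          · rw [← hab]; simpa using hm1
          · rw [← hab, pow_one, smul_smul, ← pow_succ']; exact hm3
        · refine ⟨?_, h2⟩
          obtain ⟨a, b, hab⟩ := hw x
          have := wave_pos (N := rootOrder τ) (a := a) (b := b) hi (by rwa [← hab]) (by rwa [← hab])
          rw [← hab] at this
          simpa using this
    rw [hU, Set.ncard_union_eq ?_ (Set.toFinite _) (Set.toFinite _), ih (by omega), add_mul, one_mul]
    · congr 1
      rw [Set.ncard_preimage_of_injective_subset_range (MulAction.injective (τ ^ i))]
      rw [(MulAction.surjective (τ ^ i)).range_eq]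
      exact Set.subset_univ _
    · rw [Set.disjoint_left]
      rintro x ⟨-, h1⟩ ⟨h2, -⟩
      exact absurd h1 h2.not_gt

end Transversals

/-! ### The base adapted to a twisted Coxeter element. -/

section AdaptedBase

variable {ι X Y : Type*} [AddCommGroup X] [AddCommGroup Y] {P : RootPairing ι ℤ X Y} [Finite ι]
  [P.IsReduced] {Δ : P.Base} {σ : P.Aut} {l : List ι}

lemma inv_mul_stable (g : P.Aut) (hσ : ∀ i, σ • i ∈ Δ.support ↔ i ∈ Δ.support) :
    inv Δ (g * σ) = inv Δ g := by
  rw [inv, inv, ← Set.ncard_preimage_of_injective_subset_range (MulAction.injective σ)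
    (s := {i | Δ.IsPos i ∧ i ∈ {i | ¬ Δ.IsPos (g • i)}})]
  · congr 1
    ext i
    simp only [Set.mem_ofPred_eq, Set.mem_preimage, mul_smul, isPos_stable hσ]
  · rw [(MulAction.surjective σ).range_eq]
    exact Set.subset_univ _

lemma map_wordProd_smul {A : Type*} [AddCommGroup A] {φ : P.rootSpan ℤ →ₗ[ℤ] A} {l : List ι}
    (h : ∀ i ∈ l, φ (rt P i) = 0) (x : P.rootSpan ℤ) : φ (wordProd P l • x) = φ x := by
  induction l with
  | nil => simp
  | cons i t ih =>
    rw [wordProd_cons, mul_smul, refl_smul_span, map_sub, φ.map_smul, h i (by simp), smul_zero, sub_zero,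
      ih fun j hj ↦ h j (by simp [hj])]

/-- The real part of a multiple of an eigenform that vanishes on no root. -/
lemma exists_regular_form (τ : P.Aut) (F : P.rootSpan ℤ →ₗ[ℤ] ℂ) (hF : ∀ i, F (rt P i) ≠ 0)
    (hFτ : ∀ (k : ℕ) x,
      Complex.exp (2 * π * Complex.I / (rootOrder τ : ℕ)) ^ k * F (τ ^ k • x) = F x) :
    ∃ lam : P.rootSpan ℤ →ₗ[ℤ] ℝ, (∀ i, lam (rt P i) ≠ 0) ∧
      ∀ i, ∃ a b, ∀ k : ℕ, lam (rt P (τ ^ k • i)) = wave (rootOrder τ) a b k := by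
  -- The real part of (1 + t√−1)F vanishes at some root only for finitely many t.
  obtain ⟨t, ht⟩ : ∃ t : ℝ, ∀ i, (F (rt P i)).re - t * (F (rt P i)).im ≠ 0 := by
    obtain ⟨t, ht⟩ := (Set.finite_range fun i : ι ↦ (F (rt P i)).re / (F (rt P i)).im).exists_notMem
    refine ⟨t, fun i h ↦ ?_⟩
    by_cases him : (F (rt P i)).im = 0
    · rw [him, mul_zero, sub_zero] at h
      exact hF i (Complex.ext h him)
    · exact ht ⟨i, by beta_reduce; rw [sub_eq_zero.mp h, mul_div_cancel_right₀ _ him]⟩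
  refine ⟨AddMonoidHom.toIntLinearMap
    { toFun := fun x ↦ (F x).re - t * (F x).im
      map_zero' := by simp
      map_add' := fun x y ↦ by simp; ring }, ht, fun i ↦ ?_⟩
  -- These are the real and imaginary parts of (1 + t√−1)F at i; applying τ^k rotates F by −2πk/h,
  -- where h is the order of τ on the roots.
  refine ⟨(F (rt P i)).re - t * (F (rt P i)).im, (F (rt P i)).im + t * (F (rt P i)).re, fun k ↦ ?_⟩
  change (F _).re - t * (F _).im = _
  have h := hFτ k (rt P i)
  rw [← Complex.exp_nat_mul,
    show (k : ℂ) * (2 * π * Complex.I / (rootOrder τ : ℕ)) = ((k * (2 * π / rootOrder τ) : ℝ) : ℂ) * Complex.I by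
      push_cast; ring, ← rt_smul] at h
  set θ : ℝ := k * (2 * π / rootOrder τ) with hθ
  set w := F (rt P (τ ^ k • i))
  rw [← h]
  simp only [wave, ← hθ, Complex.mul_re, Complex.mul_im, Complex.exp_ofReal_mul_I_re,
    Complex.exp_ofReal_mul_I_im]
  linear_combination (-(w.re - t * w.im)) * sin_sq_add_cos_sq θ

namespace IsCoxWord

variable (H : IsCoxWord Δ σ l)
include H

lemma ncard_transition : {i | Δ.IsPos i ∧ ¬ Δ.IsPos ((wordProd P l * σ) • i)}.ncard = l.length := by
  have := inv_mul_stable (wordProd P l) H.stable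
  rw [H.inv_wordProd] at this
  exact this

/-- A base for which the partial products of the Coxeter element are reduced. -/
lemma exists_base_inv_pow (hconn : IsConnectedDynkin Δ) : ∃ u ∈ P.weylGroup,
    inv (smulBase u Δ) (wordProd P l * σ) = l.length ∧
    ∀ i, 2 * i ≤ rootOrder (wordProd P l * σ) →
      inv (smulBase u Δ) ((wordProd P l * σ) ^ i) = i * l.length := by
  set τ := wordProd P l * σ with hτ
  have hprim := Complex.isPrimitiveRoot_exp (rootOrder τ) (rootOrder_pos τ).ne'
  obtain ⟨lam, hlam, hw⟩ := exists_regular_form τ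
    (eigenForm τ (Complex.exp (2 * π * Complex.I / (rootOrder τ : ℕ))) (htForm Δ)) (fun i ↦ by
      rw [hτ, ← H.period_eq hconn i]
      exact H.eigenForm_ne_zero (fun i hi ↦ (isPos_iff_htForm.mp hi).le) ⟨0, htForm_ne_zero _⟩)
    (fun k x ↦ eigenForm_pow_smul hprim.pow_eq_one _ k x)
  obtain ⟨u, hu, hpos⟩ := exists_base_of_regular Δ lam hlam
  have hneg : ∀ i, ¬ (smulBase u Δ).IsPos i ↔ lam (rt P i) < 0 := fun i ↦ by
    rw [hpos, not_lt]
    exact ⟨fun h ↦ lt_of_le_of_ne h (hlam i), le_of_lt⟩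
  have hinv : ∀ g, inv (smulBase u Δ) g = {x | 0 < lam (rt P x) ∧ lam (rt P (g • x)) < 0}.ncard := by
    intro g
    simp only [inv, hpos, Set.mem_ofPred_eq, ← hneg]
  -- For both bases, the roots changing from positive to negative meet each τ-orbit exactly once, so
  -- they are equally many.
  have hone : inv (smulBase u Δ) τ = l.length := by
    rw [hinv, ← H.ncard_transition, ← hτ]
    apply le_antisymm
    · refine ncard_le_of_orbits (τ := τ)
        (fun x hx y hy k hk ↦ transition_unique hlam hw hx.1 hx.2 hy.1 hy.2 hk) fun x _ ↦ ?_
      obtain ⟨k, h1, h2⟩ := exists_pos_neg (τ := τ) H.eq_zero_of_fixed' (φ := htForm Δ)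
        htForm_ne_zero x
      rw [← isPos_iff_htForm] at h1
      rw [← not_isPos_iff_htForm, pow_succ', mul_smul] at h2
      exact ⟨k, h1, h2⟩
    · refine ncard_le_of_orbits (τ := τ)
        (fun x hx y hy k hk ↦ H.eq_of_transition hx.1 hx.2 hy.1 hy.2 hk) fun x _ ↦ ?_
      obtain ⟨k, h1, h2⟩ := exists_pos_neg (τ := τ) H.eq_zero_of_fixed' (φ := lam) hlam x
      rw [pow_succ', mul_smul] at h2
      exact ⟨k, h1, h2⟩
  refine ⟨u, hu, hone, fun i hi ↦ ?_⟩
  rw [hinv, ncard_pos_neg_pow hlam hw i hi, ← hinv, hone]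

/-- The diagram automorphism is conjugated by u, and the Weyl part has a reduced word of the old
length. Every orbit occurs in that word, as otherwise its orbit coweight would be τ-invariant. There
are as many orbits as letters, so each occurs once. -/
lemma of_smulBase {u : P.Aut} (hu : u ∈ P.weylGroup)
    (hinv : inv (smulBase u Δ) (wordProd P l * σ) = l.length) :
    ∃ l', IsCoxWord (smulBase u Δ) (u * σ * u⁻¹) l' ∧ l'.length = l.length ∧
      wordProd P l' * (u * σ * u⁻¹) = wordProd P l * σ := by
  classical
  set τ := wordProd P l * σ with hτ
  set σ' := u * σ * u⁻¹ with hσ'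
  set Δ' := smulBase u Δ with hΔ'
  have hstab : ∀ i, σ' • i ∈ Δ'.support ↔ i ∈ Δ'.support := by
    intro i
    rw [hΔ', mem_smulBase, mem_smulBase, ← H.stable (u⁻¹ • i), hσ']
    simp only [mul_smul, inv_smul_smul]
  have hzpow : ∀ (m : ℤ) (i : ι), σ' ^ m • u • i = u • σ ^ m • i := by
    intro m i
    rw [hσ', conj_zpow, smul_smul, smul_smul]
    congr 1
    group
  have hc : τ * σ'⁻¹ ∈ P.weylGroup := by
    have := mul_mem (mul_mem (wordProd_mem (P := P) l) (conj_mem_weylGroup σ hu)) (inv_mem hu)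
    convert this using 1
    rw [hτ, hσ']
    group
  obtain ⟨m, hm, hmc⟩ := exists_word Δ' hc
  obtain ⟨l', hl', hlen, hprod⟩ := exists_reduced_word Δ' m hm
  rw [hmc] at hlen hprod
  have hτ' : wordProd P l' * σ' = τ := by rw [hprod]; group
  have hlen' : l'.length = l.length := by
    rw [hlen, ← hinv, ← inv_mul_stable (τ * σ'⁻¹) hstab]
    congr 1
    group
  have hhit : ∀ j ∈ Δ'.support, ∃ i, i ∈ l' ∧ ∃ m : ℤ, σ' ^ m • j = i := by
    intro j hj
    by_contra! hno
    have h0 : orbF Δ' σ' j = 0 := by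
      refine eq_zero_of_comp_eq (τ := τ) H.eq_zero_of_fixed' fun x ↦ ?_
      rw [← hτ', mul_smul, map_wordProd_smul, orbF_smul hstab]
      exact fun i hi ↦ orbF_of_not_orbit (hl' i hi) fun ⟨m, h⟩ ↦ hno i hi m h
    have h1 := orbF_of_orbit (Δ := Δ') (σ := σ') (i := j) (j := j) hj ⟨0, by simp⟩
    rw [h0] at h1
    exact zero_ne_one h1
  have hhit' : ∀ i : ι, ∃ i', i ∈ l → i' ∈ l' ∧ ∃ m : ℤ, σ' ^ m • u • i = i' := by
    intro i
    by_cases hi : i ∈ l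
    · obtain ⟨i', h⟩ := hhit (u • i) ((smul_mem_smulBase u Δ).mpr (H.mem i hi))
      exact ⟨i', fun _ ↦ h⟩
    · exact ⟨i, fun h ↦ absurd h hi⟩
  choose f hf using hhit'
  have huniq : ∀ i₁ ∈ l, ∀ i₂ ∈ l, (∃ m : ℤ, σ' ^ m • u • i₁ = u • i₂) → i₁ = i₂ := by
    rintro i₁ h₁ i₂ h₂ ⟨m, hm⟩
    rw [hzpow, smul_left_cancel_iff] at hm
    obtain ⟨i, -, hi⟩ := H.transversal i₁ (H.mem i₁ h₁)
    rw [hi i₁ ⟨h₁, 0, by simp⟩, hi i₂ ⟨h₂, m, hm⟩]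
  have hinj : Set.InjOn f (l.toFinset : Set ι) := by
    intro i₁ h₁ i₂ h₂ h12
    rw [List.coe_toFinset] at h₁ h₂
    obtain ⟨-, m₁, hm₁⟩ := hf i₁ h₁
    obtain ⟨-, m₂, hm₂⟩ := hf i₂ h₂
    refine huniq i₁ h₁ i₂ h₂ ⟨-m₂ + m₁, ?_⟩
    rw [zpow_add, mul_smul, hm₁, h12, ← hm₂, zpow_neg, inv_smul_smul]
  have himg : l.toFinset.image f ⊆ l'.toFinset := by
    intro i hi
    obtain ⟨j, hj, rfl⟩ := Finset.mem_image.mp hi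
    exact List.mem_toFinset.mpr (hf j (List.mem_toFinset.mp hj)).1
  have hcard : (l.toFinset.image f).card = l.length := by
    rw [Finset.card_image_of_injOn hinj, List.toFinset_card_of_nodup H.nodup]
  have hcard' : l'.toFinset.card = l'.length := by
    apply le_antisymm (List.toFinset_card_le _)
    rw [hlen', ← hcard]
    exact Finset.card_le_card himg
  have heq := Finset.eq_of_subset_of_card_le himg (by rw [hcard', hcard, hlen'])
  refine ⟨l', ⟨hstab, hl', ?_, fun j hj ↦ ?_⟩, hlen', hτ'⟩
  · exact List.dedup_eq_self.mp (List.Sublist.eq_of_length (List.dedup_sublist l')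
      (by rw [← hcard', List.card_toFinset]))
  · obtain ⟨i, hi, hij⟩ := hhit j hj
    refine ⟨i, ⟨hi, hij⟩, ?_⟩
    rintro i' ⟨hi', m', hm'⟩
    obtain ⟨m, hm⟩ := hij
    obtain ⟨x, hx, rfl⟩ := Finset.mem_image.mp (heq ▸ List.mem_toFinset.mpr hi)
    obtain ⟨x', hx', rfl⟩ := Finset.mem_image.mp (heq ▸ List.mem_toFinset.mpr hi')
    rw [List.mem_toFinset] at hx hx'
    obtain ⟨-, n, hn⟩ := hf x hx
    obtain ⟨-, n', hn'⟩ := hf x' hx'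
    rw [huniq x hx x' hx' ⟨-n' + m' + -m + n, ?_⟩]
    rw [zpow_add, zpow_add, zpow_add, mul_smul, mul_smul, mul_smul, hn, ← hm, zpow_neg (n := m), inv_smul_smul, hm',
      ← hn', zpow_neg, inv_smul_smul]

end IsCoxWord
end AdaptedBase

end CoxeterTorus

namespace CoxeterTorus
open RootPairing

/-! ### Lengths of partial products as inversion counts of powers. -/

section Translation

variable {ι X Y : Type*} [AddCommGroup X] [AddCommGroup Y] {P : RootPairing ι ℤ X Y} [Finite ι]

lemma weightHom_root (g : P.Aut) (i : ι) : Equiv.weightHom P g (P.root i) = P.root (g • i) :=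
  (root_smul g i).symm

lemma weightHom_zpow_root (g : P.Aut) (m : ℤ) (i j : ι) :
    (Equiv.weightHom P g ^ m) (P.root i) = P.root j ↔ g ^ m • i = j := by
  rw [← map_zpow, weightHom_root]
  exact P.root.injective.eq_iff

/-- This inequality suffices, because the order only serves as an upper bound for 2i. -/
lemma orderOnRoots_weightHom_le (τ : P.Aut) :
    orderOnRoots P (Equiv.weightHom P τ) ≤ rootOrder τ := by
  refine Nat.sInf_le ⟨rootOrder_pos τ, fun i ↦ ?_⟩
  rw [← map_pow, weightHom_root, pow_rootOrder_smul]

lemma partialProd_weightHom (σ c : P.Aut) (i : ℕ) :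
    partialProd (Equiv.weightHom P σ) (Equiv.weightHom P c) i =
      Equiv.weightHom P ((c * σ) ^ i * (σ ^ i)⁻¹) := by
  induction i with
  | zero => rw [pow_zero, pow_zero, _root_.inv_one, mul_one, map_one]; rfl
  | succ i ih =>
    have : partialProd (Equiv.weightHom P σ) (Equiv.weightHom P c) (i + 1) =
        partialProd (Equiv.weightHom P σ) (Equiv.weightHom P c) i *
          Equiv.weightHom P (σ ^ i * c * (σ ^ i)⁻¹) := by
      rw [partialProd, partialProd, List.range_succ, List.map_append, List.prod_append, List.map_singleton,
        List.prod_singleton, map_mul, map_mul, map_inv, map_pow]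
    rw [this, ih, ← map_mul]
    congr 1
    rw [pow_succ (c * σ), pow_succ σ]
    group

variable [P.IsReduced] {Δ : P.Base} {σ : P.Aut} {l : List ι}

namespace IsCoxWord

variable (H : IsCoxWord Δ σ l)
include H

lemma image_support :
    Equiv.weightHom P σ '' (P.root '' Δ.support) = P.root '' Δ.support := by
  ext x
  constructor
  · rintro ⟨_, ⟨i, hi, rfl⟩, rfl⟩
    exact ⟨σ • i, (H.stable i).mpr hi, (weightHom_root σ i).symm⟩
  · rintro ⟨i, hi, rfl⟩
    refine ⟨_, ⟨σ⁻¹ • i, ?_, rfl⟩, ?_⟩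
    · have := H.stable (σ⁻¹ • i)
      rw [smul_inv_smul] at this
      exact this.mp hi
    · rw [weightHom_root, smul_inv_smul]

lemma len_eq : len Δ (Equiv.weightHom P (wordProd P l)) = l.length := by
  rw [len_weightHom _ (wordProd_mem l), H.inv_wordProd]

lemma isTwistedCoxeter :
    IsTwistedCoxeter Δ (Equiv.weightHom P σ) (Equiv.weightHom P (wordProd P l)) := by
  refine ⟨l, ⟨H.mem, (weightHom_wordProd l).symm⟩, H.len_eq.symm, H.nodup, fun j hj ↦ ?_⟩
  simpa only [weightHom_zpow_root] using H.transversal j hj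

/-- The partial product is (cσ)^i σ^(−i), and σ^i permutes the positive roots. -/
lemma len_partialProd (i : ℕ) :
    len Δ (partialProd (Equiv.weightHom P σ) (Equiv.weightHom P (wordProd P l)) i) =
      inv Δ ((wordProd P l * σ) ^ i) := by
  rw [partialProd_weightHom, len_weightHom _ (H.pow_mul_mem i),
    ← inv_mul_stable _ (σ := σ ^ i) (fun j ↦ ?_)]
  · congr 1
    group
  · simpa using zpow_smul_mem H.stable (i : ℤ) j

/-- A twisted Coxeter element is conjugate under the Weyl group to one whose partial products are
reduced. -/
theorem exists_reduced_partialProd (hconn : IsConnectedDynkin Δ) :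
    ∃ u ∈ P.weylGroup, ∃ (σ' : P.Aut) (l' : List ι), IsCoxWord (smulBase u Δ) σ' l' ∧
      wordProd P l' * σ' = wordProd P l * σ ∧
      ∀ i, 2 * i ≤ orderOnRoots P (Equiv.weightHom P (wordProd P l * σ)) →
        len (smulBase u Δ) (partialProd (Equiv.weightHom P σ') (Equiv.weightHom P (wordProd P l')) i) =
          i * len (smulBase u Δ) (Equiv.weightHom P (wordProd P l')) := by
  obtain ⟨u, hu, h1, h2⟩ := H.exists_base_inv_pow hconn
  obtain ⟨l', H', hlen, hτ⟩ := H.of_smulBase hu h1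
  refine ⟨u, hu, _, l', H', hτ, fun i hi ↦ ?_⟩
  rw [H'.len_partialProd, hτ, h2 i (hi.trans (orderOnRoots_weightHom_le _)), H'.len_eq, hlen]

end IsCoxWord
end Translation

end CoxeterTorus

namespace CoxeterTorus
open RootPairing

/-! ### One-parameter subgroups in the Lang preimage. -/

section Arithmetic

/-- Divisibility of b by E propagates backwards from the zeros of b, hence holds everywhere. If b k
= 0, then a k is q times the quotient of b (k + 1) by E, and |a k| < q makes both vanish. -/
lemma eq_zero_of_periodic_recursion {a b : ℕ → ℤ} {q E : ℤ} {N : ℕ} (hE : E ≠ 0)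
    (hN : 0 < N) (ha : ∀ k, |a k| < q) (hab : ∀ k, q * b (k + 1) - b k = E * a k)
    (hper : ∀ m, b (m * N) = 0) (k : ℕ) : a k = 0 := by
  have hdvd : ∀ j k, b (k + j) = 0 → E ∣ b k := by
    intro j
    induction j with
    | zero => intro k h; rw [add_zero] at h; rw [h]; exact dvd_zero _
    | succ j ih =>
      intro k h
      have h1 := ih (k + 1) (by rwa [add_assoc, add_comm 1 j])
      have h2 : b k = q * b (k + 1) - E * a k := by rw [← hab]; ring
      rw [h2]
      exact dvd_sub (h1.mul_left q) (dvd_mul_right _ _)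
  have hdvd' : ∀ k, E ∣ b k := by
    intro k
    refine hdvd (k * N - k) k ?_
    rw [Nat.add_sub_cancel' (Nat.le_mul_of_pos_right k hN), hper]
  have step : ∀ k, b k = 0 → b (k + 1) = 0 ∧ a k = 0 := by
    intro k hk
    obtain ⟨c, hc⟩ := hdvd' (k + 1)
    have h1 := hab k
    rw [hk, sub_zero, hc, mul_left_comm] at h1
    have h2 := mul_left_cancel₀ hE h1
    have h3 : a k = 0 := Int.eq_zero_of_abs_lt_dvd ⟨c, h2.symm⟩ (ha k)
    refine ⟨?_, h3⟩
    rw [h3] at h2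
    have hq : q ≠ 0 := by
      rintro rfl
      exact absurd (ha 0) (not_lt.mpr (abs_nonneg _))
    rw [hc, (mul_eq_zero.mp h2).resolve_left hq, mul_zero]
  have hb : ∀ k, b k = 0 := by
    intro k
    induction k with
    | zero => simpa using hper 0
    | succ k ih => exact (step k ih).1
  exact (step k (hb k)).2

end Arithmetic

section LangMap

variable {X : Type*} [AddCommGroup X] [Module.Finite ℤ X] [Module.Free ℤ X]

/-- A vector x in the kernel equals q^n τ^n x for all n, so its coordinates are divisible by every
power of q. -/
lemma injective_smul_sub_one {q : ℕ} (hq : 2 ≤ q) (τ : X ≃ₗ[ℤ] X) :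
    LinearMap.ker ((q : ℤ) • (τ : X →ₗ[ℤ] X) - 1) = ⊥ := by
  rw [LinearMap.ker_eq_bot']
  intro x hx
  have hx' : (q : ℤ) • τ x = x := sub_eq_zero.mp hx
  have hpow : ∀ n : ℕ, (q : ℤ) ^ n • (τ ^ n) x = x := by
    intro n
    induction n with
    | zero => simp
    | succ n ih =>
      rw [pow_succ, pow_succ', mul_smul]
      change (q : ℤ) ^ n • (q : ℤ) • τ ((τ ^ n) x) = x
      rw [← τ.map_smul, ← τ.map_smul, smul_comm, ih, τ.map_smul, hx']
  have b := Module.Free.chooseBasis ℤ X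
  refine b.ext_elem fun i ↦ ?_
  rw [map_zero, Finsupp.zero_apply]
  by_contra h0
  have hd : ∀ n : ℕ, q ^ n ∣ (b.repr x i).natAbs := by
    intro n
    rw [← Int.natCast_dvd, Nat.cast_pow]
    refine ⟨b.repr ((τ ^ n) x) i, ?_⟩
    conv_lhs => rw [← hpow n]
    simp
  have h1 := Nat.le_of_dvd (Int.natAbs_pos.mpr h0) (hd (b.repr x i).natAbs)
  exact absurd h1 (not_le.mpr (Nat.lt_pow_self hq))

/-- Every linear form becomes, up to a non-zero multiple, a composition with an injective map. -/
lemma exists_comp_eq_smul (A : X →ₗ[ℤ] X) (hA : LinearMap.ker A = ⊥) :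
    ∃ e : ℤ, e ≠ 0 ∧ ∀ φ : X →ₗ[ℤ] ℤ, ∃ ψ : X →ₗ[ℤ] ℤ, ∀ x, ψ (A x) = e * φ x := by
  classical
  have b := Module.Free.chooseBasis ℤ X
  -- The multiple is det A, and ψ is φ composed with the adjugate of A.
  refine ⟨(LinearMap.toMatrix b b A).det, ?_, fun φ ↦
    ⟨φ.comp (Matrix.toLin b b (LinearMap.toMatrix b b A).adjugate), fun x ↦ ?_⟩⟩
  · rw [LinearMap.det_toMatrix]
    intro h
    exact (LinearMap.bot_lt_ker_of_det_eq_zero h).ne' hA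
  · have h1 : (Matrix.toLin b b (LinearMap.toMatrix b b A).adjugate).comp A =
        (LinearMap.toMatrix b b A).det • LinearMap.id := by
      conv_lhs => rw [← Matrix.toLin_toMatrix b b A]
      rw [← Matrix.toLin_mul, LinearMap.toMatrix_toLin, Matrix.adjugate_mul, map_smul, Matrix.toLin_one]
    have h2 := LinearMap.congr_fun h1 x
    rw [LinearMap.comp_apply] at h2
    rw [LinearMap.comp_apply, h2]
    simp

end LangMap

section Curves

variable {X κ : Type*} [AddCommGroup X] [Field κ]

/-- The sum is a Laurent polynomial in z, non-zero because of z₀; a power of z clears its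
denominators. -/
lemma finite_zeros {A : Type*} (f : A →₀ κ) (d : A → ℤ) {z₀ : κˣ}
    (h0 : (f.sum fun x a ↦ a * ((z₀ ^ d x : κˣ) : κ)) ≠ 0) :
    {z : κˣ | (f.sum fun x a ↦ a * ((z ^ d x : κˣ) : κ)) = 0}.Finite := by
  obtain ⟨N, hN⟩ : ∃ N : ℕ, ∀ x ∈ f.support, 0 ≤ d x + N := by
    refine ⟨∑ x ∈ f.support, (d x).natAbs, fun x hx ↦ ?_⟩
    have := Finset.single_le_sum (f := fun x ↦ (d x).natAbs) (fun _ _ ↦ Nat.zero_le _) hx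
    have h2 := neg_abs_le (d x)
    zify at this
    push_cast
    linarith
  let p : Polynomial κ := ∑ x ∈ f.support, Polynomial.monomial (d x + N).toNat (f x)
  have hp : ∀ z : κˣ, p.eval (z : κ) = (f.sum fun x a ↦ a * ((z ^ d x : κˣ) : κ)) * (z : κ) ^ N := by
    intro z
    rw [Polynomial.eval_finsetSum, Finsupp.sum, Finset.sum_mul]
    refine Finset.sum_congr rfl fun x hx ↦ ?_
    rw [Polynomial.eval_monomial, mul_assoc]
    congr 1
    rw [← Units.val_pow_eq_pow_val, ← Units.val_pow_eq_pow_val, ← Units.val_mul, ← zpow_natCast,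
      ← zpow_natCast, ← zpow_add, Int.toNat_of_nonneg (hN x hx)]
  have hp0 : p ≠ 0 := by
    intro h
    have := hp z₀
    rw [h, Polynomial.eval_zero] at this
    exact mul_ne_zero h0 (pow_ne_zero _ z₀.ne_zero) this.symm
  refine Set.Finite.of_injOn (f := fun z : κˣ ↦ (z : κ)) (t := {z | p.IsRoot z}) (fun z hz ↦ ?_)
    (fun _ _ _ _ h ↦ Units.ext h) (Polynomial.finite_setOfPred_isRoot hp0)
  change p.eval (z : κ) = 0
  rw [hp z, show _ = _ from hz, zero_mul]

/-- The one-parameter subgroup attached to a linear form on the characters. -/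
def curve (κ : Type*) [Field κ] (ψ : X →ₗ[ℤ] ℤ) (z : κˣ) : TorusPts X κ where
  toFun x := z ^ ψ (Multiplicative.toAdd x)
  map_one' := by simp
  map_mul' x y := by simp [zpow_add]

lemma curve_apply (ψ : X →ₗ[ℤ] ℤ) (z : κˣ) (x : X) :
    curve κ ψ z (Multiplicative.ofAdd x) = z ^ ψ x := rfl

lemma infinite_units [Infinite κ] : Infinite κˣ := by
  rw [← not_finite_iff_infinite]
  intro h
  have : (Set.univ : Set κ) = insert 0 (Set.range ((↑) : κˣ → κ)) := by
    ext x
    by_cases hx : x = 0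
    · simp [hx]
    · simpa [hx] using ⟨Units.mk0 x hx, rfl⟩
  exact Set.infinite_univ (this ▸ (Set.finite_range _).insert 0)

/-- A non-empty relatively open subset of the curve has a cofinite set of parameters, so any two of
them meet: the curve is irreducible. -/
lemma isPreconnected_range_curve [Infinite κ] (ψ : X →ₗ[ℤ] ℤ) :
    @IsPreconnected _ (zariski X κ) (Set.range (curve κ ψ)) := by
  let _ := zariski X κ
  have hfin : ∀ U : Set (TorusPts X κ), IsOpen U → (Set.range (curve κ ψ) ∩ U).Nonempty →
      {z | curve κ ψ z ∉ U}.Finite := by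
    intro U hU
    induction hU with
    | basic U h =>
      obtain ⟨f, rfl⟩ := h
      rintro ⟨_, ⟨z₀, rfl⟩, h0⟩
      exact (finite_zeros f ψ h0).subset fun z hz ↦ not_not.mp hz
    | univ => simp
    | inter U V _ _ hU hV =>
      rintro ⟨x, hx, hxU, hxV⟩
      refine ((hU ⟨x, hx, hxU⟩).union (hV ⟨x, hx, hxV⟩)).subset fun z hz ↦ ?_
      exact not_and_or.mp hz
    | sUnion S _ ih =>
      rintro ⟨x, hx, U, hU, hxU⟩
      exact (ih U hU ⟨x, hx, hxU⟩).subset fun z hz hzU ↦ hz ⟨U, hU, hzU⟩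
  refine IsPreirreducible.isPreconnected fun U V hU hV h1 h2 ↦ ?_
  have := infinite_units (κ := κ)
  obtain ⟨z, hz⟩ := ((hfin U hU h1).union (hfin V hV h2)).exists_notMem
  rw [Set.mem_union, not_or] at hz
  exact ⟨_, ⟨z, rfl⟩, not_not.mp hz.1, not_not.mp hz.2⟩

lemma exists_zpow_ne_one [Infinite κ] {d : ℤ} (hd : d ≠ 0) : ∃ z : κˣ, z ^ d ≠ 1 := by
  by_contra! h
  have : NeZero d.natAbs := ⟨Int.natAbs_ne_zero.mpr hd⟩
  have := infinite_units (κ := κ)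
  refine not_finite_iff_infinite.mpr this (Finite.of_injective
    (fun z : κˣ ↦ (⟨z, pow_natAbs_eq_one.mpr (h z)⟩ : rootsOfUnity d.natAbs κ)) fun _ _ h ↦ ?_)
  exact congrArg Subtype.val h

end Curves

section IdentityComponent

variable {ι X Y κ : Type*} [AddCommGroup X] [AddCommGroup Y] {P : RootPairing ι ℤ X Y} [Finite ι]
  [Module.Finite ℤ X] [Field κ] [Infinite κ] {Δ : P.Base}

/-- The curve attached to ψ, where ψ∘(qτ − 1) = e·ν, is connected, contains 1 and is mapped by the
Lang map into the image of ν. A root trivial on it has ψ-value zero, and the recursion along its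
orbit kills all α-coefficients. -/
theorem not_idComponent_subset_kerChar {τ : P.Aut} {q : ℕ} {α : Δ.support} {ν : Y}
    (hν : IsCoweightLift Δ α ν) (hlt : ∀ i, |coef Δ α (rt P i)| < q)
    (hne : ∀ i, ∃ k : ℕ, coef Δ α (rt P (τ ^ k • i)) ≠ 0) (j : ι) :
    ¬ idComponent (langPreimage (κ := κ) P q (Equiv.weightHom P τ) ν) ⊆ kerChar (P.root j) := by
  have : Module.IsReflexive ℤ X := .of_isPerfPair P.toLinearMap
  have : Module.IsTorsionFree ℤ X := inferInstance
  have : Module.Free ℤ X := inferInstance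
  have hq : 2 ≤ q := by
    obtain ⟨k, hk⟩ := hne j
    have h1 := hlt (τ ^ k • j)
    have h2 := Int.one_le_abs hk
    omega
  obtain ⟨e, he, h⟩ := exists_comp_eq_smul _ (injective_smul_sub_one hq (Equiv.weightHom P τ))
  obtain ⟨ψ, hψ⟩ := h (P.toLinearMap.flip ν)
  obtain ⟨m, hm, hmν⟩ := hν
  have hψ' : ∀ x, q * ψ (τ • x) - ψ x = e * P.toLinearMap x ν := by
    intro x
    have := hψ x
    rw [LinearMap.flip_apply] at this
    rw [← this, LinearMap.sub_apply, map_sub, LinearMap.smul_apply, ψ.map_smul]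
    rfl
  have hne0 : ψ (P.root j) ≠ 0 := by
    intro h0
    obtain ⟨k, hk⟩ := hne j
    refine hk (eq_zero_of_periodic_recursion (a := fun k ↦ coef Δ α (rt P (τ ^ k • j)))
      (b := fun k ↦ ψ (P.root (τ ^ k • j))) (q := q) (E := e * m) (N := rootOrder τ)
      (mul_ne_zero he hm) (rootOrder_pos τ) (fun k ↦ hlt _) (fun k ↦ ?_) (fun n ↦ ?_) k)
    · rw [pow_succ', mul_smul, root_smul, hψ', mul_assoc, ← hmν]
    · have := pow_add_mul_smul τ 0 n j
      rw [zero_add, pow_zero, one_smul] at this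
      rw [this, h0]
  obtain ⟨z, hz⟩ := exists_zpow_ne_one (κ := κ) hne0
  intro hsub
  refine hz (hsub (a := curve κ ψ z) ?_)
  let _ := zariski X κ
  refine (isPreconnected_range_curve (κ := κ) ψ).subset_connectedComponentIn ⟨1, ?_⟩ ?_ ⟨z, rfl⟩
  · ext x
    simp [curve]
  · rintro _ ⟨z, rfl⟩
    refine ⟨z ^ e, fun x ↦ ?_⟩
    have h1 : frob q (Equiv.weightHom P τ) (curve κ ψ z) (Multiplicative.ofAdd x) =
      (curve κ ψ z (Multiplicative.ofAdd (τ • x))) ^ q := rfl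
    rw [MonoidHom.mul_apply, MonoidHom.inv_apply, h1, curve_apply, curve_apply, ← zpow_mul, ← hψ',
      ← zpow_natCast, ← zpow_mul, ← zpow_neg, ← zpow_add]
    congr 1
    ring

end IdentityComponent

end CoxeterTorus

namespace CoxeterTorus
open RootPairing

/-! ### Recognising automorphisms of the root datum and Coxeter words. -/

section Automorphisms

variable {ι X Y : Type*} [AddCommGroup X] [AddCommGroup Y] {P : RootPairing ι ℤ X Y} [Finite ι]

lemma exists_perm_of_symm_mem_roots {τ : X ≃ₗ[ℤ] X} (h : ∀ i, τ.symm (P.root i) ∈ Set.range P.root) :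
    ∃ e : ι ≃ ι, ∀ i, τ (P.root i) = P.root (e i) := by
  choose f hf using h
  have hinj : Function.Injective f := fun i j hij ↦ by
    have := hf i
    rw [hij, hf j] at this
    exact (P.root.injective (τ.symm.injective this)).symm
  refine ⟨(Equiv.ofBijective f (Finite.injective_iff_bijective.mp hinj)).symm, fun i ↦ ?_⟩
  obtain ⟨j, rfl⟩ := (Equiv.ofBijective f (Finite.injective_iff_bijective.mp hinj)).surjective i
  rw [Equiv.symm_apply_apply, Equiv.ofBijective_apply, hf, LinearEquiv.apply_symm_apply]

variable [P.IsReduced]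

lemma exists_pow_eq_one_of_mem_weylGroup (Δ : P.Base) {g : P.Aut} (hg : g ∈ P.weylGroup) :
    g ^ rootOrder g = 1 := by
  refine eq_one_of_inv_eq_zero (Δ := Δ) (pow_mem hg _) ?_
  rw [inv, Set.ncard_eq_zero]
  ext i
  simp only [pow_rootOrder_smul, Set.mem_ofPred_eq, Set.mem_empty_iff_false, iff_false]
  exact fun h ↦ h.2 h.1

/-- The element τ⁻¹ s_i τ s_j of the Weyl group is a transvection along the root j. Having finite
order on a torsion-free group it is trivial, which is the equality of the two forms. -/
lemma coroot'_eq_of_normalizes [Module.IsTorsionFree ℤ X] (Δ : P.Base) {τ : X ≃ₗ[ℤ] X}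
    (hW : ∀ w ∈ weyl P, τ⁻¹ * w * τ ∈ weyl P) {i j : ι} (hij : τ (P.root j) = P.root i) (x : X) :
    P.coroot' i (τ x) = P.coroot' j x := by
  have hw := hW (P.reflection i) (Subgroup.subset_closure ⟨i, rfl⟩)
  have hj : P.reflection j ∈ weyl P := Subgroup.subset_closure ⟨j, rfl⟩
  have hu := mul_mem hw hj
  rw [weyl, ← range_weylGroup_weightHom] at hu
  obtain ⟨⟨u, hu⟩, hu'⟩ := hu
  have hux : ∀ x, u • x = x + (P.coroot' j x - P.coroot' i (τ x)) • P.root j := by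
    intro x
    have h1 : u • x = τ.symm (P.reflection i (τ (P.reflection j x))) := LinearEquiv.congr_fun hu' x
    have h2 : τ.symm (P.root i) = P.root j := by rw [← hij, LinearEquiv.symm_apply_apply]
    have h3 : P.coroot' i (P.root i) = 2 := P.root_coroot_two i
    rw [h1, reflection_apply, reflection_apply, map_sub, map_sub, map_sub, map_sub, τ.map_smul, hij,
      (P.coroot' i).map_smul, τ.symm.map_smul, τ.symm.map_smul, h2, τ.symm_apply_apply, h3]
    module
  have hpow : ∀ n : ℕ, u ^ n • x = x + (n : ℤ) • (P.coroot' j x - P.coroot' i (τ x)) • P.root j := by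
    intro n
    have h0 : P.coroot' j (P.root j) - P.coroot' i (τ (P.root j)) = 0 := by
      rw [hij, show P.coroot' j (P.root j) = 2 from P.root_coroot_two j,
        show P.coroot' i (P.root i) = 2 from P.root_coroot_two i, sub_self]
    have h1 : u • P.root j = P.root j := by rw [hux, h0, zero_smul, add_zero]
    induction n with
    | zero => simp
    | succ n ih =>
      rw [pow_succ', mul_smul, ih, smul_add, hux, smul_comm u (n : ℤ), smul_comm u (_ : ℤ) (P.root j), h1]
      push_cast
      module
  have h := hpow (rootOrder u)
  rw [exists_pow_eq_one_of_mem_weylGroup Δ hu, one_smul, left_eq_add, smul_smul, smul_eq_zero] at h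
  have h2 := (mul_eq_zero.mp (h.resolve_right (P.ne_zero j))).resolve_left
    (by exact_mod_cast (rootOrder_pos u).ne')
  exact (sub_eq_zero.mp h2).symm

/-- A linear automorphism that permutes the roots and normalizes the Weyl group comes from an
automorphism of the root datum. -/
lemma exists_aut_of_normalizes [Module.IsTorsionFree ℤ X] (Δ : P.Base) {τ : X ≃ₗ[ℤ] X}
    (hroot : ∀ i, τ.symm (P.root i) ∈ Set.range P.root)
    (hW : ∀ w ∈ weyl P, τ⁻¹ * w * τ ∈ weyl P) : ∃ t : P.Aut, Equiv.weightHom P t = τ := by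
  obtain ⟨e, he⟩ := exists_perm_of_symm_mem_roots hroot
  -- The transpose of τ under the perfect pairing.
  let D : Y ≃ₗ[ℤ] Y := P.flip.toPerfPair.trans (τ.dualMap.trans P.flip.toPerfPair.symm)
  have hD : ∀ x y, P.toLinearMap x (D y) = P.toLinearMap (τ x) y := fun x y ↦ by
    simp only [D, LinearEquiv.trans_apply]
    exact LinearMap.apply_toPerfPair_flip P.toLinearMap _ x
  have hinj : ∀ y y' : Y, (∀ x, P.toLinearMap x y = P.toLinearMap x y') → y = y' := fun y y' h ↦
    P.flip.toPerfPair.injective (LinearMap.ext h)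
  refine ⟨{ weightMap := τ
            coweightMap := D
            indexEquiv := e
            weight_coweight_transpose := ?_
            root_weightMap := ?_
            coroot_coweightMap := ?_
            bijective_weightMap := τ.bijective
            bijective_coweightMap := D.bijective }, ?_⟩
  · ext y x
    exact (hD x y).symm
  · ext i
    exact he i
  · ext i
    refine hinj _ _ fun x ↦ ?_
    have := coroot'_eq_of_normalizes Δ hW (i := i) (j := e.symm i)
      (by rw [he, Equiv.apply_symm_apply]) x
    exact (hD x _).trans this
  · ext x
    rfl

variable {Δ : P.Base}

lemma mem_support_of_htForm {i : ι} (hi : htForm Δ (rt P i) = 1) (hpos : Δ.IsPos i) : i ∈ Δ.support := by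
  classical
  obtain ⟨α, hα⟩ := (isPos_iff_exists_coef Δ).mp hpos
  have h0 := IsPos.coef_nonneg Δ hpos
  rw [htForm_apply, ← Finset.add_sum_erase _ _ (Finset.mem_univ α)] at hi
  have h1 : ∑ β ∈ Finset.univ.erase α, coef Δ β (rt P i) = 0 :=
    le_antisymm (by linarith) (Finset.sum_nonneg fun β _ ↦ h0 β)
  have h2 := (Finset.sum_eq_zero_iff_of_nonneg fun β _ ↦ h0 β).mp h1
  have h3 : rt P i = rt P α := eq_of_coef Δ fun β ↦ by
    by_cases hβ : β = α
    · subst hβ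
      rw [coef_self]; linarith
    · rw [h2 β (by simp [hβ]), coef_ne Δ hβ]
  have h4 : i = α := P.root.injective (congrArg Subtype.val h3)
  rw [h4]
  exact α.2

/-- An automorphism preserving positivity does not lower the height of positive roots, and the
simple roots are those of height 1. -/
lemma smul_mem_support_of_isPos {σ : P.Aut} (h : ∀ i, Δ.IsPos i → Δ.IsPos (σ • i)) {j : ι}
    (hj : σ • j ∈ Δ.support) (hjpos : Δ.IsPos j) : j ∈ Δ.support := by
  refine mem_support_of_htForm ?_ hjpos
  have h1 : htForm Δ (σ • rt P j) = 1 := by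
    rw [← rt_smul, htForm_apply, ← height_eq, Base.height_one_of_mem_support hj]
  have h2 : htForm Δ (rt P j) ≤ htForm Δ (σ • rt P j) := by
    conv_rhs => rw [← sum_coef Δ (rt P j)]
    rw [htForm_apply, Finset.smul_sum, map_sum]
    refine Finset.sum_le_sum fun α _ ↦ ?_
    rw [smul_comm, (htForm Δ).map_smul, ← rt_smul, smul_eq_mul]
    have h3 := isPos_iff_htForm.mp (h α (Base.isPos_of_mem_support α.2))
    have h4 := IsPos.coef_nonneg Δ hjpos α
    nlinarith
  have h3 := isPos_iff_htForm.mp hjpos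
  linarith

/-- An automorphism that preserves the positive roots permutes the simple roots. -/
lemma stable_of_isPos {σ : P.Aut} (h : ∀ i, Δ.IsPos i → Δ.IsPos (σ⁻¹ • i)) (i : ι) :
    σ • i ∈ Δ.support ↔ i ∈ Δ.support := by
  have hneg : ∀ i, Δ.IsPos (σ⁻¹ • i) → Δ.IsPos i := by
    intro i hi
    by_contra hn
    rw [← isPos_refl_self] at hn
    have := h _ hn
    have e : σ⁻¹ • refl P i • i = refl P (σ⁻¹ • i) • σ⁻¹ • i := by
      rw [refl_conj, _root_.inv_inv, smul_smul, smul_smul]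
      congr 1
      group
    rw [e, isPos_refl_self] at this
    exact this hi
  have h' : ∀ i, Δ.IsPos i → Δ.IsPos (σ • i) := fun i hi ↦ hneg _ (by rwa [inv_smul_smul])
  constructor
  · intro hi
    refine smul_mem_support_of_isPos h' hi ?_
    have := h _ (Base.isPos_of_mem_support hi)
    rwa [inv_smul_smul] at this
  · intro hi
    refine smul_mem_support_of_isPos (σ := σ⁻¹) h (by rwa [inv_smul_smul]) ?_
    exact h' _ (Base.isPos_of_mem_support hi)

lemma wordProd_reverse_map (σ : P.Aut) (l : List ι) :
    wordProd P (l.map (σ • ·)).reverse = σ * (wordProd P l)⁻¹ * σ⁻¹ := by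
  induction l with
  | nil => simp only [List.map_nil, List.reverse_nil, wordProd_nil]; group
  | cons i l ih =>
    rw [List.map_cons, List.reverse_cons, wordProd_append, ih, wordProd_cons, wordProd_cons, wordProd_nil,
      refl_conj, mul_inv_rev (refl P i), Equiv.reflection_inv]
    group

/-- If `w` is a twisted Coxeter element for `σ = τw`, then `τ` is the product of another one
with `σ`. -/
lemma exists_isCoxWord {τ : P.Aut} {w : X ≃ₗ[ℤ] X}
    (hw : IsTwistedCoxeter Δ (Equiv.weightHom P τ * w) w)
    (hpos : ∀ i j, Δ.IsPos i → (Equiv.weightHom P τ * w) (P.root j) = P.root i → Δ.IsPos j) :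
    ∃ (σ : P.Aut) (l : List ι), IsCoxWord Δ σ l ∧ wordProd P l * σ = τ := by
  obtain ⟨l, ⟨hl, rfl⟩, -, hnd, htr⟩ := hw
  rw [← weightHom_wordProd, ← map_mul] at htr hpos
  set σ := τ * wordProd P l with hσ
  have hstab : ∀ i, σ • i ∈ Δ.support ↔ i ∈ Δ.support := stable_of_isPos fun i hi ↦
    hpos i _ hi (by rw [weightHom_root, smul_inv_smul])
  -- From σ = τw one gets τ = (σw⁻¹σ⁻¹)σ; the word of the first factor is that of w reversed and
  -- moved by σ.
  refine ⟨σ, (l.map (σ • ·)).reverse, ⟨hstab, ?_, ?_, fun j hj ↦ ?_⟩, ?_⟩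
  · intro i hi
    obtain ⟨a, ha, rfl⟩ := List.mem_map.mp (List.mem_reverse.mp hi)
    exact (hstab a).mpr (hl a ha)
  · exact List.nodup_reverse.mpr (hnd.map (MulAction.injective σ))
  · obtain ⟨i, ⟨hi, m, hm⟩, huniq⟩ := htr j hj
    rw [weightHom_zpow_root] at hm
    refine ⟨σ • i, ⟨by simpa using hi, 1 + m, by rw [zpow_add, zpow_one, mul_smul, hm]⟩, ?_⟩
    rintro i' ⟨hi', m', hm'⟩
    obtain ⟨a, ha, rfl⟩ := List.mem_map.mp (List.mem_reverse.mp hi')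
    rw [huniq a ⟨ha, -1 + m', ?_⟩]
    rw [weightHom_zpow_root, zpow_add, mul_smul, hm', zpow_neg_one, inv_smul_smul]
  · rw [wordProd_reverse_map, hσ]
    group

/-- The coefficients of a root are bounded by the largest coefficient of the highest root. -/
lemma abs_coef_le_maxMark {i₀ : ι} (hi₀ : IsHighestRoot Δ i₀) (α : Δ.support) (i : ι) :
    |coef Δ α (rt P i)| ≤ maxMark Δ i₀ := by
  have h1 : ∀ j, coef Δ α (rt P j) ≤ coef Δ α (rt P i₀) := by
    intro j
    have := coef_nonneg_of_mem Δ (x := rt P i₀ - rt P j) (hi₀ j) α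
    rw [map_sub] at this
    linarith
  have h2 : coef Δ α (rt P i₀) ≤ maxMark Δ i₀ :=
    le_ciSup (f := fun α : Δ.support ↦ fundCoweight Δ α (P.rootSpanMem ℤ i₀))
      (Set.finite_range _).bddAbove α
  have h3 := h1 (refl P i • i)
  rw [rt_refl_self, map_neg] at h3
  exact abs_le.mpr ⟨by linarith, (h1 i).trans h2⟩

end Automorphisms

end CoxeterTorus

namespace CoxeterTorus
open RootPairing

/-! ### Frobenius and conjugation on rational subgroups and Lie algebras. -/

section RationalStructures

variable {n : ℕ} {k Ω : Type*} [Field k] [Field Ω] [Algebra k Ω]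
  {H : Subgroup (GL (Fin n) Ω)}

/-- Equations over k generate the ideal and have coefficients fixed by the Frobenius. This gives the
Frobenius stability of both points and Lie algebras. -/
lemma vanishing_le_ker {A : Type*} [CommRing A] (hH : IsDefinedOver k H)
    (φ : MvPolynomial (Fin n × Fin n) Ω →+* A)
    (h : ∀ p, MvPolynomial.map (algebraMap k Ω) p ∈ vanishing H →
      φ (MvPolynomial.map (algebraMap k Ω) p) = 0) {f : MvPolynomial (Fin n × Fin n) Ω}
    (hf : f ∈ vanishing H) : φ f = 0 := by
  have : vanishing H ≤ RingHom.ker φ := by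
    rw [← hH.2, Ideal.map_le_iff_le_comap]
    exact fun p hp ↦ h p hp
  exact this hf

lemma frobGL_mem (Fr : Ω ≃ₐ[k] Ω) (hH : IsDefinedOver k H) {g : GL (Fin n) Ω} (hg : g ∈ H) :
    frobGL Fr g ∈ H := by
  refine hH.1 _ fun f hf ↦ vanishing_le_ker hH (MvPolynomial.eval _) (fun p hp ↦ ?_) hf
  have h := congrArg Fr (hp g hg)
  rw [MvPolynomial.eval_map, map_zero] at h
  rw [MvPolynomial.eval_map, ← h]
  change _ = (Fr : Ω →+* Ω) _
  rw [MvPolynomial.hom_eval₂]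
  congr 1
  ext x
  exact (Fr.commutes x).symm

lemma frobGL_symm_apply (Fr : Ω ≃ₐ[k] Ω) (g : GL (Fin n) Ω) : frobGL Fr (frobGL Fr.symm g) = g := by
  ext i j
  exact Fr.apply_symm_apply _

/-- A field automorphism, applied to the dual numbers. -/
def dualMap (Fr : Ω ≃ₐ[k] Ω) : DualNumber Ω →+* DualNumber Ω where
  toFun x := TrivSqZeroExt.inl (Fr x.fst) + TrivSqZeroExt.inr (Fr x.snd)
  map_one' := by ext <;> simp
  map_zero' := by ext <;> simp
  map_mul' x y := by ext <;> simp
  map_add' x y := by ext <;> simp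

lemma lieAlg_map (Fr : Ω ≃ₐ[k] Ω) (hH : IsDefinedOver k H) {N : Matrix (Fin n) (Fin n) Ω}
    (hN : N ∈ lieAlg H) : N.map Fr ∈ lieAlg H := by
  intro f hf
  refine vanishing_le_ker hH (MvPolynomial.aeval _ : _ →ₐ[Ω] DualNumber Ω).toRingHom (fun p hp ↦ ?_) hf
  have h := congrArg (dualMap Fr) (hN _ hp)
  rw [map_zero, MvPolynomial.aeval_def, MvPolynomial.eval₂_map, MvPolynomial.hom_eval₂] at h
  change MvPolynomial.aeval _ _ = 0
  rw [MvPolynomial.aeval_def, MvPolynomial.eval₂_map, ← h]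
  congr 1
  · ext x
    · simp [dualMap, TrivSqZeroExt.algebraMap_eq_inl]
    · simp [dualMap, TrivSqZeroExt.algebraMap_eq_inl]
  · ext p
    · simp [dualMap, Matrix.one_apply, apply_ite]
    · simp [dualMap]

/-- Conjugation, on polynomials in the matrix entries. -/
def conjPoly (g : GL (Fin n) Ω) :
    MvPolynomial (Fin n × Fin n) Ω →ₐ[Ω] MvPolynomial (Fin n × Fin n) Ω :=
  MvPolynomial.aeval fun p ↦ ∑ a, ∑ b, MvPolynomial.C ((g : Matrix (Fin n) (Fin n) Ω) p.1 a) *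
    MvPolynomial.X (a, b) * MvPolynomial.C (((g⁻¹ : GL (Fin n) Ω) : Matrix (Fin n) (Fin n) Ω) b p.2)

lemma aeval_conjPoly {A : Type*} [CommRing A] [Algebra Ω A] (g : GL (Fin n) Ω)
    (M : Matrix (Fin n) (Fin n) A) (f : MvPolynomial (Fin n × Fin n) Ω) :
    MvPolynomial.aeval (fun p : Fin n × Fin n ↦ M p.1 p.2) (conjPoly g f) =
      MvPolynomial.aeval (fun p : Fin n × Fin n ↦ ((g : Matrix (Fin n) (Fin n) Ω).map (algebraMap Ω A) * M *
        ((g⁻¹ : GL (Fin n) Ω) : Matrix (Fin n) (Fin n) Ω).map (algebraMap Ω A)) p.1 p.2) f := by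
  rw [conjPoly, ← AlgHom.comp_apply]
  congr 1
  ext p
  rw [AlgHom.comp_apply, MvPolynomial.aeval_X, MvPolynomial.aeval_X, map_sum, Matrix.mul_assoc,
    Matrix.mul_apply]
  refine Finset.sum_congr rfl fun a _ ↦ ?_
  rw [Matrix.mul_apply, map_sum, Finset.mul_sum]
  refine Finset.sum_congr rfl fun b _ ↦ ?_
  rw [map_mul, map_mul, MvPolynomial.aeval_C, MvPolynomial.aeval_C, MvPolynomial.aeval_X, mul_assoc]
  rfl

lemma conjPoly_mem {g : GL (Fin n) Ω} {f : MvPolynomial (Fin n × Fin n) Ω}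
    (hf : f ∈ vanishing (H.map (MulAut.conj g).toMonoidHom)) : conjPoly g f ∈ vanishing H := by
  intro x hx
  have h1 := hf (g * x * g⁻¹) ⟨x, hx, rfl⟩
  have h2 := aeval_conjPoly g (x : Matrix (Fin n) (Fin n) Ω) f
  simp only [MvPolynomial.aeval_eq_eval, Algebra.algebraMap_self] at h2
  exact h2.trans h1

/-- Over the dual numbers, conjugating 1 + εN by g gives 1 + εgNg⁻¹. -/
lemma lieAlg_conj (g : GL (Fin n) Ω) {N : Matrix (Fin n) (Fin n) Ω} (hN : N ∈ lieAlg H) :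
    (g : Matrix (Fin n) (Fin n) Ω) * N * ((g⁻¹ : GL (Fin n) Ω) : Matrix (Fin n) (Fin n) Ω) ∈
      lieAlg (H.map (MulAut.conj g).toMonoidHom) := by
  intro f hf
  have h1 := hN _ (conjPoly_mem hf)
  have h2 := aeval_conjPoly g (A := DualNumber Ω) (Matrix.of fun i j ↦
    (TrivSqZeroExt.inl ((1 : Matrix (Fin n) (Fin n) Ω) i j) + TrivSqZeroExt.inr (N i j) : DualNumber Ω)) f
  simp only [Matrix.of_apply] at h2
  rw [h1] at h2
  rw [h2]
  congr 2
  ext p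
  · have : (g : Matrix (Fin n) (Fin n) Ω) * 1 * ((g⁻¹ : GL (Fin n) Ω) : Matrix (Fin n) (Fin n) Ω) = 1 := by
      rw [mul_one, ← Units.val_mul, mul_inv_cancel, Units.val_one]
    have := congrFun (congrFun this p.1) p.2
    rw [Matrix.mul_apply] at this
    simp only [Matrix.mul_apply, TrivSqZeroExt.fst_sum, TrivSqZeroExt.fst_mul, Matrix.map_apply,
      TrivSqZeroExt.algebraMap_eq_inl, TrivSqZeroExt.fst_inl, Matrix.of_apply, TrivSqZeroExt.fst_add,
      TrivSqZeroExt.fst_inr, add_zero] at this ⊢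
    exact this.symm
  · simp only [Matrix.mul_apply, TrivSqZeroExt.snd_sum, TrivSqZeroExt.snd_mul, Matrix.map_apply,
      TrivSqZeroExt.algebraMap_eq_inl, TrivSqZeroExt.fst_inl, TrivSqZeroExt.snd_inl, Matrix.of_apply,
      TrivSqZeroExt.snd_add, TrivSqZeroExt.snd_inr, zero_add, smul_zero, smul_eq_mul,
      TrivSqZeroExt.fst_sum, TrivSqZeroExt.fst_mul, add_zero, mul_zero,
      MulOpposite.smul_eq_mul_unop, MulOpposite.unop_op]

lemma map_conj_inv (g : GL (Fin n) Ω) (H : Subgroup (GL (Fin n) Ω)) :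
    (H.map (MulAut.conj g).toMonoidHom).map (MulAut.conj g⁻¹).toMonoidHom = H := by
  rw [Subgroup.map_map]
  convert! Subgroup.map_id H
  refine MonoidHom.ext fun x ↦ ?_
  change g⁻¹ * (g * x * g⁻¹) * g⁻¹⁻¹ = x
  group

lemma coe_frobGL (Fr : Ω ≃ₐ[k] Ω) (g : GL (Fin n) Ω) :
    (frobGL Fr g : Matrix (Fin n) (Fin n) Ω) = (g : Matrix (Fin n) (Fin n) Ω).map Fr := rfl

/-- Transport of weights along the Frobenius, conjugated by `g`. -/
lemma IsWeight.of_frob {X : Type*} [AddCommGroup X] (Fr : Ω ≃ₐ[k] Ω) {H₀ T₀ H T : Subgroup (GL (Fin n) Ω)}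
    {g : GL (Fin n) Ω} (hH₀ : IsDefinedOver k H₀) (hT₀ : IsDefinedOver k T₀)
    (hH : H₀.map (MulAut.conj g).toMonoidHom = H) (hT : T₀.map (MulAut.conj g).toMonoidHom = T)
    {ch : Multiplicative X →* (T →* Ωˣ)} (hch : Function.Injective ch) {x y : X}
    (hxy : ∀ t t' : T, (t' : GL (Fin n) Ω) = g * frobGL Fr (g⁻¹ * (t : GL (Fin n) Ω) * g) * g⁻¹ →
      (ch (Multiplicative.ofAdd y) t' : Ω) = Fr (ch (Multiplicative.ofAdd x) t : Ω))
    (hx : IsWeight H (ch (Multiplicative.ofAdd x))) (hy : y ≠ 0) :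
    IsWeight H (ch (Multiplicative.ofAdd y)) := by
  obtain ⟨-, N, hN, hN0, hw⟩ := hx
  have hH' : H.map (MulAut.conj g⁻¹).toMonoidHom = H₀ := by rw [← hH, map_conj_inv]
  have hT' : T.map (MulAut.conj g⁻¹).toMonoidHom = T₀ := by rw [← hT, map_conj_inv]
  -- The new weight vector is the image of N under the Frobenius twisted by g.
  refine ⟨fun h ↦ hy ?_, (g : Matrix (Fin n) (Fin n) Ω) *
    (((g⁻¹ : GL (Fin n) Ω) : Matrix (Fin n) (Fin n) Ω) * N * (g : Matrix (Fin n) (Fin n) Ω)).map Fr *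
    ((g⁻¹ : GL (Fin n) Ω) : Matrix (Fin n) (Fin n) Ω), ?_, ?_, ?_⟩
  · exact Multiplicative.ofAdd.injective (hch (h.trans (map_one ch).symm))
  · rw [← hH]
    apply lieAlg_conj
    apply lieAlg_map Fr hH₀
    have := lieAlg_conj g⁻¹ hN
    rwa [hH', inv_inv] at this
  · intro h0
    rw [Units.mul_left_eq_zero, Units.mul_right_eq_zero] at h0
    have h1 : ((g⁻¹ : GL (Fin n) Ω) : Matrix (Fin n) (Fin n) Ω) * N * (g : Matrix (Fin n) (Fin n) Ω) = 0 := by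
      ext i j
      exact Fr.injective ((congrFun (congrFun h0 i) j).trans (map_zero Fr).symm)
    rw [Units.mul_left_eq_zero, Units.mul_right_eq_zero] at h1
    exact hN0 h1
  · intro t
    have ht₀ : g⁻¹ * (t : GL (Fin n) Ω) * g ∈ T₀ := by
      rw [← hT']
      exact ⟨t, t.2, by simp⟩
    have hs : g * frobGL Fr.symm (g⁻¹ * (t : GL (Fin n) Ω) * g) * g⁻¹ ∈ T := by
      exact hT.le ⟨_, frobGL_mem Fr.symm hT₀ ht₀, rfl⟩
    -- The preimage of t under the twisted Frobenius; the eigenvector equation at s becomes the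
    -- required one at t.
    set s : T := ⟨_, hs⟩ with hs_def
    have hst : g * frobGL Fr (g⁻¹ * (s : GL (Fin n) Ω) * g) * g⁻¹ = t := by
      have : g⁻¹ * (s : GL (Fin n) Ω) * g = frobGL Fr.symm (g⁻¹ * (t : GL (Fin n) Ω) * g) := by
        rw [hs_def]; group
      rw [this, frobGL_symm_apply]
      group
    rw [hxy s t hst.symm]
    have h1 := hw s
    set c : Ω := (ch (Multiplicative.ofAdd x) s : Ω)
    set r := g⁻¹ * (s : GL (Fin n) Ω) * g with hr
    set A := ((g⁻¹ : GL (Fin n) Ω) : Matrix (Fin n) (Fin n) Ω) * N * (g : Matrix (Fin n) (Fin n) Ω) with hA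
    have h2 : (r : Matrix (Fin n) (Fin n) Ω) * A * ((r⁻¹ : GL (Fin n) Ω) : Matrix (Fin n) (Fin n) Ω) = c • A := by
      rw [hA, ← Matrix.smul_mul, ← Matrix.mul_smul, ← h1, hr]
      simp only [mul_inv_rev, _root_.inv_inv, Units.val_mul, Matrix.mul_assoc, Units.mul_inv_cancel_left]
    have h3 := congrArg (fun M ↦ Matrix.map M Fr) h2
    simp only [Matrix.map_mul] at h3
    rw [← hst]
    have h4 : (c • A).map Fr = Fr c • A.map Fr := by
      ext i j
      simp
    rw [h4] at h3
    rw [← Matrix.smul_mul, ← Matrix.mul_smul, ← h3, ← coe_frobGL, ← coe_frobGL, map_inv]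
    simp only [mul_inv_rev, _root_.inv_inv, Units.val_mul, Matrix.mul_assoc, Units.inv_mul_cancel_left]

end RationalStructures

end CoxeterTorus

namespace CoxeterTorus
open RootPairing

/-! ### Frobenius as an automorphism of the root datum and a Coxeter element. -/

section FrobeniusAction

variable {n : ℕ} {k Ω : Type*} [Field k] [Field Ω] [Algebra k Ω] {Fr : Ω ≃ₐ[k] Ω}
  {G T B : Subgroup (GL (Fin n) Ω)}

lemma map_conj_frobGL (hT : IsDefinedOver k T) {g : GL (Fin n) Ω}
    (hg : T.map (MulAut.conj g).toMonoidHom = T) :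
    T.map (MulAut.conj (frobGL Fr g)).toMonoidHom = T := by
  have hg' : T.map (MulAut.conj g⁻¹).toMonoidHom = T := by
    conv_rhs => rw [← map_conj_inv g T, hg]
  apply le_antisymm
  · rintro _ ⟨t, ht, rfl⟩
    have h1 := frobGL_mem Fr hT (hg.le ⟨_, frobGL_mem Fr.symm hT ht, rfl⟩)
    change frobGL Fr (g * frobGL Fr.symm t * g⁻¹) ∈ T at h1
    rw [map_mul, map_mul, map_inv, frobGL_symm_apply] at h1
    exact h1
  · intro t ht
    have h1 := frobGL_mem Fr hT (hg'.le ⟨_, frobGL_mem Fr.symm hT ht, rfl⟩)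
    change frobGL Fr (g⁻¹ * frobGL Fr.symm t * g⁻¹⁻¹) ∈ T at h1
    rw [map_mul, map_mul, map_inv, map_inv, map_inv, frobGL_symm_apply] at h1
    refine ⟨_, h1, ?_⟩
    change frobGL Fr g * ((frobGL Fr g)⁻¹ * t * (frobGL Fr g)⁻¹⁻¹) * (frobGL Fr g)⁻¹ = t
    group

variable {ι X Y : Type*} [Finite ι] [AddCommGroup X] [AddCommGroup Y] {P : RootPairing ι ℤ X Y}
  {ch : Multiplicative X →* (T →* Ωˣ)}

lemma ch_ext (hch : Function.Injective ch) {x y : X}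
    (h : ∀ t : T, (ch (Multiplicative.ofAdd x) t : Ω) = ch (Multiplicative.ofAdd y) t) : x = y :=
  Multiplicative.ofAdd.injective (hch (MonoidHom.ext fun t ↦ Units.ext (h t)))

/-- The Frobenius acts on the characters of a rational torus as an automorphism of the root datum. -/
lemma exists_aut_of_frob (hG : IsDefinedOver k G) (hT : IsDefinedOver k T)
    (hP : IsRootDatumOf G T P ch) (Δ : P.Base) {τ : X ≃ₗ[ℤ] X} (hτ : IsFrobAction Fr ch τ) :
    ∃ t : P.Aut, Equiv.weightHom P t = τ := by
  have := hP.reduced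
  have : Module.IsReflexive ℤ X := .of_isPerfPair P.toLinearMap
  have hone : ∀ H : Subgroup (GL (Fin n) Ω), H.map (MulAut.conj 1).toMonoidHom = H := fun H ↦ by
    rw [map_one]
    exact Subgroup.map_id H
  refine exists_aut_of_normalizes Δ (fun i ↦ ?_) fun w hw ↦ ?_
  · refine (hP.roots _).mpr (IsWeight.of_frob Fr (x := P.root i) hG hT (hone G) (hone T) hP.injective
      (fun t t' h ↦ ?_) ((hP.roots _).mp ⟨i, rfl⟩) ?_)
    · rw [hτ _ t t' (by rw [h]; group), LinearEquiv.apply_symm_apply]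
    · rw [ne_eq, LinearEquiv.map_eq_zero_iff]
      exact P.ne_zero i
  · obtain ⟨g, hg, hgT, hact⟩ := hP.normalizer_of_weyl w hw
    have hg' : T.map (MulAut.conj g⁻¹).toMonoidHom = T := by
      conv_rhs => rw [← map_conj_inv g T, hgT]
    -- If g represents w, then F(g) represents τ⁻¹wτ.
    obtain ⟨w', hw', hact'⟩ := hP.weyl_of_normalizer _ (frobGL_mem Fr hG hg) (map_conj_frobGL hT hgT)
    convert! hw'
    refine LinearEquiv.ext fun x ↦ τ.injective ?_
    change τ (τ.symm (w (τ x))) = τ (w' x)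
    rw [LinearEquiv.apply_symm_apply]
    refine ch_ext hP.injective fun t ↦ Fr.injective ?_
    have hs : g⁻¹ * (t : GL (Fin n) Ω) * g ∈ T := hg'.le ⟨t, t.2, by simp⟩
    rw [hact (τ x) t ⟨_, hs⟩ rfl, ← hτ x ⟨_, hs⟩ ⟨_, frobGL_mem Fr hT hs⟩ rfl,
      ← hτ (w' x) t ⟨_, frobGL_mem Fr hT t.2⟩ rfl]
    rw [hact' x _ ⟨_, frobGL_mem Fr hT hs⟩ (by simp only [map_mul, map_inv])]

/-- The Frobenius of a Coxeter pair acts as a twisted Coxeter element. -/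
lemma exists_isCoxWord_of_isCoxeterPair {K : Type*} [Field K] [Algebra K Ω] (hT : IsDefinedOver k T)
    (hP : IsRootDatumOf G T P ch) {t : P.Aut} (hτ : IsFrobAction Fr ch (Equiv.weightHom P t))
    {Δ : P.Base} (hΔ : IsBaseOf B ch Δ) (hCox : IsCoxeterPair k K Fr G T B ch (Equiv.weightHom P t) Δ) :
    ∃ (σ : P.Aut) (l : List ι), IsCoxWord Δ σ l ∧ wordProd P l * σ = t := by
  have := hP.reduced
  obtain ⟨T₀, B₀, gK, g, w, -, hT₀, -, hB₀, -, -, -, hTg, hBg, hact, hw⟩ := hCox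
  refine exists_isCoxWord hw fun i j hi hij ↦ ?_
  rw [hΔ] at hi ⊢
  -- As B₀ is rational, B is stable under the Frobenius twisted by g, which acts on characters
  -- through τw. Hence τw respects positivity.
  refine IsWeight.of_frob Fr hB₀ hT₀ hBg hTg hP.injective (fun s s' h ↦ ?_) hi (P.ne_zero j)
  rw [← hij, LinearEquiv.mul_apply, ← hτ _ s ⟨_, frobGL_mem Fr hT s.2⟩ rfl,
    hact _ _ s' (by rw [h]; simp only [map_mul, map_inv, mul_inv_rev, _root_.inv_inv, mul_assoc])]

end FrobeniusAction

end CoxeterTorus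

end

open CoxeterTorus IsLocalRing in
theorem proposition6p2
    -- `k` is a non-archimedean local field with ring of integers `𝒪`
    {𝒪 : Type*} [CommRing 𝒪] [IsDomain 𝒪] [IsDiscreteValuationRing 𝒪]
    [IsAdicComplete (maximalIdeal 𝒪) 𝒪] [Finite (ResidueField 𝒪)]
    {k : Type*} [Field k] [Algebra 𝒪 k] [IsFractionRing 𝒪 k]
    -- `K` is the completion of a maximal unramified extension of `k`, with ring of integers `R`
    {R : Type*} [CommRing R] [IsDomain R] [IsDiscreteValuationRing R]
    [IsAdicComplete (maximalIdeal R) R] [Algebra 𝒪 R] [IsLocalHom (algebraMap 𝒪 R)]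
    (hunram : (maximalIdeal 𝒪).map (algebraMap 𝒪 R) = maximalIdeal R)
    [IsAlgClosure (ResidueField 𝒪) (ResidueField R)]
    {K : Type*} [Field K] [Algebra R K] [IsFractionRing R K] [Algebra k K] [Algebra 𝒪 K]
    [IsScalarTower 𝒪 k K] [IsScalarTower 𝒪 R K]
    -- `Ω` is an algebraic closure of `K`, and `Fr` extends the Frobenius of `K/k` to `Ω`
    {Ω : Type*} [Field Ω] [Algebra K Ω] [IsAlgClosure K Ω] [Algebra k Ω] [IsScalarTower k K Ω]
    (q : ℕ) (hq : q = Nat.card (ResidueField 𝒪))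
    (Fr : Ω ≃ₐ[k] Ω)
    (hFr : ∀ x : R, ∃ y ∈ maximalIdeal R,
      Fr (algebraMap K Ω (algebraMap R K x)) = algebraMap K Ω (algebraMap R K (x ^ q + y)))
    -- `G` is a reductive group over `k`, `T` a `k`-rational maximal torus split over `K`, and `B` a
    -- Borel subgroup containing `T`
    {n : ℕ} (G T B : Subgroup (GL (Fin n) Ω))
    (hG : IsReductive G) (hGk : IsDefinedOver k G)
    (hT : IsMaximalTorus T G) (hTk : IsDefinedOver k T) (hTK : IsSplitOver K T)
    (hB : IsBorel B G) (hTB : T ≤ B)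
    -- `P` is the root datum of `(G, T)`, and `τ` the action of the Frobenius on `X = X^*(T)`
    {ι X Y : Type*} [Finite ι] [AddCommGroup X] [AddCommGroup Y] [Module.Finite ℤ X]
    [Module.Finite ℤ Y] (P : RootPairing ι ℤ X Y) (ch : Multiplicative X →* (T →* Ωˣ))
    (hP : IsRootDatumOf G T P ch)
    (τ : X ≃ₗ[ℤ] X) (hτ : IsFrobAction Fr ch τ)
    -- `Δ₀` is the set of simple roots of `B`; `(T, B)` is a Coxeter pair; the Dynkin diagram is
    -- connected
    (Δ₀ : P.Base) (hΔ₀ : IsBaseOf B ch Δ₀)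
    (hCox : IsCoxeterPair k K Fr G T B ch τ Δ₀)
    (hconn : IsConnectedDynkin Δ₀)
    -- `q > M`
    (i₀ : ι) (hi₀ : IsHighestRoot Δ₀ i₀) (hM : maxMark Δ₀ i₀ < (q : ℤ)) :
    ∃ Δ : P.Base,
      (∃ c ∈ weyl P, ∃ σ : X ≃ₗ[ℤ] X,
        -- `F` acts on `X^*(T)` as `q c σ`
        τ = c * σ ∧
        (∀ (t : TorusPts X (ResidueField R)) (x : X),
          frob q τ t (Multiplicative.ofAdd x) = t (Multiplicative.ofAdd (q • c (σ x)))) ∧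
        σ '' (P.root '' Δ.support) = P.root '' Δ.support ∧
        IsTwistedCoxeter Δ σ c ∧
        ∀ i : ℕ, 2 * i ≤ orderOnRoots P (c * σ) → len Δ (partialProd σ c i) = i * len Δ c) ∧
      (∀ (α : Δ.support) (ν : Y), IsCoweightLift Δ α ν → ∀ j : ι,
        ¬ idComponent (langPreimage (κ := ResidueField R) P q τ ν) ⊆ kerChar (P.root j)) := by
  have := hP.reduced
  obtain ⟨t, rfl⟩ := exists_aut_of_frob hGk hTk hP Δ₀ hτ
  obtain ⟨σ₀, l₀, H₀, rfl⟩ := exists_isCoxWord_of_isCoxeterPair hTk hP hτ hΔ₀ hCox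
  obtain ⟨u, -, σ, l, H, hτ', hlen⟩ := H₀.exists_reduced_partialProd hconn
  have : IsAlgClosed (ResidueField R) := IsAlgClosure.isAlgClosed (ResidueField 𝒪)
  have : Infinite (ResidueField R) := inferInstance
  rw [← hτ'] at hlen ⊢
  rw [map_mul] at hlen
  refine ⟨smulBase u Δ₀, ⟨RootPairing.Equiv.weightHom P (wordProd P l), weightHom_mem_weyl (wordProd_mem l),
    RootPairing.Equiv.weightHom P σ, map_mul _ _ _, fun s x ↦ ?_, H.image_support, H.isTwistedCoxeter, hlen⟩, ?_⟩
  · rw [ofAdd_nsmul, map_pow, map_mul]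
    rfl
  · intro α ν hν j
    refine not_idComponent_subset_kerChar hν (fun i ↦ ?_)
      (fun i ↦ H.exists_coef_ne_zero (isConnectedDynkin_smulBase u Δ₀ hconn) i α) j
    -- Coefficients for the new base are coefficients of translated roots for Δ₀, so the bound M
    -- still applies.
    rw [coef_smulBase, ← rt_smul]
    exact (abs_coef_le_maxMark hi₀ _ _).trans_lt hM
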